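/- Conventions. A class $\mathcal F$ of Boolean functions $f:\{-1,1\}^n\to\{-1,1\}$ is \emph{closed under restrictions} if fixing any of the variables of a member of $\mathcal F$ to values in $\{-1,1\}$ gives a member of $\mathcal F$ (still regarded as an $n$-variate function). Let $\hat f(S)=\mathbb E_{x}\bigl[f(x)\prod_{i\in S}x_i\bigr]$ for uniform $x\in\{-1,1\}^n$, and \[ M_k(\mathcal F)=\max_{f\in\mathcal F}\max_{x\in[-1,1]^n}\Bigl|\sum_{|S|=k}\hat f(S)\prod_{i\in S}x_i\Bigr|,\qquad L_{1,k}(\mathcal F)=\max_{f\in\mathcal F}\sum_{|S|=k}|\hat f(S)|. \] A map $G:\{-1,1\}^s\to\{-1,1\}^n$ is a \emph{PRG for $\mathcal F$ with error $\varepsilon$ and seed length $s$} if $|\mathbb E_{u}f(G(u))-\mathbb E_x f(x)|\le\varepsilon$ for all $f\in\mathcal F$, where $u$ and $x$ are uniform. A family of maps $G_{n,k,b,\varepsilon}:\{-1,1\}^{s(n,k,b,\varepsilon)}\to\{-1,1\}^n$ is \emph{explicit} if a fixed algorithm (a random access machine with logarithmic cost), given $n,k,\lceil b\rceil,\lceil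 1/\varepsilon\rceil$, computes $s=s(n,k,b,\varepsilon)$, and a fixed algorithm, given these numbers and the seed, computes the output of $G_{n,k,b,\varepsilon}$, both in time polynomial in $n$, $s$ and the binary lengths of $k,\lceil b\rceil,\lceil 1/\varepsilon\rceil$. The parameters range over integers $n\ge 2$, $k>2$ and reals $b\ge 1$, $0<\varepsilon\le 1$; the constants in $O(\cdot)$ are absolute. Theorem. (1) There is an explicit family of maps $G_{n,k,b,\varepsilon}$ with seed length \[ O\left(\frac{b^{2+\frac{4}{k-2}}\cdot k\log n\cdot\log^{1+\frac{2}{k-2}}(n/\varepsilon)}{\varepsilon^{\frac{2}{k-2}}}\right) \] such that $G_{n,k,b,\varepsilon}$ is a PRG with error $\varepsilon$ for every class $\mathcal F$ of $n$-variate Boolean functions that is closed under restrictions and satisfies $M_k(\mathcal F)\le b^k$. (2) There is an explicit family of maps $G_{n,k,b,\varepsilon}$ with seed length \[ O\left(\frac{b^{2+\frac{4}{k-2}}\cdot(\log\log n+\log k+\log(b/\varepsilon))\cdot\log^{1+\frac{2}{k-2}}(n/\varepsilon)}{\varepsilon^{\frac{2}{k-2}}}\right) \] such that $G_{n,k,b,\varepsilon}$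 is a PRG with error $\varepsilon$ for every class $\mathcal F$ of $n$-variate Boolean functions that is closed under restrictions and satisfies $M_k(\mathcal F)\le b^k$ and $L_{1,i}(\mathcal F)\le b^i$ for all $1\le i<k$. -/

import Mathlib

open scoped BigOperators

noncomputable section

/-! ### Boolean functions and their Fourier expansion -/

/-- The Boolean cube `{-1,1}^n`. -/
abbrev Cube (n : ℕ) : Type := Fin n → ℤˣ

/-- An `n`-variate Boolean function `{-1,1}^n → {-1,1}`. -/
abbrev BoolFn (n : ℕ) : Type := Cube n → ℤˣ

/-- The real number `1` or `-1` denoted by a sign. -/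
def signVal (u : ℤˣ) : ℝ := ((u : ℤ) : ℝ)

/-- The Fourier coefficient `f̂(S) = 𝔼_x [f(x) x^S]`, with `x` uniform on the cube. -/
def cubeFourierCoeff {n : ℕ} (f : BoolFn n) (S : Finset (Fin n)) : ℝ :=
  𝔼 x : Cube n, signVal (f x) * ∏ i ∈ S, signVal (x i)

/-- The level-`k` part `f_k(x) = ∑_{|S| = k} f̂(S) x^S` of the multilinear expansion. -/
def levelPart {n : ℕ} (k : ℕ) (f : BoolFn n) (x : Fin n → ℝ) : ℝ :=
  ∑ S ∈ (Finset.univ : Finset (Fin n)).powersetCard k, cubeFourierCoeff f S * ∏ i ∈ S, x i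

/-- The level-`k` absolute Fourier sum `M_k(f) = max_{x ∈ [-1,1]^n} |f_k(x)|`. -/
def absFourierSum {n : ℕ} (k : ℕ) (f : BoolFn n) : ℝ :=
  ⨆ x : Set.Icc (-1 : Fin n → ℝ) 1, |levelPart k f x|

/-- The level-`k` mass `L_{1,k}(f) = ∑_{|S| = k} |f̂(S)|`. -/
def fourierMass {n : ℕ} (k : ℕ) (f : BoolFn n) : ℝ :=
  ∑ S ∈ (Finset.univ : Finset (Fin n)).powersetCard k, |cubeFourierCoeff f S|

/-- `M_k(F) = max_{f ∈ F} M_k(f)`. -/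
def classAbsFourierSum {n : ℕ} (k : ℕ) (F : Set (BoolFn n)) : ℝ :=
  ⨆ f : F, absFourierSum k f.1

/-- `L_{1,k}(F) = max_{f ∈ F} L_{1,k}(f)`. -/
def classFourierMass {n : ℕ} (k : ℕ) (F : Set (BoolFn n)) : ℝ :=
  ⨆ f : F, fourierMass k f.1

/-- `F` is closed under restrictions: fixing any set `J` of the variables of an `f ∈ F` to any
values `z` gives a member of `F`, again regarded as a function of all `n` variables. -/
def ClosedUnderRestrictions {n : ℕ} (F : Set (BoolFn n)) : Prop :=
  ∀ f ∈ F, ∀ (J : Finset (Fin n)) (z : Cube n), (fun x : Cube n => f (J.piecewise z x)) ∈ F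

/-- `G(U_s)` is a pseudorandom generator for `F` with error `ε`. -/
def IsPRG {s n : ℕ} (G : Cube s → Cube n) (F : Set (BoolFn n)) (ε : ℝ) : Prop :=
  ∀ f ∈ F, |(𝔼 u : Cube s, signVal (f (G u))) - 𝔼 x : Cube n, signVal (f x)| ≤ ε

/-! ### Running time: structured programs for a random access machine, logarithmic cost -/

/-- The binary instructions. -/
inductive RamOp
  | add | sub | mul | div | mod | xor | and

/-- The function on natural numbers that an instruction computes (`sub` is truncated). -/
def RamOp.eval : RamOp → ℕ → ℕ → ℕ
  | .add, a, b => a + b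
  | .sub, a, b => a - b
  | .mul, a, b => a * b
  | .div, a, b => a / b
  | .mod, a, b => a % b
  | .xor, a, b => a ^^^ b
  | .and, a, b => a &&& b

/-- Programs. Registers are numbered by `ℕ` and hold natural numbers; a program names only
finitely many of them. -/
inductive Prog
  /-- store the constant `c` in register `r` -/
  | const (r c : ℕ)
  /-- apply an instruction to registers `a`, `b` and store the result in register `r` -/
  | op (o : RamOp) (r a b : ℕ)
  /-- run `p`, then `q` -/
  | seq (p q : Prog)
  /-- run `p` if register `r` is nonzero and `q` otherwise -/
  | ite (r : ℕ) (p q : Prog)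
  /-- run `p` again and again as long as register `r` is nonzero -/
  | loop (r : ℕ) (p : Prog)

/-- `p.Runs σ t τ`: started with register contents `σ`, the program `p` halts with register
contents `τ` after time `t`. Every instruction and every test costs one plus the total binary
length of the numbers it reads (logarithmic cost). -/
inductive Prog.Runs : Prog → (ℕ → ℕ) → ℕ → (ℕ → ℕ) → Prop
  | const (r c : ℕ) (σ : ℕ → ℕ) :
      Prog.Runs (.const r c) σ (1 + Nat.size c) (Function.update σ r c)
  | op (o : RamOp) (r a b : ℕ) (σ : ℕ → ℕ) :
      Prog.Runs (.op o r a b) σ (1 + Nat.size (σ a) + Nat.size (σ b))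
        (Function.update σ r (o.eval (σ a) (σ b)))
  | seq {p q : Prog} {σ τ υ : ℕ → ℕ} {t t' : ℕ} :
      Prog.Runs p σ t τ → Prog.Runs q τ t' υ → Prog.Runs (.seq p q) σ (t + t') υ
  | ite_pos {r : ℕ} {p q : Prog} {σ τ : ℕ → ℕ} {t : ℕ} :
      σ r ≠ 0 → Prog.Runs p σ t τ → Prog.Runs (.ite r p q) σ (1 + Nat.size (σ r) + t) τ
  | ite_neg {r : ℕ} {p q : Prog} {σ τ : ℕ → ℕ} {t : ℕ} :
      σ r = 0 → Prog.Runs q σ t τ → Prog.Runs (.ite r p q) σ (1 + Nat.size (σ r) + t) τ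
  | loop_done {r : ℕ} {p : Prog} {σ : ℕ → ℕ} :
      σ r = 0 → Prog.Runs (.loop r p) σ (1 + Nat.size (σ r)) σ
  | loop_step {r : ℕ} {p : Prog} {σ τ υ : ℕ → ℕ} {t t' : ℕ} :
      σ r ≠ 0 → Prog.Runs p σ t τ → Prog.Runs (.loop r p) τ t' υ →
      Prog.Runs (.loop r p) σ (1 + Nat.size (σ r) + t + t') υ

/-- Started with the numbers `input` in registers `0, 1, …` and zero in all others, the program
halts within time `T` with `out` in register `0`. -/
def Prog.OutputsWithin (p : Prog) (input : List ℕ) (out T : ℕ) : Prop :=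
  ∃ (t : ℕ) (τ : ℕ → ℕ), t ≤ T ∧ p.Runs (fun i => input.getD i 0) t τ ∧ τ 0 = out

/-- The string of signs `u` as a number: bit `i` is `1` exactly if `u i = -1`. -/
def signCode {m : ℕ} (u : Cube m) : ℕ := ∑ i : Fin m, if u i = -1 then 2 ^ (i : ℕ) else 0

/-- A family of generators `G n k b ε : {-1,1}^s → {-1,1}^n` with seed lengths `s = s n k b ε`
(`n ≥ 2`, `k > 2`, `b ≥ 1`, `0 < ε ≤ 1`) is explicit: there is one program that computes the seed
length, and one that computes the output of the generator from the seed, in time polynomial in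
`n`, `s` and the binary lengths of the other parameters. As a program cannot read a real number,
it receives `⌈b⌉` and `⌈1/ε⌉` in place of `b` and `ε`. -/
def IsExplicit (s : ℕ → ℕ → ℝ → ℝ → ℕ)
    (G : (n k : ℕ) → (b ε : ℝ) → Cube (s n k b ε) → Cube n) : Prop :=
  ∃ (P Q : Prog) (d : ℕ), ∀ (n k : ℕ) (b ε : ℝ), 2 ≤ n → 2 < k → 1 ≤ b → 0 < ε → ε ≤ 1 →
    P.OutputsWithin [n, k, ⌈b⌉₊, ⌈1 / ε⌉₊] (s n k b ε)
      ((n + s n k b ε + Nat.size k + Nat.size ⌈b⌉₊ + Nat.size ⌈1 / ε⌉₊) ^ d) ∧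
    ∀ u : Cube (s n k b ε),
      Q.OutputsWithin [n, k, ⌈b⌉₊, ⌈1 / ε⌉₊, signCode u] (signCode (G n k b ε u))
        ((n + s n k b ε + Nat.size k + Nat.size ⌈b⌉₊ + Nat.size ⌈1 / ε⌉₊) ^ d)

end

/-!
Both generators round a polarizing random walk (`walkPos`). The walk starts at the origin of
`[-1,1]^n`; a step moves coordinate `i` from `y i` to `y i + (1 - |y i|) p x i`, where `x` is a
pseudorandom direction in the cube, and the output is the vector of the signs of the final position.

*Error of a step.* On the multilinear extension of a Boolean function, the move from `y` is an average,
over random restrictions fixing variable `i` with probability `|y i|`, of moves from the origin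
(`mlExt_move`), so that a class closed under restrictions reduces every step to the first one. Along
the segment from `0` to `p x`, the extension is a polynomial in one variable, whose Taylor
coefficients at intermediate points are, by the same identity, averages of level-`k` parts of
restrictions at points of `[-2p,2p]^n`. Taylor's theorem with Lagrange remainder hence bounds all but
the levels below `k` by `(2p)^k M_k` (`abs_mlExt_sub_low_le`). The lower levels average out if
`x` is unbiased on sets of fewer than `k` coordinates; a small bias is enough if their Fourier masses
are bounded (`abs_expect_fractional_sub_le`).

*Rounding.* Nearly unbiased directions decrease the expected potential `√(1 - y ^ 2)` of each coordinate
by a factor `1 - p ^ 2 / 16` in each step (`expect_potential_step_le`), so that `O(log (n / ε) / p ^ 2)`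
steps leave the walk so close to the cube that rounding is harmless (`abs_expect_walk_sub_le`).

*Directions.* Computations take place in `F_2[x]/(x^N - 1)` with `N` a power of three. Packing the
coefficients into the digits of an integer turns multiplication into one integer product, one
remainder and one mask (`cycMul`). As `2` is a primitive root modulo `N`, the ring maps onto a field
with `2 ^ (2 N / 3)` elements (`exists_isSpreadRoot`). The directions of the first generator are the
values of a random polynomial of degree below `k` at distinct field elements, which are independent
in groups of fewer than `k` by Vandermonde's determinant (`expect_polyBit_eq_zero`). Those of the second
are inner products of a random vector with `C_i(α)`, where `α` is random and `C_i` is a polynomial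
whose exponents encode the residues of `i` modulo all small numbers. For a nonempty set of fewer
than `k` indices, some modulus isolates one of them (`exists_isolating_modulus`), so that the sum of
their polynomials is not zero and has few roots (`abs_expect_biasBit_le`).

*Explicitness.* Expressions and assignments in named variables are compiled to the register machine,
and `Exec` is a specification of a program's effect and cost with composition rules for sequences,
branches and loops. The walk is computed exactly, in integers (`walkPair`). If it takes more than `n`
random bits, the seed itself, of length `n`, is the output instead; otherwise all
parameters are at most `n`, and so the running time is polynomial (`isExplicit_gen`). The step length
is a power of two chosen so that the errors add up to at most `ε`, and `walkLen_le` compares the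
resulting number of steps with the bound of the theorem.
-/

noncomputable section

open Finset Polynomial

/-! ### Fourier expansion, restrictions and Taylor polynomials -/

theorem signVal_one : signVal 1 = 1 := by simp [signVal]

theorem signVal_neg_one : signVal (-1) = -1 := by simp [signVal]

theorem abs_signVal (u : ℤˣ) : |signVal u| = 1 := by
  rcases Int.units_eq_one_or u with rfl | rfl <;> simp [signVal]

theorem signVal_mul_self (u : ℤˣ) : signVal u * signVal u = 1 := by
  rcases Int.units_eq_one_or u with rfl | rfl <;> simp [signVal]

theorem abs_expect_le {Ω : Type*} [Fintype Ω] [Nonempty Ω] (g : Ω → ℝ) {c : ℝ}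
    (h : ∀ ω, |g ω| ≤ c) : |𝔼 ω, g ω| ≤ c := by
  rw [Fintype.expect_eq_sum_div_card, abs_div, Nat.abs_cast,
    div_le_iff₀ (by exact_mod_cast Fintype.card_pos)]
  calc |∑ ω, g ω| ≤ ∑ ω, |g ω| := abs_sum_le_sum_abs _ _
    _ ≤ ∑ _ω : Ω, c := sum_le_sum fun ω _ => h ω
    _ = c * Fintype.card Ω := by simp [mul_comm]

theorem expect_le_expect_of_fintype {Ω : Type*} [Fintype Ω] (g h : Ω → ℝ)
    (H : ∀ ω, g ω ≤ h ω) : 𝔼 ω, g ω ≤ 𝔼 ω, h ω := by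
  rw [Fintype.expect_eq_sum_div_card, Fintype.expect_eq_sum_div_card]
  gcongr
  exact H _

/-- Coordinates of a uniform point of the cube are independent. -/
theorem expect_cube_prod {n : ℕ} (φ : Fin n → ℤˣ → ℝ) :
    𝔼 z : Cube n, ∏ i, φ i (z i) = ∏ i, (φ i 1 + φ i (-1)) / 2 := by
  have h : ∀ i, (φ i 1 + φ i (-1)) = ∑ u : ℤˣ, φ i u := by
    intro i
    have : (univ : Finset ℤˣ) = {1, -1} := by decide
    rw [this, sum_pair (by decide)]
  rw [Fintype.expect_eq_sum_div_card, prod_div_distrib, prod_congr rfl fun i _ => h i,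
    prod_univ_sum, Fintype.piFinset_univ]
  simp

/-- Fourier coefficients of a real-valued function on the cube. -/
def realCoeff {n : ℕ} (g : Cube n → ℝ) (S : Finset (Fin n)) : ℝ :=
  𝔼 x : Cube n, g x * ∏ i ∈ S, signVal (x i)

/-- The multilinear extension of a real-valued function on the cube. -/
def mlExt {n : ℕ} (g : Cube n → ℝ) (y : Fin n → ℝ) : ℝ :=
  ∑ S, realCoeff g S * ∏ i ∈ S, y i

/-- The extension averages `g` against a product density, whose expectation is `1`. -/
theorem mlExt_eq_kernel {n : ℕ} (g : Cube n → ℝ) (y : Fin n → ℝ) :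
    mlExt g y = 𝔼 z : Cube n, g z * ∏ i, (1 + signVal (z i) * y i) := by
  simp only [mlExt, realCoeff, expect_mul]
  rw [← expect_sum_comm]
  refine expect_congr rfl fun z _ => ?_
  rw [prod_one_add, mul_sum, powerset_univ]
  refine sum_congr rfl fun S _ => ?_
  rw [prod_mul_distrib, mul_assoc]

theorem mlExt_signVal {n : ℕ} (g : Cube n → ℝ) (x : Cube n) :
    mlExt g (fun i => signVal (x i)) = g x := by
  rw [mlExt_eq_kernel, Fintype.expect_eq_sum_div_card, sum_eq_single x]
  · have : ∏ i, (1 + signVal (x i) * signVal (x i)) = (2 : ℝ) ^ n := by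
      simp [signVal_mul_self, one_add_one_eq_two]
    rw [this]
    simp
  · intro z _ hz
    obtain ⟨i, hi⟩ := Function.ne_iff.1 hz
    rw [prod_eq_zero (mem_univ i), mul_zero]
    rcases Int.units_eq_one_or (z i) with h | h <;>
      rcases Int.units_eq_one_or (x i) with h' | h' <;> simp_all [signVal]
  · simp

theorem mlExt_zero {n : ℕ} (g : Cube n → ℝ) : mlExt g 0 = 𝔼 z, g z := by
  rw [mlExt_eq_kernel]; simp

theorem mlExt_sum {n : ℕ} {ι : Type*} (s : Finset ι) (c : ι → ℝ) (g : ι → Cube n → ℝ)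
    (y : Fin n → ℝ) : mlExt (fun x => ∑ a ∈ s, c a * g a x) y = ∑ a ∈ s, c a * mlExt (g a) y := by
  simp only [mlExt_eq_kernel, sum_mul, mul_expect]
  rw [expect_sum_comm]
  simp only [mul_assoc]

/-- The extension of a restricted function is the extension at the restricted point. -/
theorem mlExt_restrict {n : ℕ} (g : Cube n → ℝ) (J : Finset (Fin n)) (s : Cube n)
    (y : Fin n → ℝ) :
    mlExt (fun x => g (J.piecewise s x)) y = mlExt g (J.piecewise (fun i => signVal (s i)) y) := by
  have h1 : (fun x => g (J.piecewise s x)) = fun x : Cube n =>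
      ∑ T, realCoeff g T * ∏ i ∈ T, signVal (J.piecewise s x i) := by
    funext x
    rw [← mlExt_signVal g]
    rfl
  rw [h1, mlExt_sum univ (realCoeff g) (fun T x => ∏ i ∈ T, signVal (J.piecewise s x i)), mlExt]
  refine sum_congr rfl fun T _ => ?_
  congr 1
  rw [mlExt_eq_kernel]
  set φ : Fin n → ℤˣ → ℝ := fun i u =>
    (if i ∈ T then (if i ∈ J then signVal (s i) else signVal u) else 1) * (1 + signVal u * y i)
    with hφ
  have h2 : ∀ z : Cube n, (∏ i ∈ T, signVal (J.piecewise s z i)) * ∏ i, (1 + signVal (z i) * y i)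
      = ∏ i, φ i (z i) := by
    intro z
    simp only [hφ]
    rw [← Fintype.prod_ite_mem T, ← prod_mul_distrib]
    refine prod_congr rfl fun i _ => ?_
    simp only [Finset.piecewise]
    split_ifs <;> simp
  rw [expect_congr rfl fun z _ => h2 z]
  rw [expect_cube_prod φ]
  rw [← Fintype.prod_ite_mem T]
  refine prod_congr rfl fun i _ => ?_
  simp only [hφ, Finset.piecewise, signVal_one, signVal_neg_one]
  split_ifs <;> ring

/-- The probability that the random restriction with parameters `|y i|` fixes the set `J`. -/
def restrictWeight {n : ℕ} (y : Fin n → ℝ) (J : Finset (Fin n)) : ℝ :=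
  (∏ i ∈ J, |y i|) * ∏ i ∈ univ \ J, (1 - |y i|)

theorem restrictWeight_nonneg {n : ℕ} {y : Fin n → ℝ} (hy : ∀ i, |y i| ≤ 1) (J : Finset (Fin n)) :
    0 ≤ restrictWeight y J :=
  mul_nonneg (prod_nonneg fun _ _ => abs_nonneg _)
    (prod_nonneg fun i _ => sub_nonneg.2 (hy i))

theorem sum_restrictWeight {n : ℕ} (y : Fin n → ℝ) : ∑ J, restrictWeight y J = 1 := by
  have := prod_add (fun i => |y i|) (fun i => 1 - |y i|) (univ : Finset (Fin n))
  rw [powerset_univ] at this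
  simp only [restrictWeight, ← this]
  simp

/-- The sign of a real number, as an element of `{-1,1}`, with sign `1` at zero. -/
def toSign (r : ℝ) : ℤˣ := if r < 0 then -1 else 1

theorem abs_mul_toSign (r : ℝ) : |r| * signVal (toSign r) = r := by
  unfold toSign
  split_ifs with h
  · rw [signVal_neg_one, abs_of_neg h]; ring
  · rw [signVal_one, abs_of_nonneg (not_lt.1 h)]; ring

/-- Moving from `y` by `(1 - |y|) ∘ x` averages the extension over random restrictions: variable
`i` is fixed to the sign of `y i` with probability `|y i|`. -/
theorem mlExt_move {n : ℕ} (g : Cube n → ℝ) (y x : Fin n → ℝ) :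
    mlExt g (fun i => y i + (1 - |y i|) * x i) =
      ∑ J, restrictWeight y J * mlExt (fun z => g (J.piecewise (fun i => toSign (y i)) z)) x := by
  simp only [mlExt_restrict]
  simp only [mlExt, mul_sum]
  rw [sum_comm]
  refine sum_congr rfl fun T _ => ?_
  simp only [mul_left_comm _ (realCoeff g T), ← mul_sum]
  congr 1
  have hA := prod_add (fun i => |y i| * (if i ∈ T then signVal (toSign (y i)) else 1))
    (fun i => (1 - |y i|) * (if i ∈ T then x i else 1)) (univ : Finset (Fin n))
  rw [powerset_univ] at hA
  trans ∏ i, (|y i| * (if i ∈ T then signVal (toSign (y i)) else 1) +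
    (1 - |y i|) * (if i ∈ T then x i else 1))
  · rw [← Fintype.prod_ite_mem T]
    refine prod_congr rfl fun i _ => ?_
    split_ifs
    · rw [abs_mul_toSign]
    · ring
  · rw [hA]
    refine sum_congr rfl fun J _ => ?_
    rw [prod_mul_distrib, prod_mul_distrib, restrictWeight, mul_mul_mul_comm]
    congr 1
    rw [← Fintype.prod_ite_mem T, ← prod_sdiff (subset_univ J), mul_comm]
    congr 1
    · refine prod_congr rfl fun i hi => ?_
      have : i ∉ J := (mem_sdiff.1 hi).2
      simp [Finset.piecewise, this]
    · refine prod_congr rfl fun i hi => ?_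
      simp [Finset.piecewise, hi]

/-- The real-valued function underlying a Boolean function. -/
def BoolFn.real {n : ℕ} (f : BoolFn n) : Cube n → ℝ := fun x => signVal (f x)

theorem mlExt_eq_sum_levelPart {n : ℕ} (f : BoolFn n) (y : Fin n → ℝ) :
    mlExt f.real y = ∑ i ∈ range (n + 1), levelPart i f y := by
  simp only [mlExt, levelPart]
  rw [← powerset_univ, sum_powerset]
  simp
  rfl

theorem levelPart_smul {n : ℕ} (k : ℕ) (f : BoolFn n) (c : ℝ) (y : Fin n → ℝ) :
    levelPart k f (fun i => c * y i) = c ^ k * levelPart k f y := by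
  simp only [levelPart, mul_sum]
  refine sum_congr rfl fun S hS => ?_
  rw [prod_mul_distrib, prod_const, (mem_powersetCard.1 hS).2]
  ring

theorem abs_levelPart_le_mass {n : ℕ} (k : ℕ) (f : BoolFn n) (y : Fin n → ℝ)
    (hy : ∀ i, |y i| ≤ 1) : |levelPart k f y| ≤ fourierMass k f := by
  refine (abs_sum_le_sum_abs _ _).trans (sum_le_sum fun S _ => ?_)
  rw [abs_mul, abs_prod]
  exact mul_le_of_le_one_right (abs_nonneg _)
    (prod_le_one (fun _ _ => abs_nonneg _) fun i _ => hy i)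

theorem abs_levelPart_le {n : ℕ} {k : ℕ} {F : Set (BoolFn n)} {f : BoolFn n} (hf : f ∈ F)
    {M : ℝ} (hM : classAbsFourierSum k F ≤ M) (y : Fin n → ℝ) (hy : ∀ i, |y i| ≤ 1) :
    |levelPart k f y| ≤ M := by
  have h1 : |levelPart k f y| ≤ absFourierSum k f := by
    refine le_ciSup (f := fun x : Set.Icc (-1 : Fin n → ℝ) 1 => |levelPart k f x|) ?_
      ⟨y, fun i => (abs_le.1 (hy i)).1, fun i => (abs_le.1 (hy i)).2⟩
    refine ⟨fourierMass k f, ?_⟩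
    rintro _ ⟨x, rfl⟩
    exact abs_levelPart_le_mass k f _ fun i => abs_le.2 ⟨x.2.1 i, x.2.2 i⟩
  have h2 : absFourierSum k f ≤ classAbsFourierSum k F :=
    le_ciSup (f := fun f : F => absFourierSum k f.1) (Set.finite_range _).bddAbove ⟨f, hf⟩
  exact h1.trans (h2.trans hM)

theorem fourierMass_le {n : ℕ} {k : ℕ} {F : Set (BoolFn n)} {f : BoolFn n} (hf : f ∈ F)
    {M : ℝ} (hM : classFourierMass k F ≤ M) : fourierMass k f ≤ M :=
  (le_ciSup (f := fun f : F => fourierMass k f.1) (Set.finite_range _).bddAbove ⟨f, hf⟩).trans hM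

/-- Taylor's theorem for a polynomial, with the Lagrange remainder written as a coefficient of the
polynomial expanded around an intermediate point. -/
theorem abs_eval_one_sub_sum_coeff_le (P : ℝ[X]) {k : ℕ} (hk : 0 < k) {M : ℝ}
    (h : ∀ ξ ∈ Set.Ioo (0 : ℝ) 1, |(taylor ξ P).coeff k| ≤ M) :
    |P.eval 1 - ∑ i ∈ range k, P.coeff i| ≤ M := by
  obtain ⟨m, rfl⟩ : ∃ m, k = m + 1 := ⟨k - 1, by omega⟩
  have hcd : ContDiff ℝ (m + 1) (fun x => P.eval x) := by
    simpa using P.contDiff_aeval (𝕜 := ℝ) (m + 1)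
  have hit : ∀ (j : ℕ) (x : ℝ), iteratedDeriv j (fun x => P.eval x) x =
      (j.factorial : ℝ) * (taylor x P).coeff j := by
    intro j x
    have e : iteratedDeriv j (fun x => P.eval x) = fun x => (derivative^[j] P).eval x := by
      induction j with
      | zero => simp
      | succ j ih =>
        rw [iteratedDeriv_succ, ih]
        funext x
        rw [Polynomial.deriv, Function.iterate_succ_apply']
    rw [e, taylor_coeff, ← factorial_smul_hasseDeriv]
    simp
  obtain ⟨ξ, hξ, e⟩ := taylor_mean_remainder_lagrange_iteratedDeriv (f := fun x => P.eval x)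
    (x := 1) (x₀ := 0) (n := m) (by norm_num) hcd.contDiffOn
  rw [Set.uIoo_of_lt one_pos] at hξ
  have hsum : taylorWithinEval (fun x => P.eval x) m (Set.uIcc 0 1) 0 1 =
      ∑ i ∈ range (m + 1), P.coeff i := by
    rw [taylor_within_apply]
    refine sum_congr rfl fun i hi => ?_
    rw [iteratedDerivWithin_eq_iteratedDeriv (uniqueDiffOn_uIcc (by norm_num)) _ (by simp), hit]
    · have : (i.factorial : ℝ) ≠ 0 := by positivity
      simp only [sub_zero, one_pow, mul_one, smul_eq_mul, taylor_zero]
      field_simp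
    · simpa using (P.contDiff_aeval (𝕜 := ℝ) i).contDiffAt
  rw [hsum, hit] at e
  have : ((m + 1).factorial : ℝ) ≠ 0 := by positivity
  rw [e]
  convert h ξ hξ using 2
  simp only [sub_zero, one_pow, mul_one]
  field_simp

/-- One step from the origin: apart from its parts of level below `k`, the extension at a point of
`[-p,p]^n` is within `(2p)^k M_k` of its value at the origin. -/
theorem abs_mlExt_sub_low_le {n k : ℕ} (hk : 0 < k) {F : Set (BoolFn n)}
    (hF : ClosedUnderRestrictions F) {M : ℝ} (hM : classAbsFourierSum k F ≤ M) {f : BoolFn n}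
    (hf : f ∈ F) {p : ℝ} (hp0 : 0 < p) (hp : p ≤ 1 / 2) (x : Fin n → ℝ) (hx : ∀ i, |x i| ≤ p) :
    |mlExt f.real x - ∑ i ∈ range k, levelPart i f x| ≤ (2 * p) ^ k * M := by
  have hsub : ∀ (h : BoolFn n) (v : Fin n → ℝ) (r : ℝ),
      (∑ i ∈ range (n + 1), C (levelPart i h v) * X ^ i : ℝ[X]).eval r =
        mlExt h.real (fun i => r * v i) := by
    intro h v r
    rw [mlExt_eq_sum_levelPart, eval_finsetSum]
    refine sum_congr rfl fun i _ => ?_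
    rw [levelPart_smul]
    rw [eval_mul, eval_C, eval_pow, eval_X, mul_comm]
  have hcoeff : ∀ (h : BoolFn n) (v : Fin n → ℝ) (j : ℕ),
      (∑ i ∈ range (n + 1), C (levelPart i h v) * X ^ i : ℝ[X]).coeff j = levelPart j h v := by
    intro h v j
    simp only [finsetSum_coeff, coeff_C_mul_X_pow]
    rw [sum_ite_eq (range (n + 1)) j]
    split_ifs with hj
    · rfl
    · rw [mem_range, not_lt] at hj
      rw [levelPart, powersetCard_eq_empty.2 (by simpa using hj), sum_empty]
  -- the extension along the ray through `x`, as a polynomial in the distance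
  set P : ℝ[X] := ∑ i ∈ range (n + 1), C (levelPart i f x) * X ^ i with hP
  have key := abs_eval_one_sub_sum_coeff_le P hk (M := (2 * p) ^ k * M) ?_
  · rw [hsub] at key
    simpa only [hP, hcoeff, one_mul] using key
  intro ξ hξ
  -- around `ξ x`, the extension is an average of extensions of restrictions
  set y : Fin n → ℝ := fun i => ξ * x i with hy
  have hyp : ∀ i, |y i| ≤ 1 / 2 := by
    intro i
    rw [hy, abs_mul, abs_of_pos hξ.1]
    nlinarith [hx i, hξ.2, hξ.1, abs_nonneg (x i)]
  set v : Fin n → ℝ := fun i => x i / (1 - |y i|) with hv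
  have hvp : ∀ i, |v i| ≤ 2 * p := by
    intro i
    have : 0 < 1 - |y i| := by linarith [hyp i]
    rw [hv, abs_div, abs_of_pos this, div_le_iff₀ this]
    nlinarith [hx i, hyp i]
  set fJ : Finset (Fin n) → BoolFn n :=
    fun J z => f (J.piecewise (fun i => toSign (y i)) z) with hfJ
  have hfJF : ∀ J, fJ J ∈ F := fun J => hF f hf J _
  have htay : taylor ξ P = ∑ J, C (restrictWeight y J) *
      (∑ i ∈ range (n + 1), C (levelPart i (fJ J) v) * X ^ i) := by
    refine Polynomial.funext fun r => ?_
    rw [taylor_eval, hsub, eval_finsetSum]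
    simp only [eval_mul, eval_C, hsub]
    have := mlExt_move f.real y (fun i => r * v i)
    rw [show (fun i => (r + ξ) * x i) = fun i => y i + (1 - |y i|) * (r * v i) from ?_, this]
    · rfl
    · funext i
      have : 1 - |y i| ≠ 0 := by linarith [hyp i]
      simp only [hv]
      field_simp
      ring
  rw [htay, finsetSum_coeff]
  simp only [coeff_C_mul, hcoeff]
  have hyp1 : ∀ i, |y i| ≤ 1 := fun i => (hyp i).trans (by norm_num)
  have hlev : ∀ J, |levelPart k (fJ J) v| ≤ (2 * p) ^ k * M := by
    intro J
    have e : v = fun i => (2 * p) * (v i / (2 * p)) := by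
      funext i; field_simp
    rw [e, levelPart_smul, abs_mul, abs_of_pos (by positivity)]
    refine mul_le_mul_of_nonneg_left ?_ (by positivity)
    refine abs_levelPart_le (hfJF J) hM _ fun i => ?_
    rw [abs_div, abs_of_pos (show (0 : ℝ) < 2 * p by positivity), div_le_one (by positivity)]
    exact hvp i
  calc |∑ J, restrictWeight y J * levelPart k (fJ J) v|
      ≤ ∑ J, |restrictWeight y J * levelPart k (fJ J) v| := abs_sum_le_sum_abs _ _
    _ ≤ ∑ J, restrictWeight y J * ((2 * p) ^ k * M) := by
        refine sum_le_sum fun J _ => ?_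
        rw [abs_mul, abs_of_nonneg (restrictWeight_nonneg hyp1 J)]
        exact mul_le_mul_of_nonneg_left (hlev J) (restrictWeight_nonneg hyp1 J)
    _ = (2 * p) ^ k * M := by rw [← sum_mul, sum_restrictWeight, one_mul]

/-! ### The polarizing random walk -/

/-- One step of the polarizing random walk: coordinate `i` moves from `y i` by the fraction
`p * x i` of its distance to the boundary. -/
def walkStep {n : ℕ} (p : ℝ) (y x : Fin n → ℝ) : Fin n → ℝ :=
  fun i => y i + (1 - |y i|) * (p * x i)

/-- The position of the polarizing random walk after `t` steps with directions `x (ω τ)`. -/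
def walkPos {n : ℕ} {Ω : Type*} (x : Ω → Fin n → ℝ) (p : ℝ) :
    (t : ℕ) → (Fin t → Ω) → Fin n → ℝ
  | 0, _ => 0
  | t + 1, ω => walkStep p (walkPos x p t (Fin.init ω)) (x (ω (Fin.last t)))

/-- The last of `t + 1` independent samples can be averaged separately. -/
theorem expect_snoc {Ω : Type*} [Fintype Ω] {t : ℕ} (g : (Fin t → Ω) → Ω → ℝ) :
    𝔼 ω : Fin (t + 1) → Ω, g (Fin.init ω) (ω (Fin.last t)) = 𝔼 ω, 𝔼 a, g ω a := by
  rw [← Fintype.expect_equiv (Fin.snocEquiv fun _ : Fin (t + 1) => Ω)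
    (fun q => g q.2 q.1) _ (fun q => by simp [Fin.snocEquiv]), ← univ_product_univ,
    expect_product, expect_comm]

theorem abs_walkStep_le {n : ℕ} {p : ℝ} (hp0 : 0 ≤ p) (hp : p ≤ 1) {y x : Fin n → ℝ}
    (hy : ∀ i, |y i| ≤ 1) (hx : ∀ i, |x i| ≤ 1) (i : Fin n) : |walkStep p y x i| ≤ 1 := by
  have h1 : |(1 - |y i|) * (p * x i)| ≤ 1 - |y i| := by
    rw [abs_mul, abs_mul, abs_of_nonneg (sub_nonneg.2 (hy i)), abs_of_nonneg hp0]
    exact mul_le_of_le_one_right (sub_nonneg.2 (hy i))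
      (mul_le_one₀ hp (abs_nonneg _) (hx i))
  exact (abs_add_le _ _).trans (by linarith)

theorem abs_walkPos_le {n : ℕ} {Ω : Type*} {x : Ω → Fin n → ℝ} {p : ℝ} (hp0 : 0 ≤ p)
    (hp : p ≤ 1) (hx : ∀ ω i, |x ω i| ≤ 1) (t : ℕ) (ω : Fin t → Ω) (i : Fin n) :
    |walkPos x p t ω i| ≤ 1 := by
  induction t generalizing i with
  | zero => simp [walkPos]
  | succ t ih => exact abs_walkStep_le hp0 hp (fun i => ih _ i) (fun i => hx _ i) i

/-- The Taylor polynomial of degree three of `√(1 + z)` is an upper bound. -/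
theorem sqrt_one_add_le {z : ℝ} (hz : -1 ≤ z) :
    √(1 + z) ≤ 1 + z / 2 - z ^ 2 / 8 + z ^ 3 / 16 := by
  have h0 : 0 ≤ 1 + z / 2 - z ^ 2 / 8 + z ^ 3 / 16 := by
    by_cases h : z ≤ 1
    · have h2 : z ^ 2 ≤ 1 := by nlinarith
      have h3 : 0 ≤ z ^ 2 * (z + 1) := mul_nonneg (sq_nonneg z) (by linarith)
      linarith [(by ring : z ^ 2 * (z + 1) = z ^ 3 + z ^ 2)]
    · push Not at h
      nlinarith [sq_nonneg (z - 1), mul_nonneg (by linarith : (0 : ℝ) ≤ z) (sq_nonneg (z - 1))]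
  rw [Real.sqrt_le_left h0]
  have h1 : 0 ≤ (z ^ 2) ^ 2 * (((z - 2) ^ 2 + 16) / 256) := by positivity
  have h2 : (1 + z / 2 - z ^ 2 / 8 + z ^ 3 / 16) ^ 2 =
      1 + z + (z ^ 2) ^ 2 * (((z - 2) ^ 2 + 16) / 256) := by ring
  rw [h2]
  linarith

/-- The potential `√(1 - y ^ 2)` after the two possible steps from `y ≥ 0`: its average drops by the
factor `1 - p ^ 2 / 8`, and neither value exceeds twice the old one. -/
theorem polarize_aux {y p : ℝ} (hy0 : 0 ≤ y) (hy : y ≤ 1) (hp0 : 0 ≤ p) (hp : p ≤ 1 / 2) :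
    √(1 - (y + (1 - y) * p) ^ 2) + √(1 - (y - (1 - y) * p) ^ 2) ≤
        2 * (1 - p ^ 2 / 8) * √(1 - y ^ 2) ∧
      √(1 - (y + (1 - y) * p) ^ 2) ≤ 2 * √(1 - y ^ 2) ∧
      √(1 - (y - (1 - y) * p) ^ 2) ≤ 2 * √(1 - y ^ 2) := by
  set c := 1 / (1 + y) with hc
  have hc1 : c * (1 + y) = 1 := by rw [hc]; field_simp
  have hc0 : 0 < c := by positivity
  have hcle : c ≤ 1 := by nlinarith
  have hcge : 1 / 2 ≤ c := by nlinarith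
  set u := (1 - y) * p ^ 2 * c with hu
  set w := 2 * y * p * c with hw
  have hu0 : 0 ≤ u := by have : 0 ≤ 1 - y := by linarith
                         positivity
  have hw0 : 0 ≤ w := by positivity
  have hyc : y * c ≤ 1 / 2 := by nlinarith
  have hw1 : w ≤ 1 / 2 := by nlinarith [mul_nonneg hy0 hc0.le]
  have hu1 : u ≤ 1 / 4 := by
    have h1 : (1 - y) * c ≤ 1 := by nlinarith
    have h2 : 0 ≤ (1 - y) * c := mul_nonneg (by linarith) hc0.le
    nlinarith [sq_nonneg p]
  -- relative to `1 - y ^ 2`, the two new values are `1 - u - w` and `1 - u + w`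
  have key : ∀ e : ℝ, 0 ≤ 1 + e → √((1 - y ^ 2) * (1 + e)) = √(1 - y ^ 2) * √(1 + e) :=
    fun e he => Real.sqrt_mul (by nlinarith) _
  have e1 : 1 - (y + (1 - y) * p) ^ 2 = (1 - y ^ 2) * (1 + (-u - w)) := by
    have : (1 - y ^ 2) * (u + w) = (1 - y) * ((1 - y) * p ^ 2 + 2 * y * p) * (c * (1 + y)) := by
      rw [hu, hw]; ring
    rw [hc1] at this
    linear_combination this
  have e2 : 1 - (y - (1 - y) * p) ^ 2 = (1 - y ^ 2) * (1 + (-u + w)) := by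
    have : (1 - y ^ 2) * (u - w) = (1 - y) * ((1 - y) * p ^ 2 - 2 * y * p) * (c * (1 + y)) := by
      rw [hu, hw]; ring
    rw [hc1] at this
    linear_combination this
  rw [e1, e2, key _ (by linarith), key _ (by linarith)]
  have hφ := Real.sqrt_nonneg (1 - y ^ 2)
  have s1 := sqrt_one_add_le (z := -u - w) (by linarith)
  have s2 := sqrt_one_add_le (z := -u + w) (by linarith)
  have hsum : √(1 + (-u - w)) + √(1 + (-u + w)) ≤ 2 * (1 - p ^ 2 / 8) := by
    have h3 : u + w ^ 2 / 4 = p ^ 2 * c ^ 2 := by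
      have : u = (1 - y) * p ^ 2 * c * (c * (1 + y)) := by rw [hc1, mul_one]
      rw [this, hw]; ring
    have h4 : 1 / 4 ≤ c ^ 2 := by nlinarith
    have h5 : p ^ 2 * (1 / 4) ≤ u + w ^ 2 / 4 := by
      rw [h3]; exact mul_le_mul_of_nonneg_left h4 (sq_nonneg p)
    have h6 : 0 ≤ u ^ 3 := by positivity
    have h7 : 0 ≤ u * w ^ 2 := by positivity
    have h8 : ((-u - w) ^ 2 + (-u + w) ^ 2) / 8 - ((-u - w) ^ 3 + (-u + w) ^ 3) / 16 =
        u ^ 2 / 4 + w ^ 2 / 4 + u ^ 3 / 8 + 3 * (u * w ^ 2) / 8 := by ring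
    linarith [sq_nonneg u]
  have hle : ∀ z : ℝ, z ≤ 3 → √(1 + z) ≤ 2 := by
    intro z hz
    rw [Real.sqrt_le_left (by norm_num)]
    linarith
  refine ⟨?_, ?_, ?_⟩
  · rw [← mul_add, mul_comm _ √(1 - y ^ 2)]
    exact mul_le_mul_of_nonneg_left hsum hφ
  · rw [mul_comm 2]
    exact mul_le_mul_of_nonneg_left (hle (-u - w) (by linarith)) hφ
  · rw [mul_comm 2]
    exact mul_le_mul_of_nonneg_left (hle (-u + w) (by linarith)) hφ

/-- A step with a direction of bias at most `p ^ 2 / 16` brings the expected potential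
`√(1 - y ^ 2)` down by a constant factor. -/
theorem expect_potential_step_le {Ω : Type*} [Fintype Ω] [Nonempty Ω] (x : Ω → ℤˣ) {y p : ℝ}
    (hy : |y| ≤ 1) (hp0 : 0 ≤ p) (hp : p ≤ 1 / 2) (hx : |𝔼 ω, signVal (x ω)| ≤ p ^ 2 / 16) :
    𝔼 ω, √(1 - (y + (1 - |y|) * (p * signVal (x ω))) ^ 2) ≤ (1 - p ^ 2 / 16) * √(1 - y ^ 2) := by
  set g1 := √(1 - (y + (1 - |y|) * p) ^ 2) with hg1
  set g2 := √(1 - (y - (1 - |y|) * p) ^ 2) with hg2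
  have hs : ∀ ω, √(1 - (y + (1 - |y|) * (p * signVal (x ω))) ^ 2) =
      (g1 + g2) / 2 + (g1 - g2) / 2 * signVal (x ω) := by
    intro ω
    rcases Int.units_eq_one_or (x ω) with h | h
    · rw [h, signVal_one, mul_one, mul_one]; ring
    · rw [h, signVal_neg_one, mul_neg_one, mul_neg, ← sub_eq_add_neg]; ring
  simp only [hs]
  rw [expect_add_distrib, Fintype.expect_const, ← mul_expect]
  have hφ := Real.sqrt_nonneg (1 - y ^ 2)
  have hb : g1 + g2 ≤ 2 * (1 - p ^ 2 / 8) * √(1 - y ^ 2) ∧ g1 ≤ 2 * √(1 - y ^ 2) ∧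
      g2 ≤ 2 * √(1 - y ^ 2) := by
    rcases le_total 0 y with h | h
    · rw [abs_of_nonneg h] at hg1 hg2 hy
      have := polarize_aux h hy hp0 hp
      rwa [← hg1, ← hg2] at this
    · rw [abs_of_nonpos h] at hg1 hg2 hy
      have := polarize_aux (y := -y) (by linarith) hy hp0 hp
      have t1 : (-y + (1 - -y) * p) ^ 2 = (y - (1 - -y) * p) ^ 2 := by ring
      have t2 : (-y - (1 - -y) * p) ^ 2 = (y + (1 - -y) * p) ^ 2 := by ring
      rw [t1, t2, ← hg1, ← hg2, neg_sq] at this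
      exact ⟨by linarith [this.1], this.2.2, this.2.1⟩
  have h1 : |(g1 - g2) / 2| ≤ √(1 - y ^ 2) := by
    rw [abs_le]
    constructor <;>
      linarith [hb.2.1, hb.2.2, Real.sqrt_nonneg (1 - (y + (1 - |y|) * p) ^ 2),
        Real.sqrt_nonneg (1 - (y - (1 - |y|) * p) ^ 2)]
  have h2 : (g1 - g2) / 2 * 𝔼 ω, signVal (x ω) ≤ √(1 - y ^ 2) * (p ^ 2 / 16) := by
    refine (le_abs_self _).trans ?_
    rw [abs_mul]
    exact mul_le_mul h1 hx (abs_nonneg _) hφ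
  linarith [hb.1]

/-- The expected potential of a coordinate decays geometrically along the walk. -/
theorem expect_potential_le {n : ℕ} {Ω : Type*} [Fintype Ω] [Nonempty Ω] (x : Ω → Cube n) {p : ℝ}
    (hp0 : 0 ≤ p) (hp : p ≤ 1 / 2) (hx : ∀ i, |𝔼 ω, signVal (x ω i)| ≤ p ^ 2 / 16) (t : ℕ)
    (i : Fin n) :
    𝔼 ω, √(1 - walkPos (fun a i => signVal (x a i)) p t ω i ^ 2) ≤ (1 - p ^ 2 / 16) ^ t := by
  induction t with
  | zero => simp [walkPos]
  | succ t ih =>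
    simp only [walkPos]
    rw [expect_snoc (fun ω a => √(1 - walkStep p (walkPos (fun a i => signVal (x a i)) p t ω)
      (fun i => signVal (x a i)) i ^ 2))]
    calc _ ≤ 𝔼 ω : Fin t → Ω, (1 - p ^ 2 / 16) *
            √(1 - walkPos (fun a i => signVal (x a i)) p t ω i ^ 2) := by
          refine expect_le_expect_of_fintype _ _ fun ω => ?_
          refine expect_potential_step_le (fun a => x a i) ?_ hp0 hp (hx i)
          exact abs_walkPos_le hp0 (hp.trans (by norm_num)) (fun _ _ => (abs_signVal _).le) t ω i
      _ ≤ (1 - p ^ 2 / 16) ^ (t + 1) := by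
          rw [← mul_expect, pow_succ' (1 - p ^ 2 / 16) t]
          exact mul_le_mul_of_nonneg_left ih (by nlinarith : 0 ≤ 1 - p ^ 2 / 16)

theorem one_sub_prod_le {ι : Type*} (s : Finset ι) (a : ι → ℝ) (h0 : ∀ i, 0 ≤ a i)
    (h1 : ∀ i, a i ≤ 1) : 1 - ∏ i ∈ s, a i ≤ ∑ i ∈ s, (1 - a i) := by
  classical
  induction s using Finset.induction_on with
  | empty => simp
  | insert i s hi ih =>
    rw [prod_insert hi, sum_insert hi]
    have : ∏ i ∈ s, a i ≤ 1 := prod_le_one (fun i _ => h0 i) fun i _ => h1 i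
    nlinarith [h0 i, h1 i]

/-- Rounding a point of `[-1,1]^n` to its signs. -/
theorem abs_mlExt_sub_sign_le {n : ℕ} (f : BoolFn n) {y : Fin n → ℝ} (hy : ∀ i, |y i| ≤ 1) :
    |mlExt f.real y - signVal (f fun i => toSign (y i))| ≤ 2 * ∑ i, (1 - |y i|) := by
  have h := mlExt_move f.real y 0
  simp only [Pi.zero_apply, mul_zero, add_zero] at h
  set s : Cube n := fun i => toSign (y i) with hs
  set b := fun J : Finset (Fin n) => mlExt (fun z => f.real (J.piecewise s z)) 0 with hb
  have hb1 : ∀ J, |b J| ≤ 1 := fun J => by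
    simp only [hb, mlExt_zero]
    exact abs_expect_le _ fun z => (abs_signVal _).le
  have hbu : b univ = signVal (f s) := by
    simp only [hb, mlExt_zero, BoolFn.real, Finset.piecewise_univ]
    exact Fintype.expect_const _
  have hsum := sum_restrictWeight y
  have e : mlExt f.real y - signVal (f s) = ∑ J, restrictWeight y J * (b J - b univ) := by
    simp only [mul_sub, sum_sub_distrib, ← sum_mul, hsum, one_mul, hbu]
    rw [← h]
  rw [e]
  have hu : restrictWeight y univ = ∏ i, |y i| := by simp [restrictWeight]
  calc |∑ J, restrictWeight y J * (b J - b univ)|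
      ≤ ∑ J, |restrictWeight y J * (b J - b univ)| := abs_sum_le_sum_abs _ _
    _ = ∑ J ∈ univ.erase univ, |restrictWeight y J * (b J - b univ)| := by
        rw [← add_sum_erase univ _ (mem_univ univ)]; simp
    _ ≤ ∑ J ∈ univ.erase univ, restrictWeight y J * 2 := by
        refine sum_le_sum fun J _ => ?_
        rw [abs_mul, abs_of_nonneg (restrictWeight_nonneg hy J)]
        refine mul_le_mul_of_nonneg_left ?_ (restrictWeight_nonneg hy J)
        have h1 := abs_le.1 (hb1 J)
        have h2 := abs_le.1 (hb1 univ)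
        rw [abs_le]; constructor <;> linarith
    _ = 2 * (1 - ∏ i, |y i|) := by
        rw [← sum_mul, ← hu, ← hsum, ← add_sum_erase univ _ (mem_univ univ)]; ring
    _ ≤ 2 * ∑ i, (1 - |y i|) := by
        have := one_sub_prod_le univ (fun i => |y i|) (fun _ => abs_nonneg _) hy
        linarith

theorem one_sub_abs_le_sqrt {y : ℝ} (hy : |y| ≤ 1) : 1 - |y| ≤ √(1 - y ^ 2) := by
  refine Real.le_sqrt_of_sq_le ?_
  nlinarith [abs_nonneg y, sq_abs y]

/-- The error of the generator that rounds the polarizing walk: each of the `t` steps costs the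
error of the fractional generator `p x`, and the rounding costs the expected final potential. -/
theorem abs_expect_walk_sub_le {n : ℕ} {F : Set (BoolFn n)} (hF : ClosedUnderRestrictions F)
    {Ω : Type*} [Fintype Ω] [Nonempty Ω] (x : Ω → Cube n) {p η : ℝ}
    (hp0 : 0 ≤ p) (hp : p ≤ 1 / 2) (hx : ∀ i, |𝔼 ω, signVal (x ω i)| ≤ p ^ 2 / 16)
    (hη : ∀ f ∈ F, |(𝔼 ω, mlExt f.real fun i => p * signVal (x ω i)) - mlExt f.real 0| ≤ η)
    (t : ℕ) {f : BoolFn n} (hf : f ∈ F) :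
    |(𝔼 ω, signVal (f fun i => toSign (walkPos (fun a i => signVal (x a i)) p t ω i))) -
      𝔼 z, signVal (f z)| ≤ t * η + 2 * (n * (1 - p ^ 2 / 16) ^ t) := by
  -- a step from `y` is a step from the origin for a random restriction of `f`
  have hstep : ∀ y : Fin n → ℝ, (∀ i, |y i| ≤ 1) →
      |(𝔼 a, mlExt f.real (walkStep p y fun i => signVal (x a i))) - mlExt f.real y| ≤ η := by
    intro y hy
    have e0 := mlExt_move f.real y 0
    simp only [Pi.zero_apply, mul_zero, add_zero] at e0
    have e1 : 𝔼 a, mlExt f.real (walkStep p y fun i => signVal (x a i)) =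
        ∑ J, restrictWeight y J * 𝔼 a,
          mlExt (fun z => f.real (J.piecewise (fun i => toSign (y i)) z))
            (fun i => p * signVal (x a i)) := by
      simp only [mul_expect]
      rw [← expect_sum_comm]
      refine expect_congr rfl fun a _ => ?_
      exact mlExt_move f.real y fun i => p * signVal (x a i)
    rw [e1, show mlExt f.real y = _ from e0, ← sum_sub_distrib]
    calc _ ≤ ∑ J, |_| := abs_sum_le_sum_abs _ _
      _ ≤ ∑ J, restrictWeight y J * η := by
        refine sum_le_sum fun J _ => ?_
        rw [← mul_sub, abs_mul, abs_of_nonneg (restrictWeight_nonneg hy J)]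
        exact mul_le_mul_of_nonneg_left (hη _ (hF f hf J fun i => toSign (y i)))
          (restrictWeight_nonneg hy J)
      _ = η := by rw [← sum_mul, sum_restrictWeight, one_mul]
  have hle : ∀ t ω i, |walkPos (fun a i => signVal (x a i)) p t ω i| ≤ 1 :=
    fun t ω i => abs_walkPos_le hp0 (hp.trans (by norm_num)) (fun _ _ => (abs_signVal _).le) t ω i
  have hwalk : |(𝔼 ω, mlExt f.real (walkPos (fun a i => signVal (x a i)) p t ω)) -
      𝔼 z, signVal (f z)| ≤ t * η := by
    induction t with
    | zero =>
      simp only [walkPos, mlExt_zero]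
      rw [Fintype.expect_const]
      simp [BoolFn.real]
    | succ t ih =>
      simp only [walkPos]
      rw [expect_snoc (fun ω a => mlExt f.real (walkStep p
        (walkPos (fun a i => signVal (x a i)) p t ω) fun i => signVal (x a i)))]
      have h1 := abs_expect_le (fun ω => (𝔼 a, mlExt f.real (walkStep p
        (walkPos (fun a i => signVal (x a i)) p t ω) fun i => signVal (x a i))) -
          mlExt f.real (walkPos (fun a i => signVal (x a i)) p t ω))
        (fun ω => hstep _ (hle t ω))
      rw [expect_sub_distrib] at h1
      refine (abs_sub_le _ (𝔼 ω, mlExt f.real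
        (walkPos (fun a i => signVal (x a i)) p t ω)) _).trans ?_
      push_cast
      linarith
  have hround : |(𝔼 ω, signVal (f fun i => toSign (walkPos (fun a i => signVal (x a i)) p t ω i))) -
      𝔼 ω, mlExt f.real (walkPos (fun a i => signVal (x a i)) p t ω)| ≤
        2 * (n * (1 - p ^ 2 / 16) ^ t) := by
    rw [← expect_sub_distrib]
    calc _ ≤ 𝔼 ω, |signVal (f fun i => toSign (walkPos (fun a i => signVal (x a i)) p t ω i)) -
          mlExt f.real (walkPos (fun a i => signVal (x a i)) p t ω)| := by
          rw [Fintype.expect_eq_sum_div_card, Fintype.expect_eq_sum_div_card, abs_div,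
            Nat.abs_cast]
          gcongr
          exact abs_sum_le_sum_abs _ _
      _ ≤ 𝔼 ω, 2 * ∑ i, √(1 - walkPos (fun a i => signVal (x a i)) p t ω i ^ 2) := by
          refine expect_le_expect_of_fintype _ _ fun ω => ?_
          rw [abs_sub_comm]
          refine (abs_mlExt_sub_sign_le f (hle t ω)).trans ?_
          gcongr with i
          exact one_sub_abs_le_sqrt (hle t ω i)
      _ ≤ 2 * (n * (1 - p ^ 2 / 16) ^ t) := by
          rw [← mul_expect, expect_sum_comm]
          gcongr
          calc _ ≤ ∑ _i : Fin n, (1 - p ^ 2 / 16) ^ t :=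
                sum_le_sum fun i _ => expect_potential_le x hp0 hp hx t i
            _ = _ := by simp
  refine (abs_sub_le _ (𝔼 ω, mlExt f.real (walkPos (fun a i => signVal (x a i)) p t ω)) _).trans ?_
  linarith

/-- The fractional generator `p x` when `x` has small bias on the sets of size below `k`; without
any bias no bound on the lower levels is needed. -/
theorem abs_expect_fractional_sub_le {n k : ℕ} (hk : 0 < k) {F : Set (BoolFn n)}
    (hF : ClosedUnderRestrictions F) {b : ℝ} (hb : 0 ≤ b) (hM : classAbsFourierSum k F ≤ b ^ k)
    {Ω : Type*} [Fintype Ω] [Nonempty Ω] (x : Ω → Cube n) {p δ : ℝ}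
    (hp0 : 0 < p) (hp : p ≤ 1 / 2) (hpb : p * b ≤ 1 / 2) (hδ : 0 ≤ δ)
    (hx : ∀ S : Finset (Fin n), 1 ≤ #S → #S < k → |𝔼 ω, ∏ i ∈ S, signVal (x ω i)| ≤ δ)
    (hL : δ = 0 ∨ ∀ i : ℕ, 1 ≤ i → i < k → classFourierMass i F ≤ b ^ i)
    {f : BoolFn n} (hf : f ∈ F) :
    |(𝔼 ω, mlExt f.real fun i => p * signVal (x ω i)) - mlExt f.real 0| ≤
      (2 * p * b) ^ k + δ := by
  have h0 : mlExt f.real 0 = levelPart 0 f 0 := by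
    rw [mlExt_eq_sum_levelPart, sum_range_succ', add_eq_right]
    refine sum_eq_zero fun i _ => sum_eq_zero fun S hS => ?_
    have hS : S.Nonempty := card_pos.1 (by have := (mem_powersetCard.1 hS).2; omega)
    obtain ⟨j, hj⟩ := hS
    rw [prod_eq_zero hj rfl, mul_zero]
  have h00 : ∀ y, levelPart 0 f y = levelPart 0 f 0 := by intro y; simp [levelPart]
  have hlev : ∀ i, 1 ≤ i → i < k →
      |𝔼 ω, levelPart i f fun j => p * signVal (x ω j)| ≤ δ * (p * b) ^ i := by
    intro i hi hik
    have e : 𝔼 ω, levelPart i f (fun j => p * signVal (x ω j)) =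
        p ^ i * ∑ S ∈ (univ : Finset (Fin n)).powersetCard i,
          cubeFourierCoeff f S * 𝔼 ω, ∏ j ∈ S, signVal (x ω j) := by
      rw [expect_congr rfl fun ω _ => levelPart_smul i f p fun j => signVal (x ω j), ← mul_expect]
      simp only [levelPart]
      rw [expect_sum_comm]
      simp only [← mul_expect]
    rw [e, abs_mul, abs_of_nonneg (pow_nonneg hp0.le i)]
    have hb1 : |∑ S ∈ (univ : Finset (Fin n)).powersetCard i,
          cubeFourierCoeff f S * 𝔼 ω, ∏ j ∈ S, signVal (x ω j)| ≤ fourierMass i f * δ := by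
      rw [fourierMass, sum_mul]
      refine (abs_sum_le_sum_abs _ _).trans (sum_le_sum fun S hS => ?_)
      rw [abs_mul]
      have := (mem_powersetCard.1 hS).2
      exact mul_le_mul_of_nonneg_left (hx S (by omega) (by omega)) (abs_nonneg _)
    have hb2 : fourierMass i f * δ ≤ b ^ i * δ := by
      rcases hL with rfl | hL
      · simp
      · exact mul_le_mul_of_nonneg_right (fourierMass_le hf (hL i hi hik)) hδ
    calc _ ≤ p ^ i * (b ^ i * δ) := by gcongr; exact hb1.trans hb2
      _ = δ * (p * b) ^ i := by rw [mul_pow]; ring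
  have hlow : |(𝔼 ω, ∑ i ∈ range k, levelPart i f fun j => p * signVal (x ω j)) - levelPart 0 f 0|
      ≤ δ := by
    obtain ⟨m, rfl⟩ : ∃ m, k = m + 1 := ⟨k - 1, by omega⟩
    rw [expect_sum_comm, sum_range_succ']
    simp only [h00 (fun j => p * signVal (x _ j)), Fintype.expect_const, add_sub_cancel_right]
    calc _ ≤ ∑ i ∈ range m, |_| := abs_sum_le_sum_abs _ _
      _ ≤ ∑ i ∈ range m, δ * (p * b) ^ (i + 1) := sum_le_sum fun i hi =>
          hlev (i + 1) (by omega) (by have := mem_range.1 hi; omega)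
      _ ≤ ∑ i ∈ range m, δ * (1 / 2) ^ (i + 1) := by gcongr
      _ ≤ δ := by
        rw [← mul_sum]
        refine mul_le_of_le_one_right hδ ?_
        have : ∀ m : ℕ, ∑ i ∈ range m, (1 / 2 : ℝ) ^ (i + 1) = 1 - (1 / 2) ^ m := by
          intro m
          induction m with
          | zero => simp
          | succ m ih => rw [sum_range_succ, ih]; ring
        rw [this]
        have : (0 : ℝ) ≤ (1 / 2) ^ m := by positivity
        linarith
  have hrem := abs_expect_le (fun ω => mlExt f.real (fun i => p * signVal (x ω i)) -
      ∑ i ∈ range k, levelPart i f fun j => p * signVal (x ω j)) (c := (2 * p * b) ^ k) (fun ω => by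
    rw [mul_pow (2 * p)]
    refine abs_mlExt_sub_low_le hk hF hM hf hp0 hp _ fun i => ?_
    rw [abs_mul, abs_signVal, mul_one, abs_of_pos hp0])
  rw [expect_sub_distrib] at hrem
  rw [h0]
  exact (abs_sub_le _ (𝔼 ω, ∑ i ∈ range k, levelPart i f fun j => p * signVal (x ω j)) _).trans
    (add_le_add hrem hlow)

/-! ### A field of characteristic two, moduli and counting -/

/-- `2` is a primitive root modulo every power of `3`: its order modulo `3` is even, and then
lifting the exponent applies to powers of `4`. -/
theorem two_mul_three_pow_le_of_dvd {j o : ℕ} (ho : o ≠ 0) (h : 3 ^ (j + 1) ∣ 2 ^ o - 1) :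
    2 * 3 ^ j ≤ o := by
  have h3 : (3 : ℕ) ∣ 2 ^ o - 1 := (dvd_pow_self 3 (by omega)).trans h
  rcases Nat.even_or_odd o with ⟨e, he⟩ | ⟨e, he⟩
  · have he0 : e ≠ 0 := by omega
    have e1 : 2 ^ o - 1 = 4 ^ e - 1 ^ e := by
      rw [he, ← two_mul, pow_mul, one_pow]; norm_num
    have hp : Fact (Nat.Prime 3) := ⟨Nat.prime_three⟩
    have h4 := padicValNat.pow_sub_pow (p := 3) (by decide) (x := 4) (y := 1) (by norm_num)
      (by norm_num) (by norm_num) he0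
    rw [e1] at h
    have hne : 4 ^ e - 1 ^ e ≠ 0 := by
      have : 1 < 4 ^ e := Nat.one_lt_pow he0 (by norm_num)
      rw [one_pow]; omega
    have h5 := (padicValNat_dvd_iff_le hne).1 h
    rw [h4] at h5
    simp only [Nat.add_one_sub_one, padicValNat_self] at h5
    have h6 : 3 ^ j ∣ e := (padicValNat_dvd_iff_le he0).2 (by omega)
    have := Nat.le_of_dvd (Nat.pos_of_ne_zero he0) h6
    omega
  · exfalso
    have e1 : 2 ^ o % 3 = 2 := by
      rw [he, pow_succ, pow_mul, Nat.mul_mod, Nat.pow_mod]; norm_num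
    have : 1 ≤ 2 ^ o := Nat.one_le_two_pow
    omega

/-- `ζ` is an `N`-th root of unity in a field of characteristic two, and its powers of exponent
below `d` are linearly independent over the field with two elements. -/
structure IsSpreadRoot {K : Type} [Field K] (ζ : K) (N d : ℕ) : Prop where
  pow_eq_one : ζ ^ N = 1
  two_eq_zero : (2 : K) = 0
  even_of_sum_eq_zero : ∀ g : ℕ → ℕ, ∑ l ∈ range d, (g l : K) * ζ ^ l = 0 →
    ∀ l < d, g l % 2 = 0

/-- As `2` generates the units modulo `3 ^ (j + 1)`, the cyclotomic polynomial of that order is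
irreducible modulo `2`, and `ζ` can be taken to be its root. -/
theorem exists_isSpreadRoot (j : ℕ) :
    ∃ (K : Type) (_ : Field K) (ζ : K), IsSpreadRoot ζ (3 ^ (j + 1)) (2 * 3 ^ j) := by
  have hp : Fact (Nat.Prime 2) := ⟨Nat.prime_two⟩
  set N := 3 ^ (j + 1) with hN
  have hodd : ¬ 2 ∣ N := by
    rw [hN]
    intro h
    have := Nat.prime_two.dvd_of_dvd_pow h
    omega
  have htot : N.totient = 2 * 3 ^ j := by
    rw [hN, Nat.totient_prime_pow_succ Nat.prime_three]; ring
  have hdeg : (cyclotomic N (ZMod 2)).natDegree = 2 * 3 ^ j := by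
    rw [natDegree_cyclotomic, htot]
  have hirr : Irreducible (cyclotomic N (ZMod 2)) := by
    refine ZMod.irreducible_of_dvd_cyclotomic_of_natDegree hodd dvd_rfl ?_
    rw [hdeg]
    have hNz : NeZero N := ⟨by positivity⟩
    set u := ZMod.unitOfCoprime 2 (hp.1.coprime_iff_not_dvd.mpr hodd) with hu
    have hle : orderOf u ≤ 2 * 3 ^ j := by
      rw [← htot, ← ZMod.card_units_eq_totient]
      exact orderOf_le_card_univ
    refine le_antisymm ?_ hle
    have hpos : 0 < orderOf u := orderOf_pos u
    refine two_mul_three_pow_le_of_dvd hpos.ne' ?_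
    have h1 : ((2 ^ orderOf u : ℕ) : ZMod N) = ((1 : ℕ) : ZMod N) := by
      have := congrArg (Units.val) (pow_orderOf_eq_one u)
      rw [Units.val_pow_eq_pow_val, hu, ZMod.coe_unitOfCoprime] at this
      push_cast at this ⊢
      exact this
    rw [ZMod.natCast_eq_natCast_iff] at h1
    exact (Nat.modEq_iff_dvd' Nat.one_le_two_pow).1 h1.symm
  have hF : Fact (Irreducible (cyclotomic N (ZMod 2))) := ⟨hirr⟩
  refine ⟨AdjoinRoot (cyclotomic N (ZMod 2)), inferInstance, AdjoinRoot.root _, ?_, ?_, ?_⟩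
  · have h1 : AdjoinRoot.mk (cyclotomic N (ZMod 2)) (X ^ N - 1) = 0 :=
      AdjoinRoot.mk_eq_zero.2 (cyclotomic.dvd_X_pow_sub_one N (ZMod 2))
    rw [map_sub, map_pow, AdjoinRoot.mk_X, map_one, sub_eq_zero] at h1
    exact h1
  · have : ((2 : ZMod 2)) = 0 := rfl
    have h2 := congrArg (AdjoinRoot.of (cyclotomic N (ZMod 2))) this
    rwa [map_ofNat, map_zero] at h2
  · intro g hg l hl
    set P : (ZMod 2)[X] := ∑ l ∈ range (2 * 3 ^ j), C (g l : ZMod 2) * X ^ l with hP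
    have h1 : AdjoinRoot.mk (cyclotomic N (ZMod 2)) P = 0 := by
      rw [hP, map_sum, ← hg]
      refine sum_congr rfl fun l _ => ?_
      rw [map_mul, map_pow, AdjoinRoot.mk_X, AdjoinRoot.mk_C, map_natCast]
    have h2 : P = 0 := by
      by_contra hne
      have hdvd := AdjoinRoot.mk_eq_zero.1 h1
      have hle := degree_le_of_dvd hdvd hne
      have hlt : P.degree < (2 * 3 ^ j : ℕ) := by
        rw [hP]
        refine (degree_sum_le _ _).trans_lt ?_
        rw [Finset.sup_lt_iff (WithBot.bot_lt_coe _)]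
        intro l hl
        exact (degree_C_mul_X_pow_le _ _).trans_lt (by exact_mod_cast mem_range.1 hl)
      rw [degree_eq_natDegree hirr.ne_zero, hdeg] at hle
      exact absurd (hle.trans_lt hlt) (lt_irrefl _)
    have h3 : P.coeff l = (g l : ZMod 2) := by
      rw [hP, finsetSum_coeff]
      simp only [coeff_C_mul_X_pow]
      rw [sum_ite_eq (range _) l, if_pos (mem_range.2 hl)]
    rw [h2, coeff_zero] at h3
    have := (ZMod.natCast_eq_zero_iff (g l) 2).1 h3.symm
    omega

theorem two_pow_le_centralBinom (m : ℕ) : 2 ^ m ≤ m.centralBinom := by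
  induction m with
  | zero => simp
  | succ m ih =>
    have h := Nat.succ_mul_centralBinom_succ m
    have h2 : (m + 1) * 2 ^ (m + 1) ≤ (m + 1) * (m + 1).centralBinom := by
      rw [h, pow_succ]
      calc (m + 1) * (2 ^ m * 2) = 2 * (m + 1) * 2 ^ m := by ring
        _ ≤ 2 * (2 * m + 1) * m.centralBinom := by gcongr; omega
    exact Nat.le_of_mul_le_mul_left h2 (by omega)

/-- A positive number divisible by everything up to `2m` is at least `2 ^ m`, as it is a multiple
of the central binomial coefficient. -/
theorem two_pow_le_of_forall_dvd {m D : ℕ} (hD : D ≠ 0) (h : ∀ q, 1 ≤ q → q ≤ 2 * m → q ∣ D) :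
    2 ^ m ≤ D := by
  rcases Nat.eq_zero_or_pos m with rfl | hm
  · exact Nat.one_le_iff_ne_zero.2 hD
  refine (two_pow_le_centralBinom m).trans (Nat.le_of_dvd (Nat.pos_of_ne_zero hD) ?_)
  rw [← Nat.factorization_prime_le_iff_dvd m.centralBinom_ne_zero hD]
  intro p hp
  rw [← hp.pow_dvd_iff_le_factorization hD]
  refine h _ (Nat.one_le_pow _ _ hp.pos) ?_
  rw [Nat.centralBinom_eq_two_mul_choose]
  exact Nat.pow_factorization_choose_le (by omega)

/-- Some small modulus isolates a given element of a small set of small numbers: otherwise every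
small modulus divides the product of the differences, which would then be too large. -/
theorem exists_isolating_modulus {m k : ℕ} (hm : 1 ≤ m) (S : Finset ℕ) (hS : ∀ i ∈ S, i < 2 ^ m)
    (hk : #S < k) {i : ℕ} (hi : i ∈ S) :
    ∃ q, 1 ≤ q ∧ q ≤ 2 * (k * m) ∧ ∀ i' ∈ S, i' % q = i % q → i' = i := by
  by_contra hcon
  push Not at hcon
  -- by truncation, one of the two differences is zero and the other is the distance
  set D := ∏ i' ∈ S.erase i, ((i' - i) + (i - i')) with hD
  have hD0 : D ≠ 0 := by
    rw [hD, prod_ne_zero_iff]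
    intro i' hi'
    have := ne_of_mem_erase hi'
    omega
  have hlow := two_pow_le_of_forall_dvd (m := k * m) hD0 fun q hq1 hq2 => by
    obtain ⟨i', hi', hmod, hne⟩ := hcon q hq1 hq2
    refine Dvd.dvd.trans ?_ (dvd_prod_of_mem _ (mem_erase.2 ⟨hne, hi'⟩))
    rcases le_total i i' with hle | hle
    · have := (Nat.modEq_iff_dvd' hle).1 (show i ≡ i' [MOD q] from hmod.symm)
      rwa [Nat.sub_eq_zero_of_le hle, add_zero]
    · have := (Nat.modEq_iff_dvd' hle).1 (show i' ≡ i [MOD q] from hmod)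
      rwa [Nat.sub_eq_zero_of_le hle, zero_add]
  have hup : D ≤ (2 ^ m) ^ #(S.erase i) := by
    rw [hD]
    refine prod_le_pow_card _ _ _ fun i' hi' => ?_
    have := hS i' (mem_of_mem_erase hi')
    have := hS i hi
    omega
  rw [card_erase_of_mem hi, ← pow_mul] at hup
  have : 2 ^ (m * (#S - 1)) < 2 ^ (k * m) := by
    refine Nat.pow_lt_pow_right (by norm_num) ?_
    rw [mul_comm k]
    have : 0 < #S := card_pos.2 ⟨i, hi⟩
    exact Nat.mul_lt_mul_of_pos_left (by omega) (by omega)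
  omega

/-- The exponents `e` that belong to the index `i`: writing `e = q R + r` with `r < R`, those for
which `r` is the residue of `i` modulo `q`. -/
def IsMark (R i e : ℕ) : Prop := e % R = i % (e / R)

instance (R i : ℕ) : DecidablePred (IsMark R i) := fun _ => Nat.decEq _ _

/-- The polynomial over a field of characteristic two whose exponents are the marks of `i`. -/
def markPoly (K : Type) [Field K] (R i : ℕ) : K[X] :=
  ∑ e ∈ (range (R * (R + 1))).filter (IsMark R i), X ^ e

/-- Sums of fewer than `k` mark polynomials do not vanish: some modulus isolates one index. -/
theorem sum_markPoly_ne_zero {K : Type} [Field K] {m k : ℕ} (hm : 1 ≤ m) (S : Finset ℕ)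
    (hS : ∀ i ∈ S, i < 2 ^ m) (hne : S.Nonempty) (hk : #S < k) :
    ∑ i ∈ S, markPoly K (2 * (k * m)) i ≠ 0 := by
  obtain ⟨i, hi⟩ := hne
  obtain ⟨q, hq1, hq2, hq⟩ := exists_isolating_modulus hm S hS hk hi
  set R := 2 * (k * m) with hR
  have hiq : i % q < R := (Nat.mod_lt _ hq1).trans_le hq2
  -- the exponent at which only the polynomial of `i` has a coefficient
  set e := R * q + i % q with he
  have e1 : e % R = i % q := by rw [he, Nat.mul_add_mod, Nat.mod_eq_of_lt hiq]
  have e2 : e / R = q := by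
    rw [he, Nat.mul_add_div (by omega), Nat.div_eq_of_lt hiq, add_zero]
  have e3 : e < R * (R + 1) := by
    have : R * q ≤ R * R := Nat.mul_le_mul_left _ hq2
    rw [Nat.mul_add]; omega
  intro h0
  have hc : ∀ i', (markPoly K R i').coeff e = if i' % q = i % q then 1 else 0 := by
    intro i'
    rw [markPoly, finsetSum_coeff]
    simp only [coeff_X_pow]
    rw [sum_ite_eq]
    congr 1
    simp only [mem_filter, mem_range, IsMark, e1, e2, e3, true_and, eq_iff_iff]
    exact eq_comm
  have h1 := congrArg (fun P => P.coeff e) h0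
  simp only [finsetSum_coeff, hc, coeff_zero] at h1
  rw [sum_eq_single i] at h1
  · simp at h1
  · intro i' hi' hne
    rw [if_neg fun h => hne (hq i' hi' h)]
  · exact fun h => absurd hi h

theorem natDegree_sum_markPoly_le {K : Type} [Field K] (R : ℕ) (S : Finset ℕ) :
    (∑ i ∈ S, markPoly K R i).natDegree ≤ R * (R + 1) := by
  refine natDegree_sum_le_of_forall_le _ _ fun i _ =>
    natDegree_sum_le_of_forall_le _ _ fun e he => ?_
  rw [natDegree_X_pow]
  exact (mem_range.1 (mem_filter.1 he).1).le

/-- The bit `1` for the sign `-1`. -/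
def signBit (u : ℤˣ) : ℕ := if u = -1 then 1 else 0

theorem signBit_le (u : ℤˣ) : signBit u ≤ 1 := by unfold signBit; split_ifs <;> omega

theorem signBit_injective : Function.Injective signBit := by decide

/-- The value at `ζ` of the polynomial whose coefficients are the bits of `a`. -/
def bitEval {K : Type} [Field K] (ζ : K) {N : ℕ} (a : Cube N) : K :=
  ∑ l : Fin N, (signBit (a l) : K) * ζ ^ (l : ℕ)

/-- Every value is attained by `bitEval` at most `2 ^ (N - d)` times: the bits at the positions
from `d` on determine the others. -/
theorem card_bitEval_eq_le {K : Type} [Field K] [DecidableEq K] {ζ : K} {N d : ℕ} (hd : d ≤ N)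
    (hζ : IsSpreadRoot ζ N d) (ρ : K) :
    #{a : Cube N | bitEval ζ a = ρ} ≤ 2 ^ (N - d) := by
  have hcard : #(univ : Finset (Cube (N - d))) = 2 ^ (N - d) := by simp
  rw [← hcard]
  refine card_le_card_of_injOn (fun a l => a ⟨d + l, by omega⟩) (fun _ _ => mem_univ _) ?_
  intro a ha a' ha' haa
  simp only [coe_filter, mem_univ, true_and, Set.mem_ofPred_eq] at ha ha'
  have hhigh : ∀ l : Fin N, d ≤ (l : ℕ) → a l = a' l := by
    intro l hl
    have := congrFun haa ⟨l - d, by omega⟩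
    simp only [Nat.add_sub_cancel' hl] at this
    exact this
  have hneg : ∀ x : K, x + x = 0 := fun x => by
    rw [← two_mul, hζ.two_eq_zero, zero_mul]
  -- in characteristic two the difference of the two values is their sum
  set g : ℕ → ℕ := fun l =>
    if h : l < N then signBit (a ⟨l, h⟩) + signBit (a' ⟨l, h⟩) else 0 with hg
  have hsum : ∑ l ∈ range N, (g l : K) * ζ ^ l = 0 := by
    rw [sum_range]
    have : ∀ l : Fin N, (g l : K) * ζ ^ (l : ℕ) = (signBit (a l) : K) * ζ ^ (l : ℕ) +
        (signBit (a' l) : K) * ζ ^ (l : ℕ) := by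
      intro l
      rw [hg]
      simp only [Fin.is_lt, dite_true, Fin.eta]
      push_cast; ring
    rw [sum_congr rfl fun l _ => this l, sum_add_distrib]
    change bitEval ζ a + bitEval ζ a' = 0
    rw [ha, ha', hneg]
  have hsum2 : ∑ l ∈ range d, (g l : K) * ζ ^ l = 0 := by
    rw [← hsum, ← sum_range_add_sum_Ico _ hd, left_eq_add]
    refine sum_eq_zero fun l hl => ?_
    rw [mem_Ico] at hl
    have h1 := hhigh ⟨l, hl.2⟩ hl.1
    have : g l = 2 * signBit (a' ⟨l, hl.2⟩) := by
      simp only [hg, hl.2, dite_true, h1]; ring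
    rw [this]
    push_cast
    rw [hζ.two_eq_zero]; ring
  have heven := hζ.even_of_sum_eq_zero g hsum2
  funext l
  by_cases hl : (l : ℕ) < d
  · have := heven l hl
    simp only [hg, Fin.is_lt, dite_true, Fin.eta] at this
    have b1 := signBit_le (a l)
    have b2 := signBit_le (a' l)
    exact signBit_injective (by omega)
  · exact hhigh l (by omega)

/-- A nonzero polynomial rarely vanishes at a random `bitEval`. -/
theorem card_root_bitEval_le {K : Type} [Field K] [DecidableEq K] {ζ : K} {N d : ℕ} (hd : d ≤ N)
    (hζ : IsSpreadRoot ζ N d) {P : K[X]} (hP : P ≠ 0) :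
    #{a : Cube N | P.eval (bitEval ζ a) = 0} ≤ P.natDegree * 2 ^ (N - d) := by
  have hsub : ({a : Cube N | P.eval (bitEval ζ a) = 0} : Finset (Cube N)) ⊆
      P.roots.toFinset.biUnion fun ρ => {a : Cube N | bitEval ζ a = ρ} := by
    intro a ha
    simp only [mem_filter, mem_univ, true_and] at ha
    simp only [mem_biUnion, Multiset.mem_toFinset, mem_filter, mem_univ, true_and, exists_eq_right']
    exact (mem_roots hP).2 ha
  refine (card_le_card hsub).trans ((card_biUnion_le_card_mul _ _ _ fun ρ _ =>
    card_bitEval_eq_le hd hζ ρ).trans ?_)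
  exact Nat.mul_le_mul_right _ ((Multiset.toFinset_card_le _).trans (card_roots' P))

/-! ### Integer arithmetic and pseudorandom bits -/

/-- A digit of a number given by its digits. -/
theorem sum_digits_div_mod {b : ℕ} (hb : 0 < b) (g : ℕ → ℕ) (hg : ∀ j, g j < b) (n l : ℕ) :
    (∑ j ∈ range n, g j * b ^ j) / b ^ l % b = if l < n then g l else 0 := by
  induction n generalizing g l with
  | zero => simp
  | succ n ih =>
    have e : ∑ j ∈ range (n + 1), g j * b ^ j =
        g 0 + b * ∑ j ∈ range n, g (j + 1) * b ^ j := by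
      rw [sum_range_succ', mul_sum, add_comm]
      simp only [pow_zero, mul_one, pow_succ]
      congr 1
      exact sum_congr rfl fun j _ => by ring
    rw [e]
    cases l with
    | zero => simp [Nat.mod_eq_of_lt (hg 0)]
    | succ l =>
      rw [pow_succ', ← Nat.div_div_eq_div_mul, Nat.add_mul_div_left _ _ hb,
        Nat.div_eq_of_lt (hg 0), zero_add, ih (fun j => g (j + 1)) fun j => hg _]
      simp

theorem sum_digits_lt {b : ℕ} (g : ℕ → ℕ) (hg : ∀ j, g j < b) (n : ℕ) :
    ∑ j ∈ range n, g j * b ^ j < b ^ n := by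
  induction n with
  | zero => simp
  | succ n ih =>
    rw [sum_range_succ, pow_succ]
    have : g n * b ^ n + b ^ n ≤ b ^ n * b := by
      rw [← Nat.succ_mul, mul_comm (b ^ n)]
      exact Nat.mul_le_mul_right _ (hg n)
    omega

theorem sum_range_mul {a N : ℕ} (f : ℕ → ℕ) :
    ∑ l ∈ range (a * N), f l = ∑ j ∈ range a, ∑ l ∈ range N, f (N * j + l) := by
  induction a with
  | zero => simp
  | succ a ih => rw [Nat.succ_mul, sum_range_add, ih, sum_range_succ, mul_comm a N]

/-- The mask with all digits `1` takes the parity of each digit in base `2 ^ w`. -/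
theorem land_digits {w : ℕ} (g : ℕ → ℕ) (hg : ∀ j, g j < 2 ^ w) (hw : 0 < w) (n : ℕ) :
    (∑ j ∈ range n, g j * (2 ^ w) ^ j) &&& (∑ j ∈ range n, (2 ^ w) ^ j) =
      ∑ j ∈ range n, (g j % 2) * (2 ^ w) ^ j := by
  induction n generalizing g with
  | zero => simp
  | succ n ih =>
    have e : ∀ f : ℕ → ℕ, ∑ j ∈ range (n + 1), f j * (2 ^ w) ^ j =
        2 ^ w * (∑ j ∈ range n, f (j + 1) * (2 ^ w) ^ j) + f 0 := by
      intro f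
      rw [sum_range_succ', mul_sum]
      simp only [pow_zero, mul_one, pow_succ]
      congr 1
      exact sum_congr rfl fun j _ => by ring
    have e1 := e fun _ => 1
    simp only [one_mul] at e1
    rw [e g, e1, e fun j => g j % 2, ← ih (fun j => g (j + 1)) fun j => hg _]
    refine Nat.eq_of_testBit_eq fun i => ?_
    have h1 : 1 < 2 ^ w := Nat.one_lt_two_pow hw.ne'
    have h2 : g 0 % 2 < 2 ^ w := by omega
    rw [Nat.testBit_land, Nat.testBit_two_pow_mul_add _ (hg 0), Nat.testBit_two_pow_mul_add _ h1,
      Nat.testBit_two_pow_mul_add _ h2]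
    split_ifs
    · rw [← Nat.testBit_land, Nat.and_one_is_mod]
    · rw [← Nat.testBit_land]

theorem xor_digits {w : ℕ} (g h : ℕ → ℕ) (hg : ∀ j, g j < 2 ^ w) (hh : ∀ j, h j < 2 ^ w) (n : ℕ) :
    (∑ j ∈ range n, g j * (2 ^ w) ^ j) ^^^ (∑ j ∈ range n, h j * (2 ^ w) ^ j) =
      ∑ j ∈ range n, (g j ^^^ h j) * (2 ^ w) ^ j := by
  induction n generalizing g h with
  | zero => simp
  | succ n ih =>
    have e : ∀ f : ℕ → ℕ, ∑ j ∈ range (n + 1), f j * (2 ^ w) ^ j =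
        2 ^ w * (∑ j ∈ range n, f (j + 1) * (2 ^ w) ^ j) + f 0 := by
      intro f
      rw [sum_range_succ', mul_sum]
      simp only [pow_zero, mul_one, pow_succ]
      congr 1
      exact sum_congr rfl fun j _ => by ring
    rw [e g, e h, e fun j => g j ^^^ h j,
      ← ih (fun j => g (j + 1)) (fun j => h (j + 1)) (fun j => hg _) fun j => hh _]
    refine Nat.eq_of_testBit_eq fun i => ?_
    rw [Nat.testBit_xor, Nat.testBit_two_pow_mul_add _ (hg 0), Nat.testBit_two_pow_mul_add _ (hh 0),
      Nat.testBit_two_pow_mul_add _ (Nat.xor_lt_two_pow (hg 0) (hh 0))]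
    split_ifs
    · rw [Nat.testBit_xor]
    · rw [Nat.testBit_xor]

/-- The base in which the elements of `F_2[x]/(x^N - 1)` are written, with one digit for each
coefficient: large enough that the digits of a product of two such numbers do not overflow. -/
def radix (N : ℕ) : ℕ := 4 ^ N

/-- Reduction modulo this number identifies `x ^ N` with `1`. -/
def cycMod (N : ℕ) : ℕ := radix N ^ N - 1

/-- The number all of whose `N` digits are `1`. -/
def digitMask (N : ℕ) : ℕ := ∑ j ∈ range N, radix N ^ j

/-- The number with digits `g 0, …, g (N - 1)`. -/
def enc (N : ℕ) (g : ℕ → ℕ) : ℕ := ∑ j ∈ range N, g j * radix N ^ j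

/-- Multiplication in `F_2[x]/(x^N - 1)`: the reduced integer product has the coefficients of the
cyclic convolution as its digits, and the mask takes their parities. -/
def cycMul (N x y : ℕ) : ℕ := (x * y % cycMod N) &&& digitMask N

/-- The powers of an element of `F_2[x]/(x^N - 1)`. -/
def cycPow (N x : ℕ) : ℕ → ℕ
  | 0 => 1
  | j + 1 => cycMul N (cycPow N x j) x

/-- The element of `F_2[x]/(x^N - 1)` whose coefficients are the lowest `N` bits of `w`. -/
def spread (N w : ℕ) : ℕ := enc N fun l => w / 2 ^ l % 2

/-- The constant coefficient of `x ^ l` times the element `g`. -/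
def rotCoeff (N g l : ℕ) : ℕ := g * radix N ^ l % cycMod N % 2

/-- A number whose parity is the constant coefficient of the product of `g` and the element given
by the lowest `N` bits of `w`. -/
def cycDot (N w g : ℕ) : ℕ := ∑ l ∈ range N, w / 2 ^ l % 2 * rotCoeff N g l

/-- `x` represents an element of `F_2[x]/(x^N - 1)`: its digits are `0` and `1`. -/
def IsElt (N x : ℕ) : Prop := ∃ g : ℕ → ℕ, (∀ l, g l ≤ 1) ∧ x = enc N g

/-- The image at `ζ` of an element of `F_2[x]/(x^N - 1)`. -/
def eltVal {K : Type} [Field K] (ζ : K) (N x : ℕ) : K :=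
  ∑ l ∈ range N, ((x / radix N ^ l % radix N : ℕ) : K) * ζ ^ l

theorem radix_eq (N : ℕ) : radix N = 2 ^ (2 * N) := by rw [radix, pow_mul]; norm_num

theorem sq_add_two_le_radix {N : ℕ} (hN : 0 < N) : N * N + 2 ≤ radix N := by
  obtain ⟨m, rfl⟩ : ∃ m, N = m + 1 := ⟨N - 1, by omega⟩
  unfold radix
  induction m with
  | zero => norm_num
  | succ m ih =>
    rw [pow_succ]
    nlinarith [ih (by omega)]

theorem radix_pos (N : ℕ) : 0 < radix N := by unfold radix; positivity

theorem digitMask_mul_add (N : ℕ) : digitMask N * (radix N - 1) + 1 = radix N ^ N := by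
  have h : ∀ m, (∑ j ∈ range m, radix N ^ j) * (radix N - 1) + 1 = radix N ^ m := by
    intro m
    induction m with
    | zero => simp
    | succ m ih =>
      obtain ⟨c, hc⟩ : ∃ c, radix N = c + 1 := ⟨radix N - 1, by have := radix_pos N; omega⟩
      rw [sum_range_succ, pow_succ, ← ih, hc, Nat.add_sub_cancel]
      rw [hc, Nat.add_sub_cancel] at ih
      linarith
  exact h N

theorem cycMod_eq (N : ℕ) : cycMod N = digitMask N * (radix N - 1) := by
  have := digitMask_mul_add N
  rw [cycMod]; omega

theorem digitMask_pos {N : ℕ} (hN : 0 < N) : 0 < digitMask N :=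
  sum_pos (fun _ _ => pow_pos (radix_pos N) _) ⟨0, mem_range.2 hN⟩

theorem enc_lt_cycMod {N : ℕ} (hN : 0 < N) {g : ℕ → ℕ} (hg : ∀ l, g l ≤ N * N) :
    enc N g < cycMod N := by
  have h := sq_add_two_le_radix hN
  have h1 : enc N g ≤ digitMask N * (N * N) := by
    rw [enc, digitMask, sum_mul]
    refine sum_le_sum fun j _ => ?_
    rw [mul_comm]
    exact Nat.mul_le_mul_left _ (hg j)
  have h2 : digitMask N * (N * N) < digitMask N * (radix N - 1) :=
    Nat.mul_lt_mul_of_pos_left (by omega) (digitMask_pos hN)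
  rw [cycMod_eq]
  omega

theorem radix_pow_modEq (N i : ℕ) :
    radix N ^ i ≡ radix N ^ (i % N) [MOD cycMod N] := by
  have h1 : radix N ^ N ≡ 1 [MOD cycMod N] := by
    have : 1 ≤ radix N ^ N := Nat.one_le_pow _ _ (radix_pos N)
    exact ((Nat.modEq_iff_dvd' this).2 dvd_rfl).symm
  conv_lhs => rw [← Nat.div_add_mod i N, pow_add, pow_mul]
  simpa using (h1.pow (i / N)).mul_right (radix N ^ (i % N))

/-- The coefficients of a cyclic convolution. -/
def cycConv (N : ℕ) (g h : ℕ → ℕ) (c : ℕ) : ℕ :=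
  ∑ i ∈ range N, ∑ j ∈ range N, if (i + j) % N = c then g i * h j else 0

theorem cycConv_le {N : ℕ} {g h : ℕ → ℕ} (hg : ∀ l, g l ≤ 1) (hh : ∀ l, h l ≤ 1) (c : ℕ) :
    cycConv N g h c ≤ N * N := by
  calc cycConv N g h c ≤ ∑ _i ∈ range N, ∑ _j ∈ range N, 1 := by
        refine sum_le_sum fun i _ => sum_le_sum fun j _ => ?_
        split_ifs
        · exact Nat.mul_le_mul (hg i) (hh j)
        · omega
    _ = N * N := by simp

/-- Modulo `cycMod`, integer multiplication is cyclic convolution of the digits. -/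
theorem enc_mul_enc_mod {N : ℕ} (hN : 0 < N) {g h : ℕ → ℕ} (hg : ∀ l, g l ≤ 1)
    (hh : ∀ l, h l ≤ 1) : enc N g * enc N h % cycMod N = enc N (cycConv N g h) := by
  have h1 : enc N (cycConv N g h) =
      ∑ i ∈ range N, ∑ j ∈ range N, g i * h j * radix N ^ ((i + j) % N) := by
    simp only [enc, cycConv, sum_mul]
    rw [sum_comm]
    refine sum_congr rfl fun i _ => ?_
    rw [sum_comm]
    refine sum_congr rfl fun j _ => ?_
    simp only [ite_mul, zero_mul]
    rw [sum_ite_eq, if_pos (mem_range.2 (Nat.mod_lt _ hN))]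
  have h2 : enc N g * enc N h ≡ enc N (cycConv N g h) [MOD cycMod N] := by
    rw [h1, enc, enc, sum_mul_sum]
    refine Nat.ModEq.sum fun i _ => Nat.ModEq.sum fun j _ => ?_
    rw [mul_mul_mul_comm, ← pow_add]
    exact (radix_pow_modEq N _).mul_left _
  rw [h2, Nat.mod_eq_of_lt (enc_lt_cycMod hN (cycConv_le hg hh))]

theorem cycMul_enc {N : ℕ} (hN : 0 < N) {g h : ℕ → ℕ} (hg : ∀ l, g l ≤ 1) (hh : ∀ l, h l ≤ 1) :
    cycMul N (enc N g) (enc N h) = enc N fun c => cycConv N g h c % 2 := by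
  rw [cycMul, enc_mul_enc_mod hN hg hh, enc, digitMask, enc, radix_eq]
  refine land_digits _ (fun j => ?_) (by omega) N
  have := cycConv_le (N := N) hg hh j
  have h2 := sq_add_two_le_radix hN
  rw [radix_eq] at h2
  omega

theorem two_lt_radix {N : ℕ} (hN : 0 < N) : 2 < radix N := by
  have := sq_add_two_le_radix hN
  have := Nat.mul_pos hN hN
  omega

section Val

variable {K : Type} [Field K] {ζ : K} {N d : ℕ}

theorem eltVal_enc (hN : 0 < N) {g : ℕ → ℕ} (hg : ∀ l, g l ≤ 1) :
    eltVal ζ N (enc N g) = ∑ l ∈ range N, (g l : K) * ζ ^ l := by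
  refine sum_congr rfl fun l hl => ?_
  have := two_lt_radix hN
  rw [enc, sum_digits_div_mod (radix_pos N) g (fun j => by have := hg j; omega),
    if_pos (mem_range.1 hl)]

theorem IsSpreadRoot.cast_mod_two (hζ : IsSpreadRoot ζ N d) (a : ℕ) : ((a % 2 : ℕ) : K) = a := by
  conv_rhs => rw [← Nat.div_add_mod a 2]
  push_cast
  rw [hζ.two_eq_zero, zero_mul, zero_add]

theorem IsElt.mul (hN : 0 < N) {x y : ℕ} (hx : IsElt N x) (hy : IsElt N y) :
    IsElt N (cycMul N x y) := by
  obtain ⟨g, hg, rfl⟩ := hx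
  obtain ⟨h, hh, rfl⟩ := hy
  exact ⟨_, fun c => by omega, cycMul_enc hN hg hh⟩

theorem eltVal_mul (hN : 0 < N) (hζ : IsSpreadRoot ζ N d) {x y : ℕ} (hx : IsElt N x)
    (hy : IsElt N y) : eltVal ζ N (cycMul N x y) = eltVal ζ N x * eltVal ζ N y := by
  obtain ⟨g, hg, rfl⟩ := hx
  obtain ⟨h, hh, rfl⟩ := hy
  rw [cycMul_enc hN hg hh, eltVal_enc hN fun c => by omega, eltVal_enc hN hg, eltVal_enc hN hh,
    sum_mul_sum]
  simp only [hζ.cast_mod_two, cycConv, Nat.cast_sum, sum_mul]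
  rw [sum_comm]
  refine sum_congr rfl fun i _ => ?_
  rw [sum_comm]
  refine sum_congr rfl fun j _ => ?_
  simp only [Nat.cast_ite, ite_mul, Nat.cast_zero, zero_mul]
  rw [sum_ite_eq, if_pos (mem_range.2 (Nat.mod_lt _ hN))]
  have : ζ ^ ((i + j) % N) = ζ ^ (i + j) := by
    conv_rhs => rw [← Nat.div_add_mod (i + j) N, pow_add, pow_mul, hζ.pow_eq_one, one_pow, one_mul]
  rw [this, pow_add]
  push_cast
  ring

theorem isElt_one (hN : 0 < N) : IsElt N 1 := by
  refine ⟨fun l => if l = 0 then 1 else 0, fun l => by dsimp only; split_ifs <;> omega, ?_⟩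
  simp only [enc, ite_mul, one_mul, zero_mul]
  rw [sum_ite_eq', if_pos (mem_range.2 hN), pow_zero]

theorem eltVal_one (hN : 0 < N) : eltVal ζ N 1 = 1 := by
  have h := eltVal_enc (ζ := ζ) hN (g := fun l => if l = 0 then 1 else 0)
    (fun l => by split_ifs <;> omega)
  have e : enc N (fun l => if l = 0 then 1 else 0) = 1 := by
    simp only [enc, ite_mul, one_mul, zero_mul]
    rw [sum_ite_eq', if_pos (mem_range.2 hN), pow_zero]
  rw [e] at h
  rw [h]
  simp [hN]

theorem isElt_zero : IsElt N 0 := ⟨fun _ => 0, fun _ => zero_le_one, by simp [enc]⟩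

theorem eltVal_zero : eltVal ζ N 0 = 0 := by simp [eltVal]

theorem IsElt.xor (hN : 0 < N) {x y : ℕ} (hx : IsElt N x) (hy : IsElt N y) :
    IsElt N (x ^^^ y) := by
  obtain ⟨g, hg, rfl⟩ := hx
  obtain ⟨h, hh, rfl⟩ := hy
  have := two_lt_radix hN
  refine ⟨fun l => g l ^^^ h l, fun l => ?_, ?_⟩
  · have := hg l
    have := hh l
    dsimp only
    interval_cases g l <;> interval_cases h l <;> decide
  · rw [enc, enc, enc, radix_eq]
    rw [radix_eq] at this
    exact xor_digits _ _ (fun j => by have := hg j; omega) (fun j => by have := hh j; omega) N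

theorem eltVal_xor (hN : 0 < N) (hζ : IsSpreadRoot ζ N d) {x y : ℕ} (hx : IsElt N x)
    (hy : IsElt N y) : eltVal ζ N (x ^^^ y) = eltVal ζ N x + eltVal ζ N y := by
  obtain ⟨g, hg, rfl⟩ := hx
  obtain ⟨h, hh, rfl⟩ := hy
  have h2 := two_lt_radix hN
  have e : enc N g ^^^ enc N h = enc N fun l => (g l + h l) % 2 := by
    have h3 : ∀ l, (g l + h l) % 2 = g l ^^^ h l := by
      intro l
      have := hg l
      have := hh l
      interval_cases g l <;> interval_cases h l <;> decide
    simp only [h3]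
    rw [enc, enc, enc, radix_eq]
    rw [radix_eq] at h2
    exact xor_digits _ _ (fun j => by have := hg j; omega) (fun j => by have := hh j; omega) N
  rw [e, eltVal_enc hN fun l => by omega, eltVal_enc hN hg, eltVal_enc hN hh, ← sum_add_distrib]
  refine sum_congr rfl fun l _ => ?_
  rw [hζ.cast_mod_two]
  push_cast
  ring

theorem isElt_spread (w : ℕ) : IsElt N (spread N w) := ⟨_, fun _ => by omega, rfl⟩

theorem eltVal_spread (hN : 0 < N) (w : ℕ) :
    eltVal ζ N (spread N w) = ∑ l ∈ range N, ((w / 2 ^ l % 2 : ℕ) : K) * ζ ^ l :=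
  eltVal_enc hN fun _ => by omega

theorem isElt_cycPow (hN : 0 < N) {x : ℕ} (hx : IsElt N x) (j : ℕ) : IsElt N (cycPow N x j) := by
  induction j with
  | zero => exact isElt_one hN
  | succ j ih => exact ih.mul hN hx

theorem eltVal_cycPow (hN : 0 < N) (hζ : IsSpreadRoot ζ N d) {x : ℕ} (hx : IsElt N x) (j : ℕ) :
    eltVal ζ N (cycPow N x j) = eltVal ζ N x ^ j := by
  induction j with
  | zero => rw [cycPow, eltVal_one hN, pow_zero]
  | succ j ih => rw [cycPow, eltVal_mul hN hζ (isElt_cycPow hN hx j) hx, ih, pow_succ]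

theorem IsElt.lt_cycMod (hN : 0 < N) {x : ℕ} (hx : IsElt N x) : x < cycMod N := by
  obtain ⟨g, hg, rfl⟩ := hx
  refine enc_lt_cycMod hN fun l => (hg l).trans ?_
  exact Nat.mul_pos hN hN

theorem enc_mod_two (hN : 0 < N) (g : ℕ → ℕ) : enc N g % 2 = g 0 % 2 := by
  obtain ⟨m, rfl⟩ : ∃ m, N = m + 1 := ⟨N - 1, by omega⟩
  have h : 2 ∣ ∑ j ∈ range m, g (j + 1) * radix (m + 1) ^ (j + 1) :=
    dvd_sum fun j _ => Dvd.dvd.mul_left (Dvd.dvd.trans ⟨2 * 4 ^ m, by rw [radix, pow_succ]; ring⟩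
      (dvd_pow_self _ (by omega))) _
  rw [enc, sum_range_succ']
  simp only [pow_zero, mul_one]
  omega

/-- The coefficients of an element are the constant coefficients of its rotations. -/
theorem rotCoeff_enc {g : ℕ → ℕ} (hg : ∀ l, g l ≤ 1) {j : ℕ} (hj : j < N) :
    rotCoeff N (enc N g) ((N - j) % N) = g j := by
  have hN : 0 < N := by omega
  set l := (N - j) % N with hl
  have hlN : l < N := Nat.mod_lt _ hN
  have e : radix N ^ l = enc N fun i => if i = l then 1 else 0 := by
    simp only [enc, ite_mul, one_mul, zero_mul]
    rw [sum_ite_eq', if_pos (mem_range.2 hlN)]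
  rw [rotCoeff, e, enc_mul_enc_mod hN hg fun i => by split_ifs <;> omega, enc_mod_two hN, cycConv]
  have h1 : ∀ i ∈ range N, (∑ j ∈ range N, if (i + j) % N = 0 then
      g i * (if j = l then 1 else 0) else 0) = if i = j then g i else 0 := by
    intro i hi
    rw [mem_range] at hi
    rw [sum_eq_single l]
    · have : (i + l) % N = 0 ↔ i = j := by
        rw [hl, Nat.add_mod_mod]
        constructor
        · intro h
          obtain ⟨c, hc⟩ := Nat.dvd_of_mod_eq_zero h
          have hc1 : c = 1 := by
            rcases Nat.lt_or_ge c 1 with h1 | h1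
            · have : c = 0 := by omega
              subst this; omega
            · rcases Nat.lt_or_ge c 2 with h2 | h2
              · omega
              · have := Nat.mul_le_mul_left N h2
                omega
          subst hc1
          omega
        · rintro rfl
          rw [Nat.add_sub_cancel' hi.le, Nat.mod_self]
      simp [this]
    · intro j' _ hj'
      simp [hj']
    · exact fun h => absurd (mem_range.2 hlN) h
  rw [sum_congr rfl h1, sum_ite_eq', if_pos (mem_range.2 hj)]
  have := hg j
  omega

/-- If all constant coefficients of rotations cancel modulo two, so do the elements. -/
theorem sum_eltVal_eq_zero {ι : Type*} (hN : 0 < N) (hζ : IsSpreadRoot ζ N d) (S : Finset ι)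
    {x : ι → ℕ} (hx : ∀ i, IsElt N (x i))
    (h : ∀ l < N, Even (∑ i ∈ S, rotCoeff N (x i) l)) : ∑ i ∈ S, eltVal ζ N (x i) = 0 := by
  choose g hg hxg using hx
  simp only [hxg] at h ⊢
  rw [sum_congr rfl fun i _ => eltVal_enc hN (hg i), sum_comm]
  refine sum_eq_zero fun j hj => ?_
  have h1 := h ((N - j) % N) (Nat.mod_lt _ hN)
  rw [sum_congr rfl fun i _ => rotCoeff_enc (hg i) (mem_range.1 hj)] at h1
  rw [← sum_mul, ← Nat.cast_sum, ← hζ.cast_mod_two, Nat.even_iff.1 h1, Nat.cast_zero, zero_mul]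

/-- Numbers below `2 ^ d` give different elements of the field. -/
theorem spread_injective (hd : d ≤ N) (hN : 0 < N) (hζ : IsSpreadRoot ζ N d) {i i' : ℕ}
    (hi : i < 2 ^ d) (hi' : i' < 2 ^ d)
    (h : eltVal ζ N (spread N i) = eltVal ζ N (spread N i')) : i = i' := by
  rw [eltVal_spread hN, eltVal_spread hN] at h
  have hz : ∀ a < 2 ^ d, ∑ l ∈ range N, ((a / 2 ^ l % 2 : ℕ) : K) * ζ ^ l =
      ∑ l ∈ range d, ((a / 2 ^ l % 2 : ℕ) : K) * ζ ^ l := by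
    intro a ha
    rw [← sum_range_add_sum_Ico _ hd, add_eq_left]
    refine sum_eq_zero fun l hl => ?_
    rw [Nat.div_eq_of_lt (ha.trans_le (Nat.pow_le_pow_right (by norm_num) (mem_Ico.1 hl).1))]
    simp
  rw [hz i hi, hz i' hi'] at h
  have h0 := hζ.even_of_sum_eq_zero (fun l => i / 2 ^ l % 2 + i' / 2 ^ l % 2) (by
    simp only [Nat.cast_add, add_mul, sum_add_distrib]
    rw [h, ← two_mul, hζ.two_eq_zero, zero_mul])
  refine Nat.eq_of_testBit_eq fun l => ?_
  by_cases hl : l < d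
  · have := h0 l hl
    rw [Nat.testBit_eq_decide_div_mod_eq, Nat.testBit_eq_decide_div_mod_eq, decide_eq_decide]
    omega
  · have hpow : 2 ^ d ≤ 2 ^ l := Nat.pow_le_pow_right (by norm_num) (by omega)
    rw [Nat.testBit_lt_two_pow (hi.trans_le hpow), Nat.testBit_lt_two_pow (hi'.trans_le hpow)]

end Val

/-- The bits of the number that encodes a string of signs. -/
theorem signCode_eq {m : ℕ} (u : Cube m) :
    signCode u = ∑ j ∈ range m, (if h : j < m then signBit (u ⟨j, h⟩) else 0) * 2 ^ j := by
  rw [signCode, sum_range]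
  refine sum_congr rfl fun i _ => ?_
  simp only [Fin.is_lt, dite_true, Fin.eta, signBit]
  split_ifs <;> simp

theorem signCode_bit {m : ℕ} (u : Cube m) (l : ℕ) :
    signCode u / 2 ^ l % 2 = if h : l < m then signBit (u ⟨l, h⟩) else 0 := by
  rw [signCode_eq, sum_digits_div_mod (by norm_num)]
  · split_ifs <;> rfl
  · intro j
    split_ifs
    · have := signBit_le (u ⟨j, ‹_›⟩); omega
    · omega

theorem signCode_lt {m : ℕ} (u : Cube m) : signCode u < 2 ^ m := by
  rw [signCode_eq]
  refine sum_digits_lt _ (fun j => ?_) m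
  split_ifs
  · have := signBit_le (u ⟨j, ‹_›⟩); omega
  · omega

theorem signVal_neg_one_pow (a : ℕ) : signVal ((-1) ^ a) = (-1) ^ a := by
  rcases Nat.even_or_odd a with h | h
  · rw [h.neg_one_pow, h.neg_one_pow, signVal_one]
  · rw [h.neg_one_pow, h.neg_one_pow, signVal_neg_one]

/-- The characters of linear functions of the bits: the expectation of a product is `1` if the
linear functions cancel modulo two, and `0` otherwise. -/
theorem expect_prod_linear {ι : Type*} (S : Finset ι) (m : ℕ) (c : ι → ℕ → ℕ) :
    𝔼 u : Cube m, ∏ i ∈ S, signVal ((-1) ^ ∑ l ∈ range m, signCode u / 2 ^ l % 2 * c i l) =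
      if ∀ l < m, Even (∑ i ∈ S, c i l) then 1 else 0 := by
  set φ : Fin m → ℤˣ → ℝ := fun l u => (-1) ^ (signBit u * ∑ i ∈ S, c i l) with hφ
  have h1 : ∀ u : Cube m, ∏ i ∈ S, signVal ((-1) ^ ∑ l ∈ range m, signCode u / 2 ^ l % 2 * c i l) =
      ∏ l, φ l (u l) := by
    intro u
    simp only [signVal_neg_one_pow, hφ]
    rw [prod_pow_eq_pow_sum, prod_pow_eq_pow_sum, sum_comm, sum_range]
    congr 1
    refine sum_congr rfl fun l _ => ?_
    rw [mul_sum]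
    refine sum_congr rfl fun i _ => ?_
    rw [signCode_bit]
    simp
  rw [expect_congr rfl fun u _ => h1 u, expect_cube_prod φ]
  have hb1 : signBit 1 = 0 := by decide
  have hb2 : signBit (-1) = 1 := by decide
  simp only [hφ, hb1, hb2, zero_mul, one_mul, pow_zero]
  split_ifs with h
  · refine prod_eq_one fun l _ => ?_
    rw [(h l l.2).neg_one_pow]; norm_num
  · push Not at h
    obtain ⟨l, hl, hodd⟩ := h
    refine prod_eq_zero (mem_univ ⟨l, hl⟩) ?_
    rw [(Nat.not_even_iff_odd.1 hodd).neg_one_pow]; norm_num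

/-- The direction bits of the first generator: bit `i` is the parity of this number, the constant
coefficient of the value at `i` of a polynomial of degree below `k` over `F_2[x]/(x^N - 1)` whose
coefficients are read off the seed `w`. -/
def polyBit (N k i w : ℕ) : ℕ :=
  ∑ j ∈ range k, cycDot N (w / 2 ^ (N * j)) (cycPow N (spread N i) j)

/-- The power sums with exponent below `k` of at most `k` distinct field elements do not all vanish,
as their Vandermonde matrix is invertible. -/
theorem exists_sum_pow_ne_zero {K ι : Type*} [Field K] {S : Finset ι} {k : ℕ} (hS : S.Nonempty)
    (hk : #S ≤ k) {a : ι → K} (ha : Set.InjOn a S) : ∃ j < k, ∑ i ∈ S, a i ^ j ≠ 0 := by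
  by_contra h
  push Not at h
  set e := S.equivFin.symm with he
  have hinj : Function.Injective fun r : Fin #S => a (e r) := fun r r' hr =>
    e.injective (Subtype.ext (ha (e r).2 (e r').2 hr))
  have h0 := Matrix.eq_zero_of_forall_pow_sum_mul_pow_eq_zero (R := K)
    (f := fun r : Fin #S => a (e r)) (v := fun _ => 1) hinj (fun j => by
      simp only [one_mul]
      rw [← h j (by omega), ← S.sum_coe_sort, ← e.sum_comp])
  have hr := congrFun h0 ⟨0, card_pos.2 hS⟩
  exact one_ne_zero hr

/-- The direction bits of the first generator are independent in groups of fewer than `k`: a linear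
relation would make all power sums of the corresponding field elements vanish. -/
theorem expect_polyBit_eq_zero {n k j : ℕ} (hn : n ≤ 2 ^ (2 * 3 ^ j)) (S : Finset (Fin n))
    (hS : 1 ≤ #S) (hk : #S < k) :
    𝔼 u : Cube (k * 3 ^ (j + 1)),
      ∏ i ∈ S, signVal ((-1) ^ polyBit (3 ^ (j + 1)) k i (signCode u)) = 0 := by
  obtain ⟨K, _, ζ, hζ⟩ := exists_isSpreadRoot j
  set N := 3 ^ (j + 1) with hNdef
  set d := 2 * 3 ^ j with hddef
  have hN : 0 < N := by positivity
  have hd : d ≤ N := by rw [hNdef, hddef, pow_succ]; omega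
  -- each direction bit is a linear function of all bits of the seed
  have hlin : ∀ (i : Fin n) (w : ℕ), polyBit N k i w = ∑ l ∈ range (k * N),
      w / 2 ^ l % 2 * rotCoeff N (cycPow N (spread N i) (l / N)) (l % N) := by
    intro i w
    rw [sum_range_mul, polyBit]
    refine sum_congr rfl fun j _ => sum_congr rfl fun l hl => ?_
    rw [mem_range] at hl
    rw [Nat.mul_add_mod, Nat.mod_eq_of_lt hl, Nat.mul_add_div hN, Nat.div_eq_of_lt hl, add_zero,
      Nat.div_div_eq_div_mul, ← pow_add]
  simp only [hlin]
  rw [expect_prod_linear, if_neg]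
  intro heven
  have hS' : S.Nonempty := card_pos.1 hS
  have hinj : Set.InjOn (fun i : Fin n => eltVal ζ N (spread N i)) S := by
    intro i _ i' _ h
    exact Fin.ext (spread_injective hd hN hζ (by omega) (by omega) h)
  obtain ⟨c, hc, hne⟩ := exists_sum_pow_ne_zero hS' hk.le hinj
  refine hne ?_
  rw [← sum_eltVal_eq_zero hN hζ S
    (fun i => isElt_cycPow hN (isElt_spread (i : ℕ)) c) fun l hl => ?_]
  · exact sum_congr rfl fun i _ => (eltVal_cycPow hN hζ (isElt_spread _) c).symm
  · have hlt : N * c + l < k * N := by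
      have := Nat.mul_le_mul_left N hc
      rw [Nat.mul_succ, mul_comm N k] at this
      omega
    have := heven (N * c + l) hlt
    rwa [Nat.mul_add_mod, Nat.mod_eq_of_lt hl, Nat.mul_add_div hN, Nat.div_eq_of_lt hl,
      add_zero] at this

/-- The sum of the powers of `α` whose exponents are marks of `i`. -/
def markSum (N R i α : ℕ) : ℕ → ℕ
  | 0 => 0
  | e + 1 => if IsMark R i e then markSum N R i α e ^^^ cycPow N α e else markSum N R i α e

/-- The direction bits of the second generator: bit `i` is the parity of this number, the constant
coefficient of `β C_i(α)` in `F_2[x]/(x^N - 1)`, where `α` and `β` are read off the seed `w` and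
`C_i` is the mark polynomial of `i`. -/
def biasBit (N R i w : ℕ) : ℕ :=
  cycDot N (w / 2 ^ N) (markSum N R i (spread N w) (R * (R + 1)))

theorem isElt_markSum {N : ℕ} (hN : 0 < N) (R i : ℕ) {α : ℕ} (hα : IsElt N α) (e : ℕ) :
    IsElt N (markSum N R i α e) := by
  induction e with
  | zero => exact isElt_zero
  | succ e ih =>
    rw [markSum]
    split_ifs
    · exact ih.xor hN (isElt_cycPow hN hα e)
    · exact ih

theorem eltVal_markSum {K : Type} [Field K] {ζ : K} {N d : ℕ} (hN : 0 < N)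
    (hζ : IsSpreadRoot ζ N d) (R i : ℕ) {α : ℕ} (hα : IsElt N α) (e : ℕ) :
    eltVal ζ N (markSum N R i α e) =
      ∑ c ∈ (range e).filter (IsMark R i), eltVal ζ N α ^ c := by
  induction e with
  | zero => simp [markSum, eltVal_zero]
  | succ e ih =>
    rw [markSum, range_add_one, filter_insert]
    split_ifs
    · rw [eltVal_xor hN hζ (isElt_markSum hN R i hα e) (isElt_cycPow hN hα e), ih,
        eltVal_cycPow hN hζ hα, sum_insert (by simp), add_comm]
    · exact ih

/-- The direction bits of the second generator have small bias on sets of fewer than `k` indices: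
for most `α` the mark polynomial of the set does not vanish at `α`. -/
theorem abs_expect_biasBit_le {n k m j : ℕ} (hm : 1 ≤ m) (hn : n ≤ 2 ^ m) (S : Finset (Fin n))
    (hS : 1 ≤ #S) (hk : #S < k) :
    |𝔼 u : Cube (2 * 3 ^ (j + 1)),
      ∏ i ∈ S, signVal ((-1) ^ biasBit (3 ^ (j + 1)) (2 * (k * m)) i (signCode u))| ≤
        (2 * (k * m) * (2 * (k * m) + 1) : ℕ) / 2 ^ (2 * 3 ^ j) := by
  classical
  obtain ⟨K, _, ζ, hζ⟩ := exists_isSpreadRoot j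
  set N := 3 ^ (j + 1) with hNdef
  set d := 2 * 3 ^ j with hddef
  set R := 2 * (k * m) with hR
  have hN : 0 < N := by positivity
  have hd : d ≤ N := by rw [hNdef, hddef, pow_succ]; omega
  -- the first half of the seed gives `α` and the second half gives `β`
  have hsplit : 𝔼 u : Cube (2 * N), ∏ i ∈ S, signVal ((-1) ^ biasBit N R i (signCode u)) =
      𝔼 a : Cube N, 𝔼 b : Cube N, ∏ i ∈ S, signVal ((-1) ^
        cycDot N (signCode b) (markSum N R i (spread N (signCode a)) (R * (R + 1)))) := by
    rw [two_mul, ← expect_product' univ univ fun a b : Cube N => ∏ i ∈ S, signVal ((-1) ^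
        cycDot N (signCode b) (markSum N R i (spread N (signCode a)) (R * (R + 1)))),
      univ_product_univ]
    refine (Fintype.expect_equiv (Fin.appendEquiv N N) _ _ fun q => ?_).symm
    have hlow : ∀ l < N, signCode (Fin.append q.1 q.2) / 2 ^ l % 2 = signCode q.1 / 2 ^ l % 2 := by
      intro l hl
      rw [signCode_bit, signCode_bit, dif_pos (by omega), dif_pos hl]
      congr 1
      exact Fin.append_left q.1 q.2 ⟨l, hl⟩
    have hhigh : ∀ l < N, signCode (Fin.append q.1 q.2) / 2 ^ N / 2 ^ l % 2 =
        signCode q.2 / 2 ^ l % 2 := by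
      intro l hl
      rw [Nat.div_div_eq_div_mul, ← pow_add, signCode_bit, signCode_bit, dif_pos (by omega),
        dif_pos hl]
      congr 1
      exact Fin.append_right q.1 q.2 ⟨l, hl⟩
    refine prod_congr rfl fun i _ => ?_
    have e1 : spread N (signCode (Fin.append q.1 q.2)) = spread N (signCode q.1) := by
      rw [spread, spread, enc, enc]
      exact sum_congr rfl fun l hl => by rw [hlow l (mem_range.1 hl)]
    change _ = signVal ((-1) ^ biasBit N R i (signCode (Fin.append q.1 q.2)))
    rw [biasBit, e1]
    congr 2
    exact sum_congr rfl fun l hl => by rw [hhigh l (mem_range.1 hl)]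
  rw [hsplit]
  simp only [cycDot]
  simp only [expect_prod_linear]
  -- for fixed `α` the bits are linear in `β`, and they cancel only if `P` vanishes at `α`
  set P : K[X] := ∑ i ∈ S, markPoly K R i with hP
  have hP0 : P ≠ 0 := by
    have h1 : P = ∑ i ∈ S.image (fun i : Fin n => (i : ℕ)), markPoly K R i := by
      rw [sum_image fun i _ i' _ h => Fin.ext h]
    rw [h1]
    have hcard : #(S.image fun i : Fin n => (i : ℕ)) = #S :=
      card_image_of_injective _ Fin.val_injective
    refine sum_markPoly_ne_zero hm _ (fun i hi => ?_) ?_ (by rw [hcard]; exact hk)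
    · obtain ⟨i', _, rfl⟩ := mem_image.1 hi
      exact i'.2.trans_le hn
    · exact (card_pos.1 hS).image _
  have hdeg : P.natDegree ≤ R * (R + 1) := by
    have h1 : P = ∑ i ∈ S.image (fun i : Fin n => (i : ℕ)), markPoly K R i := by
      rw [sum_image fun i _ i' _ h => Fin.ext h]
    rw [h1]
    exact natDegree_sum_markPoly_le R _
  have himp : ∀ a : Cube N, (∀ l < N, Even (∑ i ∈ S,
      rotCoeff N (markSum N R i (spread N (signCode a)) (R * (R + 1))) l)) →
        P.eval (bitEval ζ a) = 0 := by
    intro a ha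
    have h1 := sum_eltVal_eq_zero hN hζ S
      (fun i => isElt_markSum hN R i (isElt_spread (signCode a)) _) ha
    have h2 : eltVal ζ N (spread N (signCode a)) = bitEval ζ a := by
      rw [eltVal_spread hN, sum_range, bitEval]
      refine sum_congr rfl fun l _ => ?_
      rw [signCode_bit, dif_pos l.2]
    rw [← h1, hP, eval_finsetSum]
    refine sum_congr rfl fun i _ => ?_
    rw [eltVal_markSum hN hζ R i (isElt_spread _), h2, markPoly, eval_finsetSum]
    simp
  have hcount := card_root_bitEval_le hd hζ hP0
  rw [abs_of_nonneg (by
    rw [Fintype.expect_eq_sum_div_card]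
    exact div_nonneg (sum_nonneg fun a _ => by split_ifs <;> norm_num) (by positivity)),
    Fintype.expect_eq_sum_div_card, sum_boole, div_le_div_iff₀ (by simp) (by positivity)]
  have hpow : 2 ^ (N - d) * 2 ^ d = 2 ^ N := by rw [← pow_add, Nat.sub_add_cancel hd]
  have h3 : #{a : Cube N | ∀ l < N, Even (∑ i ∈ S,
      rotCoeff N (markSum N R i (spread N (signCode a)) (R * (R + 1))) l)} * 2 ^ d ≤
        R * (R + 1) * 2 ^ N := by
    rw [← hpow, ← mul_assoc]
    refine Nat.mul_le_mul_right _ ((card_le_card ?_).trans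
      (hcount.trans (Nat.mul_le_mul_right _ hdeg)))
    intro a ha
    simp only [mem_filter, mem_univ, true_and] at ha ⊢
    exact himp a ha
  have h4 : (Fintype.card (Cube N) : ℝ) = ((2 ^ N : ℕ) : ℝ) := by simp
  rw [h4]
  exact_mod_cast h3

/-! ### A verified calculus of programs -/

/-- The variables of the programs below; the first five hold the input. As the variables are
finitely many, a state is a record, and the effect of a program on it can be stated by a record
update. -/
inductive Var
  | n | k | b | e | seed | x | kk | se | lg | sl | sb | a | pa | t | sn | rr | mm | nn | c0
  | sg | bq | ms | md | out | pi | i | ci | z | al | q | uu | vv | ws | ct | acc | cj | pw | g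
  | ce | h
  deriving DecidableEq

/-- The values of all variables. -/
structure Env where
  (n k b e seed x kk se lg sl sb a pa t sn rr mm nn c0 sg bq ms md out pi i ci z al q uu vv ws ct
  acc cj pw g ce h : ℕ)

/-- The value of a variable. -/
def Env.get (σ : Env) : Var → ℕ
  | .n => σ.n | .k => σ.k | .b => σ.b | .e => σ.e | .seed => σ.seed | .x => σ.x | .kk => σ.kk
  | .se => σ.se | .lg => σ.lg | .sl => σ.sl | .sb => σ.sb | .a => σ.a | .pa => σ.pa | .t => σ.t
  | .sn => σ.sn | .rr => σ.rr | .mm => σ.mm | .nn => σ.nn | .c0 => σ.c0 | .sg => σ.sg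
  | .bq => σ.bq | .ms => σ.ms | .md => σ.md | .out => σ.out | .pi => σ.pi | .i => σ.i
  | .ci => σ.ci | .z => σ.z | .al => σ.al | .q => σ.q | .uu => σ.uu | .vv => σ.vv | .ws => σ.ws
  | .ct => σ.ct | .acc => σ.acc | .cj => σ.cj | .pw => σ.pw | .g => σ.g | .ce => σ.ce
  | .h => σ.h

/-- Changing the value of a variable. -/
def Env.set (σ : Env) (v : Var) (c : ℕ) : Env :=
  match v with
  | .n => {σ with n := c} | .k => {σ with k := c} | .b => {σ with b := c}
  | .e => {σ with e := c} | .seed => {σ with seed := c} | .x => {σ with x := c}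
  | .kk => {σ with kk := c} | .se => {σ with se := c} | .lg => {σ with lg := c}
  | .sl => {σ with sl := c} | .sb => {σ with sb := c} | .a => {σ with a := c}
  | .pa => {σ with pa := c} | .t => {σ with t := c} | .sn => {σ with sn := c}
  | .rr => {σ with rr := c} | .mm => {σ with mm := c} | .nn => {σ with nn := c}
  | .c0 => {σ with c0 := c} | .sg => {σ with sg := c} | .bq => {σ with bq := c}
  | .ms => {σ with ms := c} | .md => {σ with md := c} | .out => {σ with out := c}
  | .pi => {σ with pi := c} | .i => {σ with i := c} | .ci => {σ with ci := c}
  | .z => {σ with z := c} | .al => {σ with al := c} | .q => {σ with q := c}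
  | .uu => {σ with uu := c} | .vv => {σ with vv := c} | .ws => {σ with ws := c}
  | .ct => {σ with ct := c} | .acc => {σ with acc := c} | .cj => {σ with cj := c}
  | .pw => {σ with pw := c} | .g => {σ with g := c} | .ce => {σ with ce := c}
  | .h => {σ with h := c}

attribute [simp] Env.get Env.set

/-- The register that holds a variable. -/
def Var.code (v : Var) : ℕ := v.ctorIdx

/-- The variable held by a register. -/
def Var.ofCode (c : ℕ) : Var :=
  ([
    .n, .k, .b, .e, .seed, .x, .kk, .se, .lg, .sl, .sb, .a, .pa, .t, .sn, .rr, .mm, .nn, .c0,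
    .sg, .bq, .ms, .md, .out, .pi, .i, .ci, .z, .al, .q, .uu, .vv, .ws, .ct, .acc, .cj, .pw, .g,
    .ce, .h] : List Var).getD c .n

theorem Var.ofCode_code (v : Var) : Var.ofCode v.code = v := by cases v <;> rfl

theorem Var.code_injective : Function.Injective Var.code :=
  Function.LeftInverse.injective Var.ofCode_code

theorem Var.code_lt (v : Var) : v.code < 100 := by cases v <;> decide

theorem Env.get_set_self (σ : Env) (v : Var) (c : ℕ) : (σ.set v c).get v = c := by
  cases v <;> rfl

theorem Env.get_set_of_ne (σ : Env) {v w : Var} (h : w ≠ v) (c : ℕ) :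
    (σ.set v c).get w = σ.get w := by
  cases v <;> cases w <;> first | rfl | exact absurd rfl h

/-- Arithmetic expressions. -/
inductive Expr
  | var (v : Var)
  | const (c : ℕ)
  | bin (o : RamOp) (p q : Expr)

instance : Coe Var Expr := ⟨Expr.var⟩
instance (c : ℕ) : OfNat Expr c := ⟨Expr.const c⟩
instance : Add Expr := ⟨Expr.bin .add⟩
instance : Sub Expr := ⟨Expr.bin .sub⟩
instance : Mul Expr := ⟨Expr.bin .mul⟩
instance : Div Expr := ⟨Expr.bin .div⟩
instance : Mod Expr := ⟨Expr.bin .mod⟩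
instance : XorOp Expr := ⟨Expr.bin .xor⟩
instance : AndOp Expr := ⟨Expr.bin .and⟩

namespace Expr

/-- The value of an expression. -/
def eval (σ : Env) : Expr → ℕ
  | var v => σ.get v
  | const c => c
  | bin o p q => o.eval (eval σ p) (eval σ q)

@[simp] theorem eval_var (σ : Env) (v : Var) : (var v).eval σ = σ.get v := rfl
@[simp] theorem eval_ofNat (σ : Env) (c : ℕ) : (no_index (OfNat.ofNat c) : Expr).eval σ = c := rfl
@[simp] theorem eval_add (σ : Env) (p q : Expr) : (p + q).eval σ = p.eval σ + q.eval σ := rfl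
@[simp] theorem eval_sub (σ : Env) (p q : Expr) : (p - q).eval σ = p.eval σ - q.eval σ := rfl
@[simp] theorem eval_mul (σ : Env) (p q : Expr) : (p * q).eval σ = p.eval σ * q.eval σ := rfl
@[simp] theorem eval_div (σ : Env) (p q : Expr) : (p / q).eval σ = p.eval σ / q.eval σ := rfl
@[simp] theorem eval_mod (σ : Env) (p q : Expr) : (p % q).eval σ = p.eval σ % q.eval σ := rfl
@[simp] theorem eval_xor (σ : Env) (p q : Expr) : (p ^^^ q).eval σ = p.eval σ ^^^ q.eval σ := rfl
@[simp] theorem eval_and (σ : Env) (p q : Expr) : (p &&& q).eval σ = p.eval σ &&& q.eval σ := rfl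

/-- The number of leaves of an expression. -/
def leaves : Expr → ℕ
  | var _ => 1
  | const _ => 1
  | bin _ p q => leaves p + leaves q

/-- A bound for the cost of the evaluation, in units of the largest length of a variable. -/
def cost : Expr → ℕ
  | var _ => 3
  | const _ => 2
  | bin _ p q => cost p + cost q + (1 + leaves p + leaves q)

/-- All constants of the expression have at most seven bits. -/
def smallConst : Expr → Bool
  | var _ => true
  | const c => decide (c < 128)
  | bin _ p q => smallConst p && smallConst q

/-- The program that computes the expression into register `d`, using the registers from `d` on. A
variable is copied by its bitwise conjunction with itself. -/
def compile : Expr → ℕ → Prog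
  | var v, d => .op .and d v.code v.code
  | const c, d => .const d c
  | bin o p q, d => .seq (compile p d) (.seq (compile q (d + 1)) (.op o d d (d + 1)))

end Expr

/-- The registers hold the values of the variables. -/
def Sim (s : ℕ → ℕ) (σ : Env) : Prop := ∀ v : Var, s v.code = σ.get v

/-- All variables have at most `l` bits. -/
def Env.Bdd (l : ℕ) (σ : Env) : Prop := ∀ v : Var, σ.get v < 2 ^ l

theorem RamOp.size_eval_le (o : RamOp) (a b : ℕ) : (o.eval a b).size ≤ a.size + b.size := by
  have hle : ∀ c, c ≤ a → c.size ≤ a.size + b.size := fun c hc =>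
    (Nat.size_le_size hc).trans (Nat.le_add_right _ _)
  cases o with
  | add =>
    simp only [RamOp.eval]
    rcases Nat.eq_zero_or_pos a with rfl | ha
    · simp
    rcases Nat.eq_zero_or_pos b with rfl | hb
    · simp
    rw [Nat.size_le, pow_add]
    have h1 := Nat.lt_size_self a
    have h2 := Nat.lt_size_self b
    have h3 : 2 ≤ 2 ^ a.size := by omega
    have h4 : 2 ≤ 2 ^ b.size := by omega
    nlinarith
  | sub => exact hle _ (Nat.sub_le _ _)
  | mul =>
    simp only [RamOp.eval]
    rw [Nat.size_le, pow_add]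
    exact Nat.mul_lt_mul'' (Nat.lt_size_self a) (Nat.lt_size_self b)
  | div => exact hle _ (Nat.div_le_self _ _)
  | mod => exact hle _ (Nat.mod_le _ _)
  | xor =>
    simp only [RamOp.eval]
    rw [Nat.size_le]
    exact Nat.xor_lt_two_pow
      ((Nat.lt_size_self a).trans_le (Nat.pow_le_pow_right (by norm_num) (by omega)))
      ((Nat.lt_size_self b).trans_le (Nat.pow_le_pow_right (by norm_num) (by omega)))
  | and => exact hle _ Nat.and_le_left

namespace Expr

theorem size_eval_le {l : ℕ} (hl : 7 ≤ l) {σ : Env} (hσ : σ.Bdd l) (p : Expr)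
    (hp : p.smallConst = true) : (p.eval σ).size ≤ p.leaves * l := by
  induction p with
  | var v => rw [leaves, one_mul, eval, Nat.size_le]; exact hσ v
  | const c =>
    simp only [smallConst, decide_eq_true_eq] at hp
    rw [leaves, one_mul, eval, Nat.size_le]
    exact hp.trans_le (Nat.pow_le_pow_right (n := 2) (by norm_num) hl)
  | bin o p q ihp ihq =>
    simp only [smallConst, Bool.and_eq_true] at hp
    rw [leaves, eval, add_mul]
    exact (RamOp.size_eval_le o _ _).trans (add_le_add (ihp hp.1) (ihq hp.2))

/-- The compiled expression leaves the registers below `d`, hence all variables, unchanged. -/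
theorem compile_runs {l : ℕ} (hl : 7 ≤ l) {σ : Env} (hσ : σ.Bdd l) (p : Expr)
    (hp : p.smallConst = true) (d : ℕ) (hd : 100 ≤ d) (s : ℕ → ℕ) (hs : Sim s σ) :
    ∃ t s', (p.compile d).Runs s t s' ∧ t ≤ p.cost * l ∧ s' d = p.eval σ ∧
      ∀ r < d, s' r = s r := by
  induction p generalizing d s with
  | var v =>
    refine ⟨_, _, Prog.Runs.op .and d v.code v.code s, ?_, ?_, fun r hr => ?_⟩
    · have : (s v.code).size ≤ l := by rw [hs v, Nat.size_le]; exact hσ v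
      rw [cost]; omega
    · simp [RamOp.eval, eval, hs v]
    · exact Function.update_of_ne (by omega) _ _
  | const c =>
    refine ⟨_, _, Prog.Runs.const d c s, ?_, ?_, fun r hr => ?_⟩
    · have := size_eval_le hl hσ (const c) hp
      simp only [leaves, eval] at this
      rw [cost]; omega
    · simp [eval]
    · exact Function.update_of_ne (by omega) _ _
  | bin o p q ihp ihq =>
    have hp' := hp
    simp only [smallConst, Bool.and_eq_true] at hp
    obtain ⟨t1, s1, r1, c1, v1, f1⟩ := ihp hp.1 d hd s hs
    have hs1 : Sim s1 σ := fun v => by rw [f1 _ (by have := v.code_lt; omega), hs v]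
    obtain ⟨t2, s2, r2, c2, v2, f2⟩ := ihq hp.2 (d + 1) (by omega) s1 hs1
    refine ⟨_, _, r1.seq (r2.seq (Prog.Runs.op o d d (d + 1) s2)), ?_, ?_, fun r hr => ?_⟩
    · rw [f2 d (by omega), v1, v2, cost]
      have h1 := size_eval_le hl hσ p hp.1
      have h2 := size_eval_le hl hσ q hp.2
      have : (p.cost + q.cost + (1 + p.leaves + q.leaves)) * l =
        p.cost * l + q.cost * l + l + p.leaves * l + q.leaves * l := by ring
      omega
    · rw [Function.update_self, f2 d (by omega), v1, v2, eval]
    · rw [Function.update_of_ne (by omega), f2 r (by omega), f1 r hr]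

end Expr

/-- The program `p` turns the values `σ` of the variables into `τ`, in time at most `N * (100 * l)`
and with all variables bounded by `l` bits at the end if they are at the start. -/
def Exec (l : ℕ) (p : Prog) (σ : Env) (N : ℕ) (τ : Env) : Prop :=
  7 ≤ l → σ.Bdd l → ∀ s, Sim s σ → ∃ t s', p.Runs s t s' ∧ Sim s' τ ∧ t ≤ N * (100 * l) ∧ τ.Bdd l

/-- The assignment of the value of an expression to a variable. -/
def assign (v : Var) (p : Expr) : Prog := .seq (p.compile 100) (.op .and v.code 100 100)

/-- The loop that runs as long as a variable is nonzero. -/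
def whileNz (v : Var) (p : Prog) : Prog := .loop v.code p

/-- The case distinction whether a variable is nonzero. -/
def ifNz (v : Var) (p q : Prog) : Prog := .ite v.code p q

/-- The program that changes no variable: register `100` lies beyond the variables. -/
def skipProg : Prog := .const 100 0

infix:60 " ::= " => assign
infixr:50 " ;; " => Prog.seq

/-- The expression is small enough for its assignment to take one unit of time. -/
def Expr.ok (p : Expr) : Bool := p.smallConst && decide (p.cost + 1 + 2 * p.leaves ≤ 100)

namespace Exec

variable {l N M : ℕ} {σ τ υ : Env} {p q : Prog}

theorem mono (h : Exec l p σ N τ) (hNM : N ≤ M) : Exec l p σ M τ := fun hl hσ s hs => by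
  obtain ⟨t, s', r, h1, h2, h3⟩ := h hl hσ s hs
  exact ⟨t, s', r, h1, h2.trans (Nat.mul_le_mul_right _ hNM), h3⟩

theorem seq (hp : Exec l p σ N τ) (hq : Exec l q τ M υ) : Exec l (p ;; q) σ (N + M) υ :=
  fun hl hσ s hs => by
    obtain ⟨t, s', r, h1, h2, h3⟩ := hp hl hσ s hs
    obtain ⟨t', s'', r', h1', h2', h3'⟩ := hq hl h3 s' h1
    exact ⟨_, _, r.seq r', h1', by rw [add_mul]; exact add_le_add h2 h2', h3'⟩

theorem seq_of_eq (hp : Exec l p υ N τ) (h : σ = υ) {ω : Env} (hq : Exec l q τ M ω) :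
    Exec l (p ;; q) σ (N + M) ω := by subst h; exact hp.seq hq

theorem assign {v : Var} {e : Expr} (he : e.ok = true) (hb : σ.Bdd l → e.eval σ < 2 ^ l) :
    Exec l (v ::= e) σ 1 (σ.set v (e.eval σ)) := fun hl hσ s hs => by
  simp only [Expr.ok, Bool.and_eq_true, decide_eq_true_eq] at he
  obtain ⟨t, s', r, h1, h2, h3⟩ := e.compile_runs hl hσ he.1 100 le_rfl s hs
  refine ⟨_, _, r.seq (.op .and v.code 100 100 s'), fun w => ?_, ?_, fun w => ?_⟩
  · by_cases hw : w = v
    · subst hw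
      rw [Function.update_self, Env.get_set_self, h2]
      simp [RamOp.eval]
    · rw [Function.update_of_ne fun h => hw (Var.code_injective h), Env.get_set_of_ne _ hw,
        h3 _ w.code_lt, hs w]
  · rw [h2]
    have := e.size_eval_le hl hσ he.1
    have h4 := Nat.mul_le_mul_right l he.2
    rw [add_mul, add_mul, mul_assoc 2] at h4
    omega
  · by_cases hw : w = v
    · subst hw
      rw [Env.get_set_self]; exact hb hσ
    · rw [Env.get_set_of_ne _ hw]; exact hσ w

/-- An assignment in front of a program. -/
theorem step {v : Var} {e : Expr} (he : e.ok = true) (hb : σ.Bdd l → e.eval σ < 2 ^ l)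
    (h : Exec l q (σ.set v (e.eval σ)) N τ) : Exec l (v ::= e ;; q) σ (1 + N) τ :=
  (assign he hb).seq h

/-- An assignment at the end of a program. -/
theorem last {v : Var} {e : Expr} (he : e.ok = true) (hb : σ.Bdd l → e.eval σ < 2 ^ l)
    (h : σ.set v (e.eval σ) = τ) : Exec l (v ::= e) σ 1 τ := h ▸ assign he hb

theorem skipProg : Exec l skipProg σ 1 σ := fun hl hσ s hs => by
  refine ⟨_, _, .const 100 0 s, fun v => ?_, ?_, hσ⟩
  · rw [Function.update_of_ne (by have := v.code_lt; omega), hs v]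
  · simp; omega

theorem ifNz_pos {v : Var} (hv : σ.get v ≠ 0) (h : Exec l p σ N τ) :
    Exec l (ifNz v p q) σ (1 + N) τ := fun hl hσ s hs => by
  obtain ⟨t, s', r, h1, h2, h3⟩ := h hl hσ s hs
  refine ⟨_, s', .ite_pos (by rwa [hs v]) r, h1, ?_, h3⟩
  have : (s v.code).size ≤ l := by rw [hs v, Nat.size_le]; exact hσ v
  rw [add_mul]; omega

theorem ifNz_neg {v : Var} (hv : σ.get v = 0) (h : Exec l q σ N τ) :
    Exec l (ifNz v p q) σ (1 + N) τ := fun hl hσ s hs => by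
  obtain ⟨t, s', r, h1, h2, h3⟩ := h hl hσ s hs
  refine ⟨_, s', .ite_neg (by rwa [hs v]) r, h1, ?_, h3⟩
  have : (s v.code).size ≤ l := by rw [hs v, Nat.size_le]; exact hσ v
  rw [add_mul]; omega

/-- A loop that is run through `m` times, with the values `E j` after `j` rounds. -/
theorem loop {v : Var} (E : ℕ → Env) (m : ℕ) (hne : ∀ j < m, (E j).get v ≠ 0)
    (hz : (E m).get v = 0) (hstep : ∀ j < m, Exec l p (E j) N (E (j + 1))) :
    Exec l (whileNz v p) (E 0) (m * (N + 1) + 1) (E m) := by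
  induction m generalizing E with
  | zero =>
    intro hl hσ s hs
    refine ⟨_, s, .loop_done (by rw [← hz]; exact hs v), hs, ?_, hσ⟩
    rw [hs v, hz]; simp; omega
  | succ m ih =>
    intro hl hσ s hs
    obtain ⟨t, s', r, h1, h2, h3⟩ := hstep 0 (by omega) hl hσ s hs
    obtain ⟨t', s'', r', h1', h2', h3'⟩ := ih (fun j => E (j + 1)) (fun j hj => hne _ (by omega)) hz
      (fun j hj => hstep _ (by omega)) hl h3 s' h1
    refine ⟨_, s'', .loop_step (by rw [hs v]; exact hne 0 (by omega)) r r', h1', ?_, h3'⟩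
    have h4 : (s v.code).size ≤ l := by rw [hs v, Nat.size_le]; exact hσ v
    have h5 : ((m + 1) * (N + 1) + 1) * (100 * l) =
      (m * (N + 1) + 1) * (100 * l) + N * (100 * l) + 100 * l := by ring
    omega

end Exec

/-! ### Programs for the directions and the walk -/

section Programs

open Var

/-- One round of `spreadProg`. -/
def spreadBody : Prog :=
  al ::= al + (z % 2) * q ;; z ::= z / 2 ;; q ::= q * bq ;; x ::= x - 1

/-- Move the lowest `nn` bits of `z` to the digits of `al`. -/
def spreadProg : Prog :=
  al ::= 0 ;; q ::= 1 ;; x ::= nn ;; whileNz x spreadBody ;; q ::= 0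

/-- One round of `dotProg`. -/
def dotBody : Prog :=
  acc ::= acc + (ws % 2) * (g % 2) ;; ws ::= ws / 2 ;; g ::= (g * bq) % md ;; x ::= x - 1

/-- Add to `acc` the inner product of the lowest `nn` bits of `ws` with the rotations of `g`. -/
def dotProg : Prog := x ::= nn ;; whileNz x dotBody ;; g ::= 0

/-- One round of `polyStep`. -/
def polyBody : Prog :=
  g ::= pw ;; dotProg ;; pw ::= (((pw * al) % md) &&& ms) ;; cj ::= cj - 1

/-- A direction bit of the first generator: the program for `polyBit`. -/
def polyStep : Prog :=
  z ::= i ;; spreadProg ;; z ::= 0 ;; acc ::= 0 ;; g ::= 0 ;; pw ::= 1 ;;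
    cj ::= kk ;; whileNz cj polyBody ;; al ::= 0 ;; pw ::= 0

/-- The end of a round of `biasStep`. -/
def biasTail : Prog := h ::= 0 ;; pw ::= (((pw * al) % md) &&& ms) ;; ce ::= ce + 1 ;; cj ::= cj - 1

/-- One round of `biasStep`. -/
def biasBody : Prog :=
  h ::= ((ce % rr) ^^^ (i % (ce / rr))) ;; ifNz h skipProg (g ::= (g ^^^ pw)) ;;
    biasTail

/-- The part of `biasStep` after the loop. -/
def biasEnd : Prog := acc ::= 0 ;; dotProg ;; al ::= 0 ;; pw ::= 0 ;; ce ::= 0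

/-- A direction bit of the second generator: the program for `biasBit`. -/
def biasStep : Prog :=
  z ::= ws ;; spreadProg ;; ws ::= z ;; z ::= 0 ;; g ::= 0 ;; pw ::= 1 ;; ce ::= 0 ;;
    h ::= 0 ;; cj ::= rr * (rr + 1) ;; whileNz cj biasBody ;; biasEnd

/-- One step of the walk of a coordinate, in the direction computed by `step`. -/
def walkBody (step : Prog) : Prog :=
  step ;; acc ::= acc % 2 ;; h ::= uu - (uu - vv) ;;
    ifNz acc (uu ::= pa * uu - h ;; vv ::= pa * vv + h)
      (uu ::= pa * uu + h ;; vv ::= pa * vv - h) ;;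
      acc ::= 0 ;; h ::= 0 ;; ct ::= ct - 1

/-- The walk of a coordinate. -/
def walkProg (step : Prog) : Prog :=
  uu ::= 1 ;; vv ::= 1 ;; ws ::= seed ;; ct ::= t ;; whileNz ct (walkBody step)

/-- The walk of a coordinate and its contribution to the output. -/
def rowBody (step : Prog) : Prog :=
  walkProg step ;; h ::= vv - uu ;; ifNz h (out ::= out + pi) skipProg ;;
    h ::= 0 ;; uu ::= 0 ;; vv ::= 0 ;; ws ::= 0 ;; pi ::= pi * 2 ;; i ::= i + 1 ;; ci ::= ci - 1

/-- The walks of all coordinates. -/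
def rowsProg (step : Prog) : Prog :=
  out ::= 0 ;; pi ::= 1 ;; i ::= 0 ;; ci ::= n ;; whileNz ci (rowBody step)

end Programs

/-- The variables that describe the ring hold the right values, which fit into `l` bits. -/
structure RingReady (l N : ℕ) (σ : Env) : Prop where
  pos : 0 < N
  nn : σ.nn = N
  bq : σ.bq = radix N
  md : σ.md = cycMod N
  ms : σ.ms = digitMask N
  fits : radix N ^ N < 2 ^ l

theorem cycMod_pos {N : ℕ} (hN : 0 < N) : 0 < cycMod N := by
  have := two_lt_radix hN
  rw [cycMod_eq]
  exact Nat.mul_pos (digitMask_pos hN) (by omega)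

theorem digitMask_lt {N : ℕ} (hN : 0 < N) : digitMask N < radix N ^ N := by
  have h1 := digitMask_mul_add N
  have h2 := two_lt_radix hN
  have h3 : digitMask N * 2 ≤ digitMask N * (radix N - 1) := Nat.mul_le_mul_left _ (by omega)
  omega

theorem IsElt.lt_radix_pow {N : ℕ} (hN : 0 < N) {y : ℕ} (hy : IsElt N y) : y < radix N ^ N :=
  (hy.lt_cycMod hN).trans_le (Nat.sub_le _ _)

theorem le_two_pow_pow (N : ℕ) (hN : 0 < N) : N < radix N ^ N := by
  calc N < 4 ^ N := Nat.lt_pow_self (by norm_num)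
    _ ≤ radix N ^ N := by
      rw [radix]; exact Nat.le_self_pow hN.ne' _

theorem spreadProg_exec {l N : ℕ} {σ : Env} (hσ : RingReady l N σ) :
    Exec l spreadProg σ (5 * N + 5)
      {σ with al := spread N σ.z, z := σ.z / 2 ^ N, q := 0, x := 0} := by
  have hb := two_lt_radix hσ.pos
  have hfit := hσ.fits
  have hq : ∀ j ≤ N, radix N ^ j < 2 ^ l := fun j hj =>
    (Nat.pow_le_pow_right (by omega) hj).trans_lt hfit
  have hal : ∀ j ≤ N, ∑ c ∈ range j, σ.z / 2 ^ c % 2 * radix N ^ c < 2 ^ l := fun j hj =>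
    (sum_digits_lt _ (fun c => by omega) j).trans (hq j hj)
  have loop := Exec.loop (l := l) (v := Var.x) (N := 4) (p := spreadBody)
    (fun j => {σ with al := ∑ c ∈ range j, σ.z / 2 ^ c % 2 * radix N ^ c, z := σ.z / 2 ^ j,
                      q := radix N ^ j, x := N - j}) N
    (fun j hj => Nat.sub_ne_zero_of_lt hj) (Nat.sub_self _) (fun j hj => by
      refine .step (by rfl) (fun _ => ?_) (.step (by rfl) (fun H => ?_) (.step (by rfl)
        (fun _ => ?_) (.last (by rfl) (fun H => ?_) ?_)))
      · dsimp; rw [← sum_range_succ]; exact hal _ hj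
      · exact (Nat.div_le_self _ _).trans_lt (H .z)
      · dsimp; rw [hσ.bq, ← pow_succ]; exact hq _ hj
      · exact (Nat.sub_le _ _).trans_lt (H .x)
      · dsimp
        rw [sum_range_succ, pow_succ, pow_succ, Nat.div_div_eq_div_mul, Nat.sub_sub, hσ.bq])
  have h0 : 0 < 2 ^ l := by positivity
  have h1 : 1 < 2 ^ l := by have := le_two_pow_pow N hσ.pos; have := hσ.pos; omega
  refine Exec.mono (.step (by rfl) (fun _ => h0) (.step (by rfl) (fun _ => h1) (.step (by rfl)
    (fun H => H .nn) (.seq_of_eq loop ?_ (.last (by rfl) (fun _ => h0) ?_))))) ?_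
  · dsimp; rw [hσ.nn]; simp
  · dsimp; rw [Nat.sub_self]; rfl
  · omega

theorem dotProg_exec {l N : ℕ} {σ : Env} (hσ : RingReady l N σ) (hg : σ.g < cycMod N)
    (hacc : σ.acc + N < 2 ^ l) :
    Exec l dotProg σ (5 * N + 3)
      {σ with acc := σ.acc + cycDot N σ.ws σ.g, ws := σ.ws / 2 ^ N, g := 0, x := 0} := by
  have hfit := hσ.fits
  have hM := cycMod_pos hσ.pos
  have hMl : cycMod N < 2 ^ l := (Nat.sub_le _ _).trans_lt hfit
  have hsum : ∀ j ≤ N, σ.acc + ∑ c ∈ range j, σ.ws / 2 ^ c % 2 * rotCoeff N σ.g c < 2 ^ l := by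
    intro j hj
    have h1 : ∑ c ∈ range j, σ.ws / 2 ^ c % 2 * rotCoeff N σ.g c ≤ ∑ _c ∈ range j, 1 := by
      refine sum_le_sum fun c _ => ?_
      have h2 : σ.ws / 2 ^ c % 2 ≤ 1 := by omega
      have h3 : rotCoeff N σ.g c ≤ 1 := by rw [rotCoeff]; omega
      exact Nat.mul_le_mul h2 h3
    simp only [sum_const, card_range, smul_eq_mul, mul_one] at h1
    omega
  have loop := Exec.loop (l := l) (v := Var.x) (N := 4) (p := dotBody)
    (fun j => {σ with acc := σ.acc + ∑ c ∈ range j, σ.ws / 2 ^ c % 2 * rotCoeff N σ.g c,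
                      ws := σ.ws / 2 ^ j, g := σ.g * radix N ^ j % cycMod N, x := N - j}) N
    (fun j hj => Nat.sub_ne_zero_of_lt hj) (Nat.sub_self _) (fun j hj => by
      refine .step (by rfl) (fun _ => ?_) (.step (by rfl) (fun H => ?_) (.step (by rfl)
        (fun _ => ?_) (.last (by rfl) (fun H => ?_) ?_)))
      · dsimp; rw [add_assoc]
        change σ.acc + (_ + _ * rotCoeff N σ.g j) < _
        rw [← sum_range_succ]; exact hsum _ hj
      · exact (Nat.div_le_self _ _).trans_lt (H .ws)
      · dsimp; rw [hσ.md]; exact (Nat.mod_lt _ hM).trans hMl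
      · exact (Nat.sub_le _ _).trans_lt (H .x)
      · dsimp
        rw [sum_range_succ, pow_succ 2, Nat.div_div_eq_div_mul, Nat.sub_sub, hσ.bq, hσ.md,
          Nat.mod_mul_mod, pow_succ (radix N), mul_assoc σ.g, add_assoc]
        rfl)
  have h0 : 0 < 2 ^ l := by positivity
  refine Exec.mono (.step (by rfl) (fun H => H .nn) (.seq_of_eq loop ?_ (.last (by rfl)
    (fun _ => h0) ?_))) ?_
  · dsimp; rw [hσ.nn]; simp [Nat.mod_eq_of_lt hg]
  · dsimp; rw [Nat.sub_self]; rfl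
  · omega

theorem cycDot_le (N w y : ℕ) : cycDot N w y ≤ N := by
  have : cycDot N w y ≤ ∑ _c ∈ range N, 1 := by
    refine sum_le_sum fun c _ => ?_
    have h2 : w / 2 ^ c % 2 ≤ 1 := by omega
    have h3 : rotCoeff N y c ≤ 1 := by rw [rotCoeff]; omega
    exact Nat.mul_le_mul h2 h3
  simpa using this

theorem cycMul_lt {l N : ℕ} {σ : Env} (hσ : RingReady l N σ) (y y' : ℕ) :
    cycMul N y y' < 2 ^ l :=
  Nat.and_le_right.trans_lt ((digitMask_lt hσ.pos).trans hσ.fits)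

theorem polyStep_exec {l N : ℕ} {σ : Env} (hσ : RingReady l N σ) (hk : σ.kk * N + N < 2 ^ l) :
    Exec l polyStep σ (σ.kk * (5 * N + 7) + 5 * N + 14)
      {σ with acc := polyBit N σ.kk σ.i σ.ws, ws := σ.ws / 2 ^ (N * σ.kk), z := 0, q := 0, x := 0,
              g := 0, cj := 0, al := 0, pw := 0} := by
  have h0 : 0 < 2 ^ l := by positivity
  have h1 : 1 < 2 ^ l := by have := le_two_pow_pow N hσ.pos; have := hσ.pos; have := hσ.fits; omega
  have hsp := isElt_spread (N := N) σ.i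
  have hpw := fun j => isElt_cycPow hσ.pos hsp j
  have hsum : ∀ j ≤ σ.kk, polyBit N j σ.i σ.ws + N < 2 ^ l := by
    intro j hj
    have h2 : polyBit N j σ.i σ.ws ≤ ∑ _c ∈ range j, N := sum_le_sum fun c _ => cycDot_le _ _ _
    simp only [sum_const, card_range, smul_eq_mul] at h2
    have := Nat.mul_le_mul_right N hj
    omega
  have loop := Exec.loop (l := l) (v := Var.cj) (N := 1 + ((5 * N + 3) + 2)) (p := polyBody)
    (fun j => {σ with acc := polyBit N j σ.i σ.ws, ws := σ.ws / 2 ^ (N * j), z := 0, q := 0, x := 0,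
                      g := 0, cj := σ.kk - j, al := spread N σ.i,
                      pw := cycPow N (spread N σ.i) j}) σ.kk
    (fun j hj => Nat.sub_ne_zero_of_lt hj) (Nat.sub_self _) (fun j hj => by
      refine .step (by rfl) (fun H => H .pw) (.seq (dotProg_exec (N := N) ?_ ?_ ?_)
        (.step (by rfl) (fun _ => ?_) (.last (by rfl) (fun H => ?_) ?_)))
      · exact ⟨hσ.pos, hσ.nn, hσ.bq, hσ.md, hσ.ms, hσ.fits⟩
      · exact (hpw j).lt_cycMod hσ.pos
      · exact hsum j hj.le
      · dsimp; rw [hσ.md, hσ.ms]; exact cycMul_lt hσ _ _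
      · exact (Nat.sub_le _ _).trans_lt (H .cj)
      · dsimp
        rw [hσ.md, hσ.ms, polyBit, polyBit, sum_range_succ, Nat.sub_sub, Nat.mul_succ, pow_add,
          Nat.div_div_eq_div_mul]
        rfl)
  refine Exec.mono (.step (by rfl) (fun H => H .i) (.seq (spreadProg_exec (N := N) ?_)
    (.step (by rfl)
    (fun _ => h0) (.step (by rfl) (fun _ => h0) (.step (by rfl) (fun _ => h0) (.step (by rfl)
    (fun _ => h1) (.step (by rfl) (fun H => H .kk) (.seq_of_eq loop ?_ (.step (by rfl)
    (fun _ => h0) (.last (by rfl) (fun _ => h0) ?_)))))))))) ?_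
  · exact ⟨hσ.pos, hσ.nn, hσ.bq, hσ.md, hσ.ms, hσ.fits⟩
  · dsimp; simp [polyBit, cycPow]
  · dsimp; rw [Nat.sub_self]
  · ring_nf; omega

theorem biasTail_exec {l N α j : ℕ} {σ τ : Env} (hσ : RingReady l N σ)
    (hpw : σ.pw = cycPow N α j) (hal : σ.al = α) (hce : σ.ce = j) (hj : j + 1 < 2 ^ l)
    (hτ : {σ with pw := cycPow N α (j + 1), ce := j + 1, cj := σ.cj - 1, h := 0} = τ) :
    Exec l biasTail σ 4 τ := by
  refine .step (by rfl) (fun _ => Nat.two_pow_pos l) (.step (by rfl) (fun _ => ?_) (.step (by rfl)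
    (fun _ => ?_) (.last (by rfl) (fun H => (Nat.sub_le _ _).trans_lt (H .cj)) ?_)))
  · dsimp; rw [hσ.md, hσ.ms]; exact cycMul_lt hσ _ _
  · dsimp; rw [hce]; exact hj
  · rw [← hτ]; dsimp; rw [hpw, hal, hce, hσ.md, hσ.ms]; rfl

theorem biasBody_exec {l N α j : ℕ} {σ τ : Env} (hσ : RingReady l N σ) (hα : IsElt N α)
    (hg : σ.g = markSum N σ.rr σ.i α j) (hpw : σ.pw = cycPow N α j) (hal : σ.al = α)
    (hce : σ.ce = j) (hj : j + 1 < 2 ^ l)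
    (hτ : {σ with g := markSum N σ.rr σ.i α (j + 1), pw := cycPow N α (j + 1), ce := j + 1,
                  cj := σ.cj - 1, h := 0} = τ) :
    Exec l biasBody σ 7 τ := by
  subst hτ
  have hR := hσ.fits
  refine .step (N := 2 + 4) (by rfl) (fun H => ?_) ?_
  · exact Nat.xor_lt_two_pow ((Nat.mod_le _ _).trans_lt (H .ce)) ((Nat.mod_le _ _).trans_lt (H .i))
  by_cases hm : σ.ce % σ.rr = σ.i % (σ.ce / σ.rr)
  · have hm' : IsMark σ.rr σ.i j := hce ▸ hm
    refine .seq (.ifNz_neg (N := 1) ?_ (.last (by rfl) (fun _ => ?_) rfl)) (biasTail_exec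
      (N := N) (α := α) (j := j) ?_ hpw hal hce hj ?_)
    · dsimp; rw [hm, Nat.xor_self]
    · dsimp; rw [hg, hpw]
      exact ((isElt_markSum hσ.pos _ _ hα _).xor hσ.pos (isElt_cycPow hσ.pos hα _)).lt_radix_pow
        hσ.pos |>.trans hR
    · exact ⟨hσ.pos, hσ.nn, hσ.bq, hσ.md, hσ.ms, hσ.fits⟩
    · simp only [Env.set, Env.get, Expr.eval_xor, Expr.eval_var, markSum, if_pos hm', hg, hpw]
  · have hm' : ¬ IsMark σ.rr σ.i j := fun h => hm (hce.symm ▸ h)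
    refine .seq (.ifNz_pos (N := 1) ?_ .skipProg) (biasTail_exec
      (N := N) (α := α) (j := j) ?_ hpw hal hce hj ?_)
    · exact fun h => hm (Nat.xor_eq_zero_iff.mp h)
    · exact ⟨hσ.pos, hσ.nn, hσ.bq, hσ.md, hσ.ms, hσ.fits⟩
    · simp only [Env.set, markSum, if_neg hm', hg]

/-- The values of the variables after `j` rounds of the loop in `biasStep`. -/
def biasEnv (N : ℕ) (σ : Env) (j : ℕ) : Env :=
  {σ with ws := σ.ws / 2 ^ N, z := 0, q := 0, x := 0, h := 0, ce := j,
          cj := σ.rr * (σ.rr + 1) - j, al := spread N σ.ws,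
          g := markSum N σ.rr σ.i (spread N σ.ws) j, pw := cycPow N (spread N σ.ws) j}

theorem biasLoop_exec {l N : ℕ} {σ : Env} (hσ : RingReady l N σ)
    (hr : σ.rr * (σ.rr + 1) < 2 ^ l) :
    Exec l (whileNz Var.cj biasBody) (biasEnv N σ 0) (σ.rr * (σ.rr + 1) * 8 + 1)
      (biasEnv N σ (σ.rr * (σ.rr + 1))) := by
  refine Exec.loop (biasEnv N σ) _ (fun j hj => Nat.sub_ne_zero_of_lt hj) (Nat.sub_self _)
    (fun j hj => ?_)
  refine biasBody_exec (N := N) (α := spread N σ.ws) (j := j) ?_ (isElt_spread _) rfl rfl rfl rfl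
    (lt_of_le_of_lt hj hr) ?_
  · exact ⟨hσ.pos, hσ.nn, hσ.bq, hσ.md, hσ.ms, hσ.fits⟩
  · simp only [biasEnv, Nat.sub_sub]

theorem biasStep_exec {l N R : ℕ} {σ : Env} (hσ : RingReady l N σ) (hR : σ.rr = R)
    (hr : R * (R + 1) < 2 ^ l) :
    Exec l biasStep σ (8 * (R * (R + 1)) + 10 * N + 21)
      {σ with acc := biasBit N R σ.i σ.ws, ws := σ.ws / 2 ^ (2 * N), z := 0, q := 0, x := 0,
              g := 0, cj := 0, al := 0, pw := 0, ce := 0, h := 0} := by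
  subst hR
  have h0 : 0 < 2 ^ l := by positivity
  have hN := le_two_pow_pow N hσ.pos
  have hfit := hσ.fits
  have h1 : 1 < 2 ^ l := by have := hσ.pos; omega
  have hsp := isElt_spread (N := N) σ.ws
  have hend : Exec l biasEnd (biasEnv N σ (σ.rr * (σ.rr + 1))) (1 + ((5 * N + 3) + 3))
      {σ with acc := biasBit N σ.rr σ.i σ.ws, ws := σ.ws / 2 ^ (2 * N), z := 0, q := 0, x := 0,
              g := 0, cj := 0, al := 0, pw := 0, ce := 0, h := 0} := by
    rw [biasEnv, Nat.sub_self]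
    generalize hM : σ.rr * (σ.rr + 1) = M
    refine .step (by rfl) (fun _ => h0) (.seq (dotProg_exec
      (N := N) ?_ ?_ ?_) (.step (by rfl) (fun _ => h0) (.step (by rfl) (fun _ => h0) (.last (by rfl)
      (fun _ => h0) ?_))))
    · exact ⟨hσ.pos, hσ.nn, hσ.bq, hσ.md, hσ.ms, hσ.fits⟩
    · exact (isElt_markSum hσ.pos _ _ hsp _).lt_cycMod hσ.pos
    · dsimp; omega
    · dsimp
      rw [Nat.div_div_eq_div_mul, ← pow_add, zero_add, two_mul, biasBit, hM]
  refine Exec.mono (.step (by rfl) (fun H => H .ws) (.seq (spreadProg_exec (N := N) ?_) (.step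
    (by rfl) (fun H => H .z) (.step (by rfl) (fun _ => h0) (.step (by rfl) (fun _ => h0) (.step
    (by rfl) (fun _ => h1) (.step (by rfl) (fun _ => h0) (.step (by rfl) (fun _ => h0) (.step
    (by rfl) (fun _ => ?_) (.seq_of_eq (biasLoop_exec hσ hr) ?_ hend)))))))))) ?_
  · exact ⟨hσ.pos, hσ.nn, hσ.bq, hσ.md, hσ.ms, hσ.fits⟩
  · dsimp; exact hr
  · dsimp; simp [biasEnv, markSum, cycPow]
  · ring_nf; omega

/-- The walk of a coordinate in integers: after `τ` steps of relative length `1 / pa`, with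
direction `-1` where `d` is odd, the position is `(u - v) / (u + v)` for the pair `(u, v)`. -/
def walkPair (pa : ℕ) (d : ℕ → ℕ) : ℕ → ℕ × ℕ
  | 0 => (1, 1)
  | τ + 1 =>
    let (u, v) := walkPair pa d τ
    let m := u - (u - v)
    if d τ % 2 = 0 then (pa * u + m, pa * v - m) else (pa * u - m, pa * v + m)

/-- The denominator of the position does not depend on the directions. -/
theorem walkPair_add {pa : ℕ} (hpa : 0 < pa) (d : ℕ → ℕ) (τ : ℕ) :
    (walkPair pa d τ).1 + (walkPair pa d τ).2 = 2 * pa ^ τ := by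
  induction τ with
  | zero => rfl
  | succ τ ih =>
    rw [walkPair, pow_succ, ← mul_assoc, ← ih]
    generalize walkPair pa d τ = y
    obtain ⟨u, v⟩ := y
    dsimp
    have h1 : u ≤ pa * u := Nat.le_mul_of_pos_left _ hpa
    have h2 : v ≤ pa * v := Nat.le_mul_of_pos_left _ hpa
    split_ifs <;> dsimp <;> rw [add_mul, mul_comm u, mul_comm v] <;> omega

/-- The output of the generator with step length `1 / pa`, `t` steps, and directions
`(-1) ^ bit i w`, where `w` runs through the chunks of the seed of length `s`. -/
def walkOut (pa t s : ℕ) (bit : ℕ → ℕ → ℕ) (w n : ℕ) : ℕ :=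
  ∑ i ∈ range n,
    if (walkPair pa (fun τ => bit i (w / 2 ^ (s * τ))) t).1 <
      (walkPair pa (fun τ => bit i (w / 2 ^ (s * τ))) t).2 then 2 ^ i else 0

theorem walkOut_lt (pa t s : ℕ) (bit : ℕ → ℕ → ℕ) (w n : ℕ) : walkOut pa t s bit w n < 2 ^ n := by
  induction n with
  | zero => simp [walkOut]
  | succ n ih =>
    rw [walkOut, sum_range_succ, ← walkOut, pow_succ]
    split_ifs <;> omega

/-- The program `step` computes the direction bit of the coordinate `i` from the seed `ws`, and
moves on in the seed. -/
def StepSpec (l : ℕ) (step : Prog) (σ : Env) (bit : ℕ → ℕ → ℕ) (s T : ℕ) : Prop :=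
  ∀ i w u v ct out pi ci,
    Exec l step {σ with i := i, ws := w, uu := u, vv := v, ct := ct, out := out, pi := pi, ci := ci}
      T {σ with i := i, ws := w / 2 ^ s, uu := u, vv := v, ct := ct, out := out, pi := pi, ci := ci,
                acc := bit i w}

section Walk

variable {l s T : ℕ} {step : Prog} {σ : Env} {bit : ℕ → ℕ → ℕ}

theorem walkBody_exec (hs : StepSpec l step σ bit s T) (hacc : σ.acc = 0) (hh : σ.h = 0)
    (hpa : 0 < σ.pa) (hl : 2 * σ.pa ^ σ.t < 2 ^ l) (d : ℕ → ℕ) (i w ct out pi ci τ : ℕ)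
    (hτ : τ < σ.t) (hd : d τ = bit i w) :
    Exec l (walkBody step)
      {σ with i := i, ws := w, uu := (walkPair σ.pa d τ).1, vv := (walkPair σ.pa d τ).2,
              ct := ct, out := out, pi := pi, ci := ci} (T + 8)
      {σ with i := i, ws := w / 2 ^ s, uu := (walkPair σ.pa d (τ + 1)).1,
              vv := (walkPair σ.pa d (τ + 1)).2, ct := ct - 1, out := out, pi := pi, ci := ci} := by
  have h0 : 0 < 2 ^ l := by positivity
  have hsum := walkPair_add hpa d (τ + 1)
  have hle : σ.pa ^ (τ + 1) ≤ σ.pa ^ σ.t := Nat.pow_le_pow_right hpa hτ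
  have h1 : (walkPair σ.pa d (τ + 1)).1 < 2 ^ l := by omega
  have h2 : (walkPair σ.pa d (τ + 1)).2 < 2 ^ l := by omega
  refine Exec.mono (.seq (hs _ _ _ _ _ _ _ _) (.step (by rfl) (fun H => (Nat.mod_le _ _).trans_lt
    (H .acc)) (.step (by rfl) (fun H => (Nat.sub_le _ _).trans_lt (H .uu)) (.seq (N := 3)
    (τ := {σ with i := i, ws := w / 2 ^ s, uu := (walkPair σ.pa d (τ + 1)).1,
                  vv := (walkPair σ.pa d (τ + 1)).2, ct := ct, out := out, pi := pi, ci := ci,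
                  acc := bit i w % 2, h := (walkPair σ.pa d τ).1 -
                    ((walkPair σ.pa d τ).1 - (walkPair σ.pa d τ).2)}) ?_ (.step (by rfl)
    (fun _ => h0) (.step (by rfl) (fun _ => h0) (.last (by rfl) (fun H =>
    (Nat.sub_le _ _).trans_lt (H .ct)) ?_))))))) (by omega)
  · by_cases hb : bit i w % 2 = 0
    · rw [walkPair, hd] at h1 h2 ⊢
      dsimp only at h1 h2 ⊢
      rw [if_pos hb] at h1 h2 ⊢
      exact .ifNz_neg (N := 2) hb (.step (by rfl) (fun _ => h1) (.last (by rfl) (fun _ => h2) rfl))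
    · rw [walkPair, hd] at h1 h2 ⊢
      dsimp only at h1 h2 ⊢
      rw [if_neg hb] at h1 h2 ⊢
      exact .ifNz_pos (N := 2) hb (.step (by rfl) (fun _ => h1) (.last (by rfl) (fun _ => h2) rfl))
  · dsimp; rw [hacc, hh]

theorem walkProg_exec (hs : StepSpec l step σ bit s T) (hacc : σ.acc = 0) (hh : σ.h = 0)
    (hpa : 0 < σ.pa) (hl : 2 * σ.pa ^ σ.t < 2 ^ l) (i w u v ct out pi ci : ℕ) :
    Exec l (walkProg step)
      {σ with i := i, ws := w, uu := u, vv := v, ct := ct, out := out, pi := pi, ci := ci}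
      (σ.t * (T + 9) + 5)
      {σ with i := i, ws := σ.seed / 2 ^ (s * σ.t),
              uu := (walkPair σ.pa (fun τ => bit i (σ.seed / 2 ^ (s * τ))) σ.t).1,
              vv := (walkPair σ.pa (fun τ => bit i (σ.seed / 2 ^ (s * τ))) σ.t).2,
              ct := 0, out := out, pi := pi, ci := ci} := by
  have h1 : 1 < 2 ^ l := by have := Nat.pow_pos (n := σ.t) hpa; omega
  have loop := Exec.loop (l := l) (v := Var.ct) (N := T + 8) (p := walkBody step)
    (fun j => {σ with i := i, ws := σ.seed / 2 ^ (s * j),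
                      uu := (walkPair σ.pa (fun τ => bit i (σ.seed / 2 ^ (s * τ))) j).1,
                      vv := (walkPair σ.pa (fun τ => bit i (σ.seed / 2 ^ (s * τ))) j).2,
                      ct := σ.t - j, out := out, pi := pi, ci := ci}) σ.t
    (fun j hj => Nat.sub_ne_zero_of_lt hj) (Nat.sub_self _) (fun j hj => by
      convert walkBody_exec hs hacc hh hpa hl (fun τ => bit i (σ.seed / 2 ^ (s * τ))) i
        (σ.seed / 2 ^ (s * j)) (σ.t - j) out pi ci j hj rfl using 1
      rw [Nat.div_div_eq_div_mul, ← pow_add, Nat.mul_succ, Nat.sub_sub])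
  rw [Nat.sub_self] at loop
  refine Exec.mono (.step (by rfl) (fun _ => h1) (.step (by rfl) (fun _ => h1) (.step (by rfl)
    (fun H => H .seed) (.step (by rfl) (fun H => H .t)
      (?_ : Exec _ _ _ (σ.t * (T + 8 + 1) + 1) _)))))
    (by ring_nf; omega)
  convert loop using 1
  simp [walkPair]

theorem rowBody_exec (hs : StepSpec l step σ bit s T) (hacc : σ.acc = 0) (hh : σ.h = 0)
    (huu : σ.uu = 0) (hvv : σ.vv = 0) (hws : σ.ws = 0) (hct : σ.ct = 0)
    (hpa : 0 < σ.pa) (hl : 2 * σ.pa ^ σ.t < 2 ^ l) {i n : ℕ} (hi : i < n) (hn : 2 ^ n < 2 ^ l)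
    (ci : ℕ) :
    Exec l (rowBody step)
      {σ with i := i, out := walkOut σ.pa σ.t s bit σ.seed i, pi := 2 ^ i, ci := ci}
      (σ.t * (T + 9) + 15)
      {σ with i := i + 1, out := walkOut σ.pa σ.t s bit σ.seed (i + 1), pi := 2 ^ (i + 1),
              ci := ci - 1} := by
  have h0 : 0 < 2 ^ l := by positivity
  have hi' : i + 1 < 2 ^ l := (hi.trans_le' le_rfl |> Nat.succ_le_of_lt).trans_lt
    (Nat.lt_two_pow_self.trans hn)
  have hpi : 2 ^ (i + 1) < 2 ^ l := (Nat.pow_le_pow_right (by norm_num) hi).trans_lt hn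
  have hout := (walkOut_lt σ.pa σ.t s bit σ.seed (i + 1)).trans hpi
  have hw := walkProg_exec hs hacc hh hpa hl i σ.ws σ.uu σ.vv σ.ct
    (walkOut σ.pa σ.t s bit σ.seed i) (2 ^ i) ci
  refine Exec.mono (.seq hw (.step (by rfl) (fun H => (Nat.sub_le _ _).trans_lt (H .vv))
    (.seq (N := 2) (τ := {σ with
      i := i, ws := σ.seed / 2 ^ (s * σ.t),
      uu := (walkPair σ.pa (fun τ => bit i (σ.seed / 2 ^ (s * τ))) σ.t).1,
      vv := (walkPair σ.pa (fun τ => bit i (σ.seed / 2 ^ (s * τ))) σ.t).2,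
      h := (walkPair σ.pa (fun τ => bit i (σ.seed / 2 ^ (s * τ))) σ.t).2 -
        (walkPair σ.pa (fun τ => bit i (σ.seed / 2 ^ (s * τ))) σ.t).1,
      ct := 0, out := walkOut σ.pa σ.t s bit σ.seed (i + 1), pi := 2 ^ i, ci := ci}) ?_ (.step
    (by rfl) (fun _ => h0) (.step (by rfl) (fun _ => h0) (.step (by rfl) (fun _ => h0) (.step
    (by rfl) (fun _ => h0) (.step (by rfl) (fun _ => hpi) (.step (by rfl) (fun _ => hi') (.last
    (by rfl) (fun H => (Nat.sub_le _ _).trans_lt (H .ci)) ?_)))))))))) (by omega)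
  · have key := sum_range_succ (fun i =>
      if (walkPair σ.pa (fun τ => bit i (σ.seed / 2 ^ (s * τ))) σ.t).1 <
        (walkPair σ.pa (fun τ => bit i (σ.seed / 2 ^ (s * τ))) σ.t).2 then 2 ^ i else 0) i
    change walkOut σ.pa σ.t s bit σ.seed (i + 1) = walkOut σ.pa σ.t s bit σ.seed i + _ at key
    by_cases hb : (walkPair σ.pa (fun τ => bit i (σ.seed / 2 ^ (s * τ))) σ.t).1 <
        (walkPair σ.pa (fun τ => bit i (σ.seed / 2 ^ (s * τ))) σ.t).2
    · rw [if_pos hb] at key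
      rw [key] at hout ⊢
      exact .ifNz_pos (N := 1) (Nat.sub_ne_zero_of_lt hb) (.last (by rfl) (fun _ => hout) rfl)
    · rw [if_neg hb] at key
      rw [key] at hout ⊢
      exact .ifNz_neg (N := 1) (Nat.sub_eq_zero_of_le (not_lt.mp hb)) .skipProg
  · dsimp; rw [hh, huu, hvv, hws, hct, pow_succ]

theorem rowsProg_exec (hs : StepSpec l step σ bit s T) (hacc : σ.acc = 0) (hh : σ.h = 0)
    (huu : σ.uu = 0) (hvv : σ.vv = 0) (hws : σ.ws = 0) (hct : σ.ct = 0)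
    (hpa : 0 < σ.pa) (hl : 2 * σ.pa ^ σ.t < 2 ^ l) (hn : 2 ^ σ.n < 2 ^ l) :
    Exec l (rowsProg step) σ (σ.n * (σ.t * (T + 9) + 16) + 5)
      {σ with i := σ.n, out := walkOut σ.pa σ.t s bit σ.seed σ.n, pi := 2 ^ σ.n, ci := 0} := by
  have h0 : 0 < 2 ^ l := by positivity
  have h1 : 1 < 2 ^ l := by have := Nat.pow_pos (n := σ.t) hpa; omega
  have loop := Exec.loop (l := l) (v := Var.ci) (N := σ.t * (T + 9) + 15) (p := rowBody step)
    (fun j => {σ with i := j, out := walkOut σ.pa σ.t s bit σ.seed j, pi := 2 ^ j, ci := σ.n - j})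
    σ.n (fun j hj => Nat.sub_ne_zero_of_lt hj) (Nat.sub_self _) (fun j hj => by
      convert rowBody_exec hs hacc hh huu hvv hws hct hpa hl hj hn (σ.n - j) using 1
      rw [Nat.sub_sub])
  rw [Nat.sub_self] at loop
  refine Exec.mono (.step (by rfl) (fun _ => h0) (.step (by rfl) (fun _ => h1) (.step (by rfl)
    (fun _ => h0) (.step (by rfl) (fun H => H .n)
    (?_ : Exec _ _ _ (σ.n * (σ.t * (T + 9) + 15 + 1) + 1) _))))) (by ring_nf; omega)
  convert loop using 1
  simp [walkOut]

end Walk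

/-! ### Programs for the parameters -/

theorem Env.set_set_self (σ : Env) (v : Var) (c d : ℕ) : (σ.set v c).set v d = σ.set v d := by
  cases v <;> rfl

theorem Env.set_x_comm (σ : Env) {v : Var} (h : v ≠ .x) (c d : ℕ) :
    (σ.set v c).set .x d = (σ.set .x d).set v c := by
  cases v <;> first | rfl | exact absurd rfl h

section Programs

open Var

/-- One round of `sizeProg`. -/
def sizeBody (v : Var) : Prog := x ::= x / 2 ;; v ::= (v : Expr) + 1

/-- Store the length of the value of `p` in `v`. -/
def sizeProg (v : Var) (p : Expr) : Prog := x ::= p ;; v ::= 0 ;; whileNz x (sizeBody v)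

/-- The lengths of the input. -/
def lengthProg : Prog :=
  kk ::= (k : Expr) - (k - (n + 1)) ;; sizeProg se e ;; sizeProg lg ((n : Expr) * e) ;;
    lg ::= lg + 2 ;; sizeProg sl lg ;; sizeProg sb b

/-- One round of `stepProg`. -/
def stepBody : Prog := pa ::= pa * 2 ;; x ::= x - 1

/-- The parameters of the walk. -/
def stepProg : Prog :=
  a ::= (6 + se + sl + (sb + 1) * kk) / (kk - 2) + 1 ;; pa ::= 1 ;; x ::= a ;;
    whileNz x stepBody ;; t ::= 16 * (pa * pa) * lg ;; sizeProg sn n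

/-- One round of `lenProg`. -/
def lenBody : Prog := nn ::= nn * 3 ;; x ::= 2 * mm - nn

/-- The dimension of the ring, the length of the seed, and whether this length exceeds `n`. -/
def lenProg : Prog :=
  nn ::= 1 ;; x ::= 2 * mm - nn ;; whileNz x lenBody ;; sg ::= t * (c0 * nn) ;; h ::= sg - n

/-- The sizes for the first generator. -/
def polySizes : Prog := mm ::= sn ;; c0 ::= kk

/-- The sizes for the second generator. -/
def biasSizes : Prog :=
  rr ::= 2 * (kk * sn) ;; sizeProg mm (rr * (rr + 1)) ;; mm ::= 6 + se + 2 * a + sl + mm ;; c0 ::= 2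

/-- One round of the first loop of `ringProg`. -/
def radixBody : Prog := bq ::= bq * 4 ;; x ::= x - 1

/-- One round of the second loop of `ringProg`. -/
def maskBody : Prog := ms ::= ms + md ;; md ::= md * bq ;; x ::= x - 1

/-- The numbers that describe the ring. -/
def ringProg : Prog :=
  bq ::= 1 ;; x ::= nn ;; whileNz x radixBody ;; ms ::= 0 ;; md ::= 1 ;; x ::= nn ;;
    whileNz x maskBody ;; md ::= md - 1

/-- The parameters. -/
def paramProg (sizes : Prog) : Prog := lengthProg ;; stepProg ;; sizes ;; lenProg

/-- The program that computes the length of the seed. -/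
def seedLenProg (sizes : Prog) : Prog := paramProg sizes ;; ifNz h skipProg (n ::= sg)

/-- The program that computes the output of the generator. -/
def genProg (sizes step : Prog) : Prog :=
  paramProg sizes ;; ifNz h (n ::= seed) (ringProg ;; rowsProg step ;; n ::= out)

end Programs

section Params

variable (n k B E : ℕ)

/-- The level that bounds the error of a step; beyond `n + 1` all levels vanish alike. -/
def effLevel : ℕ := min k (n + 1)

/-- An upper bound for `log (4 n E)`. -/
def walkLog : ℕ := (n * E).size + 2

/-- The steps of the walk have relative length `1 / 2 ^ stepExp`. With `K = effLevel n k`, the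
exponent is large enough that `64 E (walkLog n E) (2 B) ^ K ≤ 2 ^ (stepExp * (K - 2))`. -/
def stepExp : ℕ :=
  (6 + E.size + (walkLog n E).size + (B.size + 1) * effLevel n k) / (effLevel n k - 2) + 1

/-- The number of steps of the walk. With steps of length `p`, the potential of a coordinate falls
by the factor `1 - p ^ 2 / 16`, so that `16 / p ^ 2` steps are needed for each factor `exp 1`. -/
def walkLen : ℕ := 16 * (2 ^ stepExp n k B E * 2 ^ stepExp n k B E) * walkLog n E

/-- A bound for the moduli that define the marks of the second generator, and hence for the
remainders. -/
def markBound : ℕ := 2 * (effLevel n k * n.size)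

/-- The second generator needs a field with at least two to the power of this many elements, for a
bias of at most `1 / (64 E (walkLog n E) 4 ^ stepExp)`. -/
def biasDim : ℕ :=
  6 + E.size + 2 * stepExp n k B E + (walkLog n E).size +
    (markBound n k * (markBound n k + 1)).size

end Params

/-- The smallest power of three that is at least `2 * m`. -/
def ringDim (m : ℕ) : ℕ := 3 ^ Nat.clog 3 (2 * m)

section

variable {l : ℕ} {σ : Env}

theorem size_lt_two_pow {w : ℕ} (hw : w < 2 ^ l) : w.size < 2 ^ l :=
  (Nat.size_le.mpr hw).trans_lt Nat.lt_two_pow_self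

theorem sizeProg_exec {v : Var} {p : Expr} {τ : Env} (w : ℕ) (hv : v ≠ Var.x) (hp : p.ok = true)
    (hw : p.eval σ = w) (hl : w < 2 ^ l) (hτ : (σ.set Var.x 0).set v w.size = τ) :
    Exec l (sizeProg v p) σ (3 * w.size + 3) τ := by
  subst hτ
  have h0 : 0 < 2 ^ l := by positivity
  have hdiv : ∀ j, w / 2 ^ j = 0 ↔ w.size ≤ j := fun j => by
    rw [Nat.div_eq_zero_iff, Nat.size_le]
    simp
  have loop := Exec.loop (l := l) (v := Var.x) (N := 2) (p := sizeBody v)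
    (fun j => (σ.set Var.x (w / 2 ^ j)).set v j) w.size
    (fun j hj => by
      rw [Env.get_set_of_ne _ hv.symm, Env.get_set_self, Ne, hdiv]; omega)
    (by rw [Env.get_set_of_ne _ hv.symm, Env.get_set_self, hdiv])
    (fun j hj => by
      have hx : (Expr.eval ((σ.set Var.x (w / 2 ^ j)).set v j) ((Var.x : Expr) / 2)) =
          w / 2 ^ (j + 1) := by
        rw [Expr.eval_div, Expr.eval_var, Env.get_set_of_ne _ hv.symm, Env.get_set_self, pow_succ,
          ← Nat.div_div_eq_div_mul]
        rfl
      have hE : (((σ.set Var.x (w / 2 ^ j)).set v j).set Var.x (w / 2 ^ (j + 1))).get v = j := by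
        rw [Env.get_set_of_ne _ hv, Env.get_set_self]
      refine .step (by rfl) (fun _ => ?_) (.last (by rfl) (fun _ => ?_) ?_)
      · rw [hx]; exact (Nat.div_le_self _ _).trans_lt hl
      · rw [hx, Expr.eval_add, Expr.eval_var, hE]
        exact lt_of_le_of_lt hj (size_lt_two_pow hl)
      · rw [hx, Expr.eval_add, Expr.eval_var, hE, Env.set_x_comm _ hv, Env.set_set_self,
          Env.set_set_self]
        rfl)
  refine Exec.mono (.step hp (fun _ => by rwa [hw]) (.step (by rfl) (fun _ => h0)
    (?_ : Exec _ _ _ (w.size * (2 + 1) + 1) _))) (by omega)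
  convert loop using 1
  · rw [hw, pow_zero, Nat.div_one]; rfl
  · rw [(hdiv _).mpr le_rfl]

theorem lengthProg_exec (hn : (σ.n * σ.e).size + 2 < 2 ^ l) (hne : σ.n * σ.e < 2 ^ l) :
    Exec l lengthProg σ
      (3 * (σ.e.size + (σ.n * σ.e).size + (walkLog σ.n σ.e).size + σ.b.size) + 14)
      {σ with kk := effLevel σ.n σ.k, se := σ.e.size, lg := walkLog σ.n σ.e,
              sl := (walkLog σ.n σ.e).size, sb := σ.b.size, x := 0} := by
  intro hl hσ
  have h1 : Exec l (Var.kk ::= (Var.k : Expr) - (Var.k - (Var.n + 1))) σ 1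
      {σ with kk := effLevel σ.n σ.k} := by
    refine .last (by rfl) (fun H => (Nat.sub_le _ _).trans_lt (H .k)) ?_
    dsimp
    congr 1
    rw [effLevel]; omega
  have h2 : Exec l (sizeProg Var.se Var.e) {σ with kk := effLevel σ.n σ.k} _
      {σ with kk := effLevel σ.n σ.k, se := σ.e.size, x := 0} :=
    sizeProg_exec σ.e (by decide) (by rfl) rfl (hσ .e) rfl
  have h3 : Exec l (sizeProg Var.lg ((Var.n : Expr) * Var.e))
      {σ with kk := effLevel σ.n σ.k, se := σ.e.size, x := 0} _
      {σ with kk := effLevel σ.n σ.k, se := σ.e.size, lg := (σ.n * σ.e).size, x := 0} :=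
    sizeProg_exec (σ.n * σ.e) (by decide) (by rfl) rfl hne rfl
  have h4 : Exec l (Var.lg ::= (Var.lg : Expr) + 2)
      {σ with kk := effLevel σ.n σ.k, se := σ.e.size, lg := (σ.n * σ.e).size, x := 0} 1
      {σ with kk := effLevel σ.n σ.k, se := σ.e.size, lg := walkLog σ.n σ.e, x := 0} :=
    .last (by rfl) (fun _ => hn) rfl
  have h5 : Exec l (sizeProg Var.sl Var.lg)
      {σ with kk := effLevel σ.n σ.k, se := σ.e.size, lg := walkLog σ.n σ.e, x := 0} _
      {σ with kk := effLevel σ.n σ.k, se := σ.e.size, lg := walkLog σ.n σ.e,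
              sl := (walkLog σ.n σ.e).size, x := 0} :=
    sizeProg_exec (walkLog σ.n σ.e) (by decide) (by rfl) rfl hn rfl
  have h6 : Exec l (sizeProg Var.sb Var.b)
      {σ with kk := effLevel σ.n σ.k, se := σ.e.size, lg := walkLog σ.n σ.e,
              sl := (walkLog σ.n σ.e).size, x := 0} _
      {σ with kk := effLevel σ.n σ.k, se := σ.e.size, lg := walkLog σ.n σ.e,
              sl := (walkLog σ.n σ.e).size, sb := σ.b.size, x := 0} :=
    sizeProg_exec σ.b (by decide) (by rfl) rfl (hσ .b) rfl
  exact Exec.mono (h1.seq (h2.seq (h3.seq (h4.seq (h5.seq h6))))) (by omega) hl hσ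

theorem stepProg_exec {n k B E : ℕ} (hkk : σ.kk = effLevel n k) (hse : σ.se = E.size)
    (hlg : σ.lg = walkLog n E) (hsl : σ.sl = (walkLog n E).size) (hsb : σ.sb = B.size)
    (ha : stepExp n k B E < 2 ^ l) (ht : walkLen n k B E < 2 ^ l) :
    Exec l stepProg σ (3 * stepExp n k B E + 3 * σ.n.size + 8)
      {σ with a := stepExp n k B E, pa := 2 ^ stepExp n k B E, t := walkLen n k B E,
              sn := σ.n.size, x := 0} := by
  intro hl hσ
  have hlgpos : 1 ≤ walkLog n E := by rw [walkLog]; omega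
  have hpa : 2 ^ stepExp n k B E < 2 ^ l := by
    refine lt_of_le_of_lt ?_ ht
    rw [walkLen]
    have := Nat.one_le_two_pow (n := stepExp n k B E)
    nlinarith [Nat.mul_le_mul this this]
  have loop := Exec.loop (l := l) (v := Var.x) (N := 2) (p := stepBody)
    (fun j => {σ with a := stepExp n k B E, pa := 2 ^ j, x := stepExp n k B E - j})
    (stepExp n k B E) (fun j hj => Nat.sub_ne_zero_of_lt hj) (Nat.sub_self _) (fun j hj => by
      refine .step (by rfl) (fun _ => ?_) (.last (by rfl)
        (fun H => (Nat.sub_le _ _).trans_lt (H .x)) ?_)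
      · dsimp
        rw [← pow_succ]
        exact (Nat.pow_le_pow_right (by norm_num) hj).trans_lt hpa
      · dsimp; rw [pow_succ, Nat.sub_sub])
  have hea : (6 + σ.se + σ.sl + (σ.sb + 1) * σ.kk) / (σ.kk - 2) + 1 = stepExp n k B E := by
    rw [hkk, hse, hsl, hsb]; rfl
  refine Exec.mono (.step (by rfl) (fun _ => ?_) (.step (by rfl) (fun _ => ?_) (.step (by rfl)
    (fun H => H .a) (.seq_of_eq loop ?_ (.step (by rfl) (fun _ => ?_)
    (?_ : Exec _ _ _ (3 * σ.n.size + 3) _)))))) (by omega) hl hσ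
  · exact hea.trans_lt ha
  · exact lt_of_le_of_lt (Nat.one_le_two_pow (n := stepExp n k B E)) hpa
  · dsimp; rw [hea]
  · dsimp; rw [hlg]; exact ht
  · refine sizeProg_exec σ.n (by decide) (by rfl) rfl (hσ .n) ?_
    dsimp; rw [hlg, walkLen]

theorem ringDim_lt {m : ℕ} (hm : 0 < m) : ringDim m < 6 * m := by
  have h1 := Nat.pow_pred_clog_lt_self (b := 3) (by norm_num) (x := 2 * m) (by omega)
  have h2 : 0 < Nat.clog 3 (2 * m) := Nat.clog_pos (by norm_num) (by omega)
  obtain ⟨c, hc⟩ := Nat.exists_eq_succ_of_ne_zero h2.ne'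
  rw [hc, Nat.pred_succ] at h1
  rw [ringDim, hc, pow_succ]
  omega

theorem le_ringDim (m : ℕ) : 2 * m ≤ ringDim m := Nat.le_pow_clog (by norm_num) _

theorem lenProg_exec (hm : 0 < σ.mm) (hmm : 6 * σ.mm < 2 ^ l)
    (hs : σ.t * (σ.c0 * ringDim σ.mm) < 2 ^ l) :
    Exec l lenProg σ (6 * σ.mm + 5)
      {σ with nn := ringDim σ.mm, sg := σ.t * (σ.c0 * ringDim σ.mm),
              h := σ.t * (σ.c0 * ringDim σ.mm) - σ.n, x := 0} := by
  have hr := ringDim_lt hm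
  have loop := Exec.loop (l := l) (v := Var.x) (N := 2) (p := lenBody)
    (fun j => {σ with nn := 3 ^ j, x := 2 * σ.mm - 3 ^ j}) (Nat.clog 3 (2 * σ.mm))
    (fun j hj => Nat.sub_ne_zero_of_lt ((Nat.lt_clog_iff_pow_lt (by norm_num)).mp hj))
    (Nat.sub_eq_zero_of_le (le_ringDim _)) (fun j hj => by
      refine .step (by rfl) (fun _ => ?_) (.last (by rfl) (fun _ => ?_) ?_)
      · dsimp
        rw [← pow_succ]
        exact ((Nat.pow_le_pow_right (by norm_num) hj).trans hr.le).trans_lt hmm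
      · dsimp; omega
      · dsimp; rw [pow_succ])
  have hcl : Nat.clog 3 (2 * σ.mm) ≤ 2 * σ.mm :=
    (Nat.clog_le_iff_le_pow (by norm_num)).mpr (Nat.lt_pow_self (by norm_num)).le
  refine Exec.mono (.step (by rfl) (fun _ => ?_) (.step (by rfl) (fun _ => ?_) (.seq_of_eq loop rfl
    (.step (by rfl) (fun _ => hs) (.last (by rfl) (fun _ => (Nat.sub_le _ _).trans_lt hs) ?_)))))
    (by omega)
  · dsimp; omega
  · dsimp; omega
  · have h1 := le_ringDim σ.mm
    have h2 : 2 * σ.mm - 3 ^ Nat.clog 3 (2 * σ.mm) = 0 := Nat.sub_eq_zero_of_le h1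
    dsimp
    rw [h2, ringDim]

theorem polySizes_exec : Exec l polySizes σ 2 {σ with mm := σ.sn, c0 := σ.kk} :=
  .step (by rfl) (fun H => H .sn) (.last (by rfl) (fun H => H .kk) rfl)

theorem biasSizes_exec {n k B E : ℕ} (hkk : σ.kk = effLevel n k) (hse : σ.se = E.size)
    (hsl : σ.sl = (walkLog n E).size) (ha : σ.a = stepExp n k B E) (hsn : σ.sn = n.size)
    (hr : markBound n k < 2 ^ l) (hrr : markBound n k * (markBound n k + 1) < 2 ^ l)
    (hm : biasDim n k B E < 2 ^ l) (hl : 2 < 2 ^ l) :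
    Exec l biasSizes σ (3 * biasDim n k B E + 6)
      {σ with rr := markBound n k, mm := biasDim n k B E, c0 := 2, x := 0} := by
  have h1 : 2 * (σ.kk * σ.sn) = markBound n k := by rw [hkk, hsn, markBound]
  refine Exec.mono (.step (by rfl) (fun _ => ?_) (.seq (sizeProg_exec
    (markBound n k * (markBound n k + 1)) (by decide) (by rfl) ?_ hrr rfl) (.step (by rfl)
    (fun _ => ?_) (.last (by rfl) (fun _ => hl) ?_)))) ?_
  · dsimp; rw [h1]; exact hr
  · dsimp; rw [h1]
  · dsimp; rw [hse, ha, hsl]; exact hm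
  · dsimp; rw [h1, hse, ha, hsl, biasDim]
  · rw [biasDim]; omega

theorem ringProg_exec {N : ℕ} (hnn : σ.nn = N) (hN : 0 < N) (hfit : radix N ^ N < 2 ^ l) :
    Exec l ringProg σ (7 * N + 8)
      {σ with bq := radix N, md := cycMod N, ms := digitMask N, x := 0} := by
  have h0 : 0 < 2 ^ l := by positivity
  have h2 := two_lt_radix hN
  have h1 : 1 < 2 ^ l := by have := le_two_pow_pow N hN; omega
  have hbq : ∀ j ≤ N, 4 ^ j < 2 ^ l := fun j hj =>
    ((Nat.pow_le_pow_right (by norm_num) hj).trans (Nat.le_self_pow hN.ne' _)).trans_lt hfit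
  have hmd : ∀ j ≤ N, radix N ^ j < 2 ^ l := fun j hj =>
    (Nat.pow_le_pow_right (by omega) hj).trans_lt hfit
  have hms : ∀ j ≤ N, ∑ c ∈ range j, radix N ^ c < 2 ^ l := fun j hj => by
    have := sum_digits_lt (b := radix N) (fun _ => 1) (fun _ => by omega) j
    simp only [one_mul] at this
    exact this.trans (hmd j hj)
  have loop := Exec.loop (l := l) (v := Var.x) (N := 2) (p := radixBody)
    (fun j => {σ with bq := 4 ^ j, x := N - j}) N
    (fun j hj => Nat.sub_ne_zero_of_lt hj) (Nat.sub_self _) (fun j hj => by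
      refine .step (by rfl) (fun _ => ?_) (.last (by rfl)
        (fun H => (Nat.sub_le _ _).trans_lt (H .x)) ?_)
      · dsimp; rw [← pow_succ]; exact hbq _ hj
      · dsimp; rw [pow_succ, Nat.sub_sub])
  have loop' := Exec.loop (l := l) (v := Var.x) (N := 3) (p := maskBody)
    (fun j => {σ with bq := radix N, ms := ∑ c ∈ range j, radix N ^ c, md := radix N ^ j,
                      x := N - j}) N
    (fun j hj => Nat.sub_ne_zero_of_lt hj) (Nat.sub_self _) (fun j hj => by
      refine .step (by rfl) (fun _ => ?_) (.step (by rfl) (fun _ => ?_) (.last (by rfl)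
        (fun H => (Nat.sub_le _ _).trans_lt (H .x)) ?_))
      · dsimp; rw [← sum_range_succ]; exact hms _ hj
      · dsimp; rw [← pow_succ]; exact hmd _ hj
      · dsimp; rw [pow_succ, Nat.sub_sub, sum_range_succ])
  refine Exec.mono (.step (by rfl) (fun _ => h1) (.step (by rfl) (fun H => H .nn) (.seq_of_eq loop
    ?_ (.step (by rfl) (fun _ => h0) (.step (by rfl) (fun _ => h1) (.step (by rfl) (fun H => H .nn)
    (.seq_of_eq loop' ?_ (.last (by rfl) (fun H => (Nat.sub_le _ _).trans_lt (H .md)) ?_))))))))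
    (by omega)
  · dsimp; rw [hnn]
  · dsimp; rw [hnn]; simp [radix]
  · dsimp; rw [Nat.sub_self]; rfl

end

/-! ### Explicitness of the two generators -/

/-- The values of the variables at the start of a program. -/
def inEnv (n k B E w : ℕ) : Env :=
  ⟨n, k, B, E, w, 0, 0, 0, 0, 0, 0, 0, 0, 0, 0, 0, 0, 0, 0, 0, 0, 0, 0, 0, 0, 0, 0, 0, 0, 0, 0, 0,
    0, 0, 0, 0, 0, 0, 0, 0⟩

/-- The values of the variables before the sizes are computed. -/
def walkEnv (n k B E w : ℕ) : Env :=
  {inEnv n k B E w with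
    kk := effLevel n k, se := E.size, lg := walkLog n E, sl := (walkLog n E).size, sb := B.size,
    a := stepExp n k B E, pa := 2 ^ stepExp n k B E, t := walkLen n k B E, sn := n.size}

/-- A family of sources of direction bits. -/
structure Source where
  /-- the marks are encoded by numbers below `R * (R + 1)` -/
  R : ℕ → ℕ → ℕ → ℕ → ℕ
  /-- the dimension of the ring is at least twice this number -/
  M : ℕ → ℕ → ℕ → ℕ → ℕ
  /-- the number of ring elements in the seed -/
  C : ℕ → ℕ → ℕ → ℕ → ℕ
  /-- the bits computed from the dimension of the ring, the level, `R`, the coordinate and the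
  seed -/
  bit : ℕ → ℕ → ℕ → ℕ → ℕ → ℕ

namespace Source

variable (D : Source) (n k B E : ℕ)

/-- The dimension of the ring. -/
def dim : ℕ := ringDim (D.M n k B E)

/-- The number of random bits that one step of the walk takes. -/
def chunk : ℕ := D.C n k B E * D.dim n k B E

/-- The number of random bits that the walk takes. -/
def walkSeed : ℕ := walkLen n k B E * D.chunk n k B E

/-- The direction of a coordinate, computed from a chunk of the seed. -/
def dirBit (i w : ℕ) : ℕ := D.bit (D.dim n k B E) (effLevel n k) (D.R n k B E) i w

/-- The length of the seed. If the walk takes more than `n` bits, the seed is used as output. -/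
def seedLen (n k : ℕ) (b ε : ℝ) : ℕ :=
  if D.walkSeed n k ⌈b⌉₊ ⌈1 / ε⌉₊ ≤ n then D.walkSeed n k ⌈b⌉₊ ⌈1 / ε⌉₊ else n

/-- The generator. -/
def gen (n k : ℕ) (b ε : ℝ) (u : Cube (D.seedLen n k b ε)) : Cube n := fun i =>
  if D.walkSeed n k ⌈b⌉₊ ⌈1 / ε⌉₊ ≤ n then
    if (walkPair (2 ^ stepExp n k ⌈b⌉₊ ⌈1 / ε⌉₊) (fun τ => D.dirBit n k ⌈b⌉₊ ⌈1 / ε⌉₊ i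
          (signCode u / 2 ^ (D.chunk n k ⌈b⌉₊ ⌈1 / ε⌉₊ * τ))) (walkLen n k ⌈b⌉₊ ⌈1 / ε⌉₊)).1 <
        (walkPair (2 ^ stepExp n k ⌈b⌉₊ ⌈1 / ε⌉₊) (fun τ => D.dirBit n k ⌈b⌉₊ ⌈1 / ε⌉₊ i
          (signCode u / 2 ^ (D.chunk n k ⌈b⌉₊ ⌈1 / ε⌉₊ * τ))) (walkLen n k ⌈b⌉₊ ⌈1 / ε⌉₊)).2
      then -1 else 1
  else if h : (i : ℕ) < D.seedLen n k b ε then u ⟨i, h⟩ else 1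

/-- The values of the variables once all parameters are known. -/
def paramEnv (w : ℕ) : Env :=
  {walkEnv n k B E w with
    rr := D.R n k B E, mm := D.M n k B E, c0 := D.C n k B E, nn := D.dim n k B E,
    sg := D.walkSeed n k B E, h := D.walkSeed n k B E - n}

/-- The values of the variables once the ring is known. -/
def ringEnv (w : ℕ) : Env :=
  {D.paramEnv n k B E w with
    bq := radix (D.dim n k B E), md := cycMod (D.dim n k B E), ms := digitMask (D.dim n k B E)}

end Source

/-- The input is in the range of interest, and `z` bounds its size. All sizes and running times are
estimated by powers of `z`; that `z` is at least six lets a further power absorb numerical factors.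
-/
structure InputBound (n k B E z : ℕ) : Prop where
  n_ge : 2 ≤ n
  k_gt : 2 < k
  six_le : 6 ≤ z
  n_lt : n < z
  k_le : k.size ≤ z
  B_le : B.size ≤ z
  E_le : E.size ≤ z

/-- The programs `sizes` and `step` compute the sizes and the direction bits of the source `D`. -/
structure Source.Computes (D : Source) (sizes step : Prog) : Prop where
  M_pos {n k B E z : ℕ} : InputBound n k B E z → 0 < D.M n k B E
  M_le {n k B E z : ℕ} : InputBound n k B E z → D.M n k B E ≤ z ^ 6
  C_pos {n k B E z : ℕ} : InputBound n k B E z → 0 < D.C n k B E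
  C_le {n k B E z : ℕ} : InputBound n k B E z → D.C n k B E ≤ z
  sizes_exec {n k B E z l w : ℕ} : InputBound n k B E z → z ^ 10 ≤ l →
    Exec l sizes (walkEnv n k B E w) (z ^ 8)
      {walkEnv n k B E w with rr := D.R n k B E, mm := D.M n k B E, c0 := D.C n k B E}
  step_spec {n k B E z l w : ℕ} : InputBound n k B E z → z ^ 10 ≤ l →
    D.walkSeed n k B E ≤ n →
    StepSpec l step (D.ringEnv n k B E w) (D.dirBit n k B E) (D.chunk n k B E) (z ^ 7)

theorem stepExp_le_add {n k B E : ℕ} (hn : 2 ≤ n) (hk : 2 < k) :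
    stepExp n k B E ≤ 7 + E.size + (walkLog n E).size + 3 * (B.size + 1) := by
  have h2 : 3 ≤ effLevel n k := by rw [effLevel]; omega
  obtain ⟨c, hc⟩ : ∃ c, effLevel n k = c + 3 := ⟨_, (Nat.sub_add_cancel h2).symm⟩
  rw [stepExp, hc]
  have h6 : (6 + E.size + (walkLog n E).size + (B.size + 1) * (c + 3)) / (c + 3 - 2) ≤
      6 + E.size + (walkLog n E).size + 3 * (B.size + 1) := by
    refine Nat.div_le_of_le_mul ?_
    rw [show c + 3 - 2 = c + 1 by omega]
    nlinarith [Nat.zero_le (c * (6 + E.size + (walkLog n E).size)), Nat.zero_le (c * B.size)]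
  omega

namespace InputBound

variable {n k B E z : ℕ}

theorem effLevel_ge (h : InputBound n k B E z) : 3 ≤ effLevel n k := by
  have := h.n_ge; have := h.k_gt
  rw [effLevel]; omega

theorem effLevel_le (h : InputBound n k B E z) : effLevel n k ≤ z :=
  (min_le_right _ _).trans h.n_lt

theorem size_mul_le (h : InputBound n k B E z) : (n * E).size ≤ 2 * z := by
  have h1 := RamOp.size_eval_le .mul n E
  simp only [RamOp.eval] at h1
  have h2 : n.size ≤ n := Nat.size_le.mpr Nat.lt_two_pow_self
  have h3 := h.n_lt
  have h4 := h.E_le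
  omega

theorem size_walkLog_le (h : InputBound n k B E z) : (walkLog n E).size ≤ 3 * z := by
  have h1 : (walkLog n E).size ≤ walkLog n E := Nat.size_le.mpr Nat.lt_two_pow_self
  have h2 := h.size_mul_le
  have h3 := h.six_le
  have h4 : walkLog n E = (n * E).size + 2 := rfl
  omega

theorem stepExp_le (h : InputBound n k B E z) : stepExp n k B E ≤ 9 * z := by
  have h1 := h.size_walkLog_le
  have h3 := h.six_le
  have h4 := h.E_le
  have h5 := h.B_le
  have h6 := stepExp_le_add (B := B) (E := E) h.n_ge h.k_gt
  omega

theorem walkLen_lt (h : InputBound n k B E z) : walkLen n k B E < 2 ^ (22 * z) := by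
  have h1 := h.stepExp_le
  have h2 : walkLog n E < 2 ^ (2 * z + 2) := by
    refine lt_of_le_of_lt ?_ (Nat.lt_two_pow_self (n := 2 * z + 2))
    have := h.size_mul_le
    rw [walkLog]; omega
  have h3 := h.six_le
  calc walkLen n k B E = 2 ^ (4 + stepExp n k B E + stepExp n k B E) * walkLog n E := by
        rw [walkLen, pow_add, pow_add]; ring
    _ < 2 ^ (4 + stepExp n k B E + stepExp n k B E) * 2 ^ (2 * z + 2) :=
        Nat.mul_lt_mul_of_pos_left h2 (by positivity)
    _ ≤ 2 ^ (22 * z) := by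
        rw [← pow_add]; exact Nat.pow_le_pow_right (by norm_num) (by omega)

theorem pow_mono (h : InputBound n k B E z) {i j : ℕ} (hij : i ≤ j) : z ^ i ≤ z ^ j :=
  Nat.pow_le_pow_right (by have := h.six_le; omega) hij

/-- A numerical factor of at most six is absorbed by one more power of `z`. -/
theorem mul_pow_le (h : InputBound n k B E z) (i j : ℕ) (hij : i < j) : 6 * z ^ i ≤ z ^ j := by
  refine le_trans ?_ (h.pow_mono hij)
  rw [pow_succ, mul_comm]; exact Nat.mul_le_mul_left _ h.six_le

theorem markBound_le (h : InputBound n k B E z) : markBound n k ≤ 2 * z ^ 2 := by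
  have h1 := h.effLevel_le
  have h2 : n.size ≤ n := Nat.size_le.mpr Nat.lt_two_pow_self
  have h3 := h.n_lt
  rw [markBound, sq]
  exact Nat.mul_le_mul_left _ (Nat.mul_le_mul h1 (by omega))

theorem markBound_mul_le (h : InputBound n k B E z) :
    markBound n k * (markBound n k + 1) ≤ z ^ 5 := by
  have h1 := h.markBound_le
  have h2 := h.mul_pow_le 4 5 (by norm_num)
  have h3 : 1 ≤ z ^ 2 := Nat.one_le_pow _ _ (by have := h.six_le; omega)
  calc markBound n k * (markBound n k + 1) ≤ 2 * z ^ 2 * (3 * z ^ 2) :=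
        Nat.mul_le_mul h1 (by omega)
    _ = 6 * z ^ 4 := by ring
    _ ≤ z ^ 5 := h2

theorem biasDim_le (h : InputBound n k B E z) : biasDim n k B E ≤ z ^ 6 := by
  have h1 := h.markBound_mul_le
  have h2 : (markBound n k * (markBound n k + 1)).size ≤ z ^ 5 :=
    (Nat.size_le.mpr Nat.lt_two_pow_self).trans h1
  have h3 := h.stepExp_le
  have h4 := h.size_walkLog_le
  have h5 := h.E_le
  have h6 := h.mul_pow_le 5 6 (by norm_num)
  have h7 := h.mul_pow_le 1 2 (by norm_num)
  have h8 := h.mul_pow_le 2 5 (by norm_num)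
  have h9 := h.six_le
  rw [biasDim]
  simp only [pow_one] at h7
  omega

theorem lt_two_pow (_ : InputBound n k B E z) {l v : ℕ} (hl : z ^ 10 ≤ l) (hv : v ≤ z ^ 10) :
    v < 2 ^ l :=
  (hv.trans hl).trans_lt Nat.lt_two_pow_self

end InputBound

section Explicit

variable {D : Source} {sizes step : Prog} {n k B E z l w : ℕ}

theorem paramProg_exec (hD : D.Computes sizes step) (h : InputBound n k B E z) (hl : z ^ 10 ≤ l) :
    Exec l (paramProg sizes) (inEnv n k B E w) (z ^ 9) (D.paramEnv n k B E w) := by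
  have hz := h.six_le
  have hlog := h.size_mul_le
  have hslog := h.size_walkLog_le
  have hexp := h.stepExp_le
  have p1 := h.mul_pow_le 1 2 (by norm_num)
  have p2 := h.mul_pow_le 2 3 (by norm_num)
  have p6 := h.mul_pow_le 6 7 (by norm_num)
  have p7 := h.mul_pow_le 7 8 (by norm_num)
  have p8 := h.mul_pow_le 8 9 (by norm_num)
  have q2 := h.mul_pow_le 2 7 (by norm_num)
  have q9 := h.mul_pow_le 9 10 (by norm_num)
  have q3 : z ^ 3 ≤ z ^ 7 := h.pow_mono (by norm_num)
  have q8 : z ^ 8 ≤ z ^ 10 := h.pow_mono (by norm_num)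
  have q10 : z ^ 9 ≤ z ^ 10 := h.pow_mono (by norm_num)
  simp only [pow_one] at p1
  have hM := hD.M_le h
  have hdim := ringDim_lt (hD.M_pos h)
  have hnsize : n.size ≤ n := Nat.size_le.mpr Nat.lt_two_pow_self
  have hnz := h.n_lt
  have hBz := h.B_le
  have hEz := h.E_le
  have hraw : D.walkSeed n k B E < 2 ^ l := by
    have h1 : D.chunk n k B E ≤ z ^ 8 := by
      rw [Source.chunk, Source.dim, pow_succ' z 7]
      exact Nat.mul_le_mul (hD.C_le h) (by omega)
    calc D.walkSeed n k B E ≤ 2 ^ (22 * z) * z ^ 8 := Nat.mul_le_mul h.walkLen_lt.le h1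
      _ < 2 ^ (22 * z) * 2 ^ (z ^ 8) :=
          Nat.mul_lt_mul_of_pos_left Nat.lt_two_pow_self (by positivity)
      _ ≤ 2 ^ l := by
          rw [← pow_add]; exact Nat.pow_le_pow_right (by norm_num) (by omega)
  have e1 := lengthProg_exec (l := l) (σ := inEnv n k B E w)
    (h.lt_two_pow hl (by dsimp [inEnv]; omega)) (by
      dsimp [inEnv]
      exact (Nat.size_le.mp le_rfl : n * E < 2 ^ (n * E).size).trans_le
        (Nat.pow_le_pow_right (by norm_num) (by omega)))
  have e2 := stepProg_exec (l := l) (n := n) (k := k) (B := B) (E := E)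
    (σ := {inEnv n k B E w with
      kk := effLevel n k, se := E.size, lg := walkLog n E, sl := (walkLog n E).size, sb := B.size,
      x := 0}) rfl rfl rfl rfl rfl (h.lt_two_pow hl (by omega))
    (h.walkLen_lt.trans_le (Nat.pow_le_pow_right (by norm_num) (by omega)))
  have e3 := hD.sizes_exec (w := w) h hl
  have e4 := lenProg_exec (l := l)
    (σ := {walkEnv n k B E w with rr := D.R n k B E, mm := D.M n k B E, c0 := D.C n k B E})
    (hD.M_pos h) (h.lt_two_pow hl (by dsimp; omega)) hraw
  refine Exec.mono (e1.seq (e2.seq (e3.seq e4))) ?_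
  dsimp [inEnv]
  omega

theorem seedLenProg_exec (hD : D.Computes sizes step) (h : InputBound n k B E z)
    (hl : z ^ 10 ≤ l) :
    ∃ τ : Env, Exec l (seedLenProg sizes) (inEnv n k B E w) (z ^ 12) τ ∧
      τ.n = if D.walkSeed n k B E ≤ n then D.walkSeed n k B E else n := by
  have p9 := h.mul_pow_le 9 10 (by norm_num)
  have q : z ^ 10 ≤ z ^ 12 := h.pow_mono (by norm_num)
  have hz : 1 ≤ z ^ 9 := Nat.one_le_pow _ _ (by have := h.six_le; omega)
  by_cases hs : D.walkSeed n k B E ≤ n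
  · refine ⟨_, Exec.mono (.seq (paramProg_exec hD h hl) (.ifNz_neg (N := 1) ?_ (.last (by rfl)
      (fun H => H .sg) rfl))) (by omega), ?_⟩
    · exact Nat.sub_eq_zero_of_le hs
    · rw [if_pos hs]; rfl
  · refine ⟨_, Exec.mono (.seq (paramProg_exec hD h hl) (.ifNz_pos (N := 1) ?_ .skipProg))
      (by omega), ?_⟩
    · exact Nat.sub_ne_zero_of_lt (not_le.mp hs)
    · rw [if_neg hs]; rfl

/-- If the walk takes at most `n` bits, then its parameters are at most `n`. -/
theorem Source.walk_bounds (D : Source) (hM : 0 < D.M n k B E) (hC : 0 < D.C n k B E)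
    (hs : D.walkSeed n k B E ≤ n) :
    0 < D.dim n k B E ∧ D.dim n k B E ≤ n ∧ walkLen n k B E ≤ n ∧ stepExp n k B E ≤ n := by
  have hdim : 0 < D.dim n k B E := by
    have := le_ringDim (D.M n k B E); rw [Source.dim]; omega
  have hlog : 1 ≤ walkLog n E := by rw [walkLog]; omega
  have hpow : 1 ≤ 2 ^ stepExp n k B E := Nat.one_le_two_pow
  have hchunk : D.dim n k B E ≤ D.chunk n k B E := Nat.le_mul_of_pos_left _ hC
  have hlen0 : 2 ^ stepExp n k B E ≤ walkLen n k B E := by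
    rw [walkLen]
    nlinarith [Nat.mul_le_mul hpow hpow, Nat.mul_le_mul (Nat.mul_le_mul hpow hpow) hlog]
  have hchunk' : D.chunk n k B E ≤ n :=
    (Nat.le_mul_of_pos_left _ (by omega : 0 < walkLen n k B E)).trans hs
  have hlen : walkLen n k B E ≤ n := (Nat.le_mul_of_pos_right _ (by omega)).trans hs
  exact ⟨hdim, hchunk.trans hchunk', hlen, (Nat.lt_two_pow_self.le.trans hlen0).trans hlen⟩

theorem InputBound.mul_lt (h : InputBound n k B E z) (hl : z ^ 10 ≤ l) {a b : ℕ} (ha : a ≤ n)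
    (hb : b ≤ n) : 1 + a * b + a * b < l := by
  have hnz := h.n_lt
  have h1 : a * b ≤ z ^ 2 := by rw [sq]; exact Nat.mul_le_mul (by omega) (by omega)
  have h2 := h.mul_pow_le 2 10 (by norm_num)
  have h4 : 6 ^ 2 ≤ z ^ 2 := Nat.pow_le_pow_left h.six_le 2
  omega

theorem InputBound.radix_pow_lt (h : InputBound n k B E z) (hl : z ^ 10 ≤ l) {N : ℕ}
    (hN : N ≤ n) : radix N ^ N < 2 ^ l := by
  rw [radix, ← pow_mul, show (4 : ℕ) = 2 ^ 2 by norm_num, ← pow_mul]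
  refine Nat.pow_lt_pow_right (by norm_num) ?_
  have := h.mul_lt hl hN hN
  omega

/-- The cost of a program with variables of at most `z ^ 10` bits. -/
theorem InputBound.time_le (h : InputBound n k B E z) : z ^ 12 * (100 * z ^ 10) ≤ z ^ 25 := by
  have : 6 ^ 3 ≤ z ^ 3 := Nat.pow_le_pow_left h.six_le 3
  calc z ^ 12 * (100 * z ^ 10) = 100 * z ^ 22 := by ring
    _ ≤ z ^ 3 * z ^ 22 := Nat.mul_le_mul_right _ (by omega)
    _ = z ^ 25 := by ring

theorem genProg_exec (hD : D.Computes sizes step) (h : InputBound n k B E z)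
    (hl : z ^ 10 ≤ l) :
    ∃ τ : Env, Exec l (genProg sizes step) (inEnv n k B E w) (z ^ 12) τ ∧
      τ.n = if D.walkSeed n k B E ≤ n then walkOut (2 ^ stepExp n k B E) (walkLen n k B E)
        (D.chunk n k B E) (D.dirBit n k B E) w n else w := by
  have p9 := h.mul_pow_le 9 10 (by norm_num)
  have p10 := h.mul_pow_le 10 11 (by norm_num)
  have p11 := h.mul_pow_le 11 12 (by norm_num)
  have hz : 1 ≤ z ^ 9 := Nat.one_le_pow _ _ (by have := h.six_le; omega)
  by_cases hs : D.walkSeed n k B E ≤ n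
  · have hnz := h.n_lt
    obtain ⟨hdim, hdimn, hlen, hexp⟩ := D.walk_bounds (hD.M_pos h) (hD.C_pos h) hs
    have hfit := h.radix_pow_lt hl hdimn
    have e1 := paramProg_exec (w := w) hD h hl
    have e2 := ringProg_exec (l := l) (σ := D.paramEnv n k B E w) rfl hdim hfit
    have e3 := rowsProg_exec (l := l) (σ := D.ringEnv n k B E w) (hD.step_spec h hl hs) rfl
      (Nat.sub_eq_zero_of_le hs) rfl rfl rfl rfl (Nat.two_pow_pos _) (by
        change 2 * (2 ^ stepExp n k B E) ^ walkLen n k B E < 2 ^ l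
        rw [← pow_mul, ← pow_succ']
        refine Nat.pow_lt_pow_right (by norm_num) ?_
        have := h.mul_lt hl hexp hlen
        omega) (Nat.pow_lt_pow_right (by norm_num) (by
          change n < l
          have := h.mul_lt hl (by omega : 1 ≤ n) le_rfl
          omega))
    have hcost : n * (walkLen n k B E * (z ^ 7 + 9) + 16) + 5 ≤ z ^ 10 := by
      have a1 : walkLen n k B E * (z ^ 7 + 9) ≤ z * (2 * z ^ 7) := by
        have a3 : 6 ^ 7 ≤ z ^ 7 := Nat.pow_le_pow_left h.six_le 7
        exact Nat.mul_le_mul (by omega) (by omega)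
      have a2 : n * (walkLen n k B E * (z ^ 7 + 9) + 16) ≤ z * (3 * z ^ 8) := by
        have a3 : 6 ^ 8 ≤ z ^ 8 := Nat.pow_le_pow_left h.six_le 8
        refine Nat.mul_le_mul (by omega) ?_
        have : z * (2 * z ^ 7) = 2 * z ^ 8 := by ring
        omega
      have a4 : z * (3 * z ^ 8) = 3 * z ^ 9 := by ring
      have a5 : 6 ^ 9 ≤ z ^ 9 := Nat.pow_le_pow_left h.six_le 9
      omega
    refine ⟨_, Exec.mono (.seq e1 (.ifNz_neg ?_ (.seq e2 (.seq e3 (.last (by rfl)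
      (fun H => H .out) rfl))))) ?_, ?_⟩
    · exact Nat.sub_eq_zero_of_le hs
    · have c1 : (D.ringEnv n k B E w).n = n := rfl
      have c2 : (D.ringEnv n k B E w).t = walkLen n k B E := rfl
      have c3 : D.dim n k B E ≤ z := by omega
      have c4 : z ≤ z ^ 9 := Nat.le_self_pow (by norm_num) _
      have c5 : (D.paramEnv n k B E w).nn = D.dim n k B E := rfl
      rw [c1, c2]
      omega
    · rw [if_pos hs]; rfl
  · refine ⟨_, Exec.mono (.seq (paramProg_exec hD h hl) (.ifNz_pos (N := 1) ?_ (.last (by rfl)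
      (fun H => H .seed) rfl))) (by omega), ?_⟩
    · exact Nat.sub_ne_zero_of_lt (not_le.mp hs)
    · rw [if_neg hs]; rfl

/-- The number written by the output is the one that the program computes. -/
theorem signCode_gen (D : Source) (n k : ℕ) (b ε : ℝ) (u : Cube (D.seedLen n k b ε)) :
    signCode (D.gen n k b ε u) =
      if D.walkSeed n k ⌈b⌉₊ ⌈1 / ε⌉₊ ≤ n then
        walkOut (2 ^ stepExp n k ⌈b⌉₊ ⌈1 / ε⌉₊) (walkLen n k ⌈b⌉₊ ⌈1 / ε⌉₊)
          (D.chunk n k ⌈b⌉₊ ⌈1 / ε⌉₊) (D.dirBit n k ⌈b⌉₊ ⌈1 / ε⌉₊) (signCode u) n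
      else signCode u := by
  split_ifs with h
  · rw [signCode, walkOut, sum_range]
    refine sum_congr rfl fun i _ => ?_
    simp only [Source.gen, if_pos h]
    split_ifs <;> first | rfl | simp_all
  · have hs : D.seedLen n k b ε = n := if_neg h
    have key : ∀ (s : ℕ) (hs : s = n) (u : Cube s),
        signCode (fun i : Fin n => if h : (i : ℕ) < s then u ⟨i, h⟩ else 1) = signCode u := by
      rintro s rfl u
      simp
    rw [← key _ hs u]
    congr 1
    funext i
    simp only [Source.gen, if_neg h]

/-- The generator is explicit: if the walk takes at most `n` bits, then all numbers in the
computation have polynomially many bits, and otherwise the walk is not computed at all. -/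
theorem isExplicit_gen (hD : D.Computes sizes step) : IsExplicit D.seedLen D.gen := by
  refine ⟨seedLenProg sizes, genProg sizes step, 25, fun n k b ε hn hk hb hε hε1 => ?_⟩
  set B := ⌈b⌉₊ with hB
  set E := ⌈1 / ε⌉₊ with hE
  have hBpos : 1 ≤ B := Nat.one_le_iff_ne_zero.mpr (Nat.ceil_pos.mpr (by linarith)).ne'
  have hEpos : 1 ≤ E := Nat.one_le_iff_ne_zero.mpr (Nat.ceil_pos.mpr (by positivity)).ne'
  set z := n + D.seedLen n k b ε + Nat.size k + Nat.size B + Nat.size E with hz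
  have hk2 : 2 ≤ k.size := (Nat.size_le_size hk.le : Nat.size 2 ≤ _)
  have hB1 : 1 ≤ B.size := Nat.size_pos.mpr hBpos
  have hE1 : 1 ≤ E.size := Nat.size_pos.mpr hEpos
  have h : InputBound n k B E z :=
    ⟨hn, hk, by omega, by omega, by omega, by omega, by omega⟩
  have hlen : D.seedLen n k b ε = if D.walkSeed n k B E ≤ n then D.walkSeed n k B E else n := rfl
  have hlen' : D.seedLen n k b ε ≤ n := by rw [hlen]; split_ifs with h' <;> omega
  have z10 : z ≤ z ^ 10 := Nat.le_self_pow (by norm_num) _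
  have hl7 : 7 ≤ z ^ 10 := by
    have := h.six_le
    calc 7 ≤ 6 ^ 10 := by norm_num
      _ ≤ z ^ 10 := Nat.pow_le_pow_left this 10
  have hbdd : ∀ w, w < 2 ^ n → (inEnv n k B E w).Bdd (z ^ 10) := by
    intro w hw v
    have two : ∀ {x m : ℕ}, x < 2 ^ m → m ≤ z → x < 2 ^ z ^ 10 := fun hx hm =>
      hx.trans_le (Nat.pow_le_pow_right (by norm_num) (hm.trans z10))
    cases v
    case n => exact two Nat.lt_two_pow_self h.n_lt.le
    case k => exact two (Nat.size_le.mp le_rfl) h.k_le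
    case b => exact two (Nat.size_le.mp le_rfl) h.B_le
    case e => exact two (Nat.size_le.mp le_rfl) h.E_le
    case seed => exact two hw h.n_lt.le
    all_goals exact Nat.two_pow_pos _
  have htime := h.time_le
  refine ⟨?_, fun u => ?_⟩
  · obtain ⟨τ, hexec, hτ⟩ := seedLenProg_exec (w := 0) hD h le_rfl
    obtain ⟨t, s', hr, hsim, ht, -⟩ := hexec hl7 (hbdd 0 (by positivity))
      (fun i => [n, k, B, E].getD i 0) (fun v => by cases v <;> rfl)
    exact ⟨t, s', ht.trans htime, hr, (hsim .n).trans (hτ.trans hlen.symm)⟩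
  · have hu : signCode u < 2 ^ n :=
      (signCode_lt u).trans_le (Nat.pow_le_pow_right (by norm_num) hlen')
    obtain ⟨τ, hexec, hτ⟩ := genProg_exec (w := signCode u) hD h le_rfl
    obtain ⟨t, s', hr, hsim, ht, -⟩ := hexec hl7 (hbdd _ hu)
      (fun i => [n, k, B, E, signCode u].getD i 0) (fun v => by cases v <;> rfl)
    refine ⟨t, s', ht.trans htime, hr, (hsim .n).trans (hτ.trans ?_)⟩
    rw [signCode_gen]

/-- The source of exactly `k - 1`-wise independent bits. -/
def polySource : Source where
  R := fun _ _ _ _ => 0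
  M := fun n _ _ _ => n.size
  C := fun n k _ _ => effLevel n k
  bit := fun N k _ i w => polyBit N k i w

/-- The source of bits that are nearly unbiased on small sets. -/
def biasSource : Source where
  R := fun n k _ _ => markBound n k
  M := biasDim
  C := fun _ _ _ _ => 2
  bit := fun N _ R i w => biasBit N R i w

theorem InputBound.polyBit_cost (h : InputBound n k B E z) {N K : ℕ} (hN : N ≤ n) (hK : K ≤ z) :
    K * (5 * N + 7) + 5 * N + 14 ≤ z ^ 7 := by
  have hnz := h.n_lt
  have h1 : K * (5 * N + 7) ≤ z * (7 * z) := Nat.mul_le_mul hK (by have := h.six_le; omega)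
  have h2 : z * (7 * z) = 7 * z ^ 2 := by ring
  have h3 := h.mul_pow_le 1 2 (by norm_num)
  have h4 := h.mul_pow_le 2 3 (by norm_num)
  have h5 := h.mul_pow_le 3 7 (by norm_num)
  have h6 := h.six_le
  simp only [pow_one] at h3
  omega

theorem InputBound.biasBit_cost (h : InputBound n k B E z) {N : ℕ} (hN : N ≤ n) :
    8 * (markBound n k * (markBound n k + 1)) + 10 * N + 21 ≤ z ^ 7 := by
  have hnz := h.n_lt
  have h1 := h.markBound_mul_le
  have h3 := h.mul_pow_le 1 5 (by norm_num)
  have h4 := h.mul_pow_le 5 6 (by norm_num)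
  have h5 := h.mul_pow_le 6 7 (by norm_num)
  have h6 := h.six_le
  simp only [pow_one] at h3
  omega

theorem Source.ringReady (D : Source) (hN : 0 < D.dim n k B E)
    (hl : radix (D.dim n k B E) ^ D.dim n k B E < 2 ^ l) :
    RingReady l (D.dim n k B E) (D.ringEnv n k B E w) :=
  ⟨hN, rfl, rfl, rfl, rfl, hl⟩

theorem polySource_computes : polySource.Computes polySizes polyStep where
  M_pos h := Nat.size_pos.mpr (by have := h.n_ge; omega)
  M_le {n k B E z} h := by
    have h1 : n.size ≤ n := Nat.size_le.mpr Nat.lt_two_pow_self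
    have h2 : z ≤ z ^ 6 := Nat.le_self_pow (by norm_num) _
    have h3 := h.n_lt
    change n.size ≤ _
    omega
  C_pos h := by have := h.effLevel_ge; change 0 < effLevel _ _; omega
  C_le h := h.effLevel_le
  sizes_exec {n k B E z l w} h hl := by
    refine polySizes_exec.mono ?_
    have : 6 ^ 8 ≤ z ^ 8 := Nat.pow_le_pow_left h.six_le 8
    omega
  step_spec {n k B E z l w} h hl hs i w' u v ct out pi ci := by
    obtain ⟨hdim, hdimn, -, -⟩ := polySource.walk_bounds
      (Nat.size_pos.mpr (by have := h.n_ge; omega : 0 < n))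
      (by have := h.effLevel_ge; change 0 < effLevel _ _; omega) hs
    have hkz := h.effLevel_le
    have e := polyStep_exec (l := l) (N := polySource.dim n k B E)
      (σ := {polySource.ringEnv n k B E w with
        i := i, ws := w', uu := u, vv := v, ct := ct, out := out, pi := pi, ci := ci})
      ⟨hdim, rfl, rfl, rfl, rfl, h.radix_pow_lt hl hdimn⟩ (h.lt_two_pow hl (by
        change effLevel n k * _ + _ ≤ _
        have h1 := h.n_lt
        have h2 : effLevel n k * polySource.dim n k B E ≤ z ^ 2 := by
          rw [sq]; exact Nat.mul_le_mul hkz (by omega)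
        have h3 := h.mul_pow_le 2 10 (by norm_num)
        have h4 := h.mul_pow_le 1 2 (by norm_num)
        simp only [pow_one] at h4
        omega))
    have hc : polySource.chunk n k B E = polySource.dim n k B E * effLevel n k := mul_comm _ _
    rw [hc]
    exact Exec.mono e (h.polyBit_cost hdimn hkz)

theorem biasSizes_exec_walkEnv (h : InputBound n k B E z) (hl : z ^ 10 ≤ l) :
    Exec l biasSizes (walkEnv n k B E w) (z ^ 8)
      {walkEnv n k B E w with rr := markBound n k, mm := biasDim n k B E, c0 := 2} := by
  have h1 := h.biasDim_le
  have h2 := h.markBound_mul_le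
  have h3 := h.markBound_le
  have h4 : z ^ 5 ≤ z ^ 10 := h.pow_mono (by norm_num)
  have h5 : z ^ 6 ≤ z ^ 10 := h.pow_mono (by norm_num)
  have h6 := h.mul_pow_le 2 10 (by norm_num)
  have h7 := h.mul_pow_le 6 8 (by norm_num)
  have h8 : 6 ^ 6 ≤ z ^ 6 := Nat.pow_le_pow_left h.six_le 6
  have h9 : markBound n k ≤ z ^ 10 := by omega
  have h10 : biasDim n k B E ≤ z ^ 10 := by omega
  have h11 : 2 ≤ z ^ 10 := by omega
  have h12 : 3 * biasDim n k B E + 6 ≤ z ^ 8 := by omega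
  have e := biasSizes_exec (n := n) (k := k) (B := B) (E := E) (l := l)
    (σ := walkEnv n k B E w) rfl rfl rfl rfl rfl
    (h.lt_two_pow hl h9) (h.lt_two_pow hl (h2.trans h4)) (h.lt_two_pow hl h10)
    (h.lt_two_pow hl h11)
  exact Exec.mono e h12

/-- The temporary variables of the direction programs are zero. -/
structure Env.Clean (σ : Env) : Prop where
  z : σ.z = 0
  q : σ.q = 0
  x : σ.x = 0
  g : σ.g = 0
  cj : σ.cj = 0
  al : σ.al = 0
  pw : σ.pw = 0
  ce : σ.ce = 0
  h : σ.h = 0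

theorem biasStep_stepSpec {N R : ℕ} {σ : Env} (hσ : RingReady l N σ) (hc : σ.Clean) (hR : σ.rr = R)
    (hr : R * (R + 1) < 2 ^ l) :
    StepSpec l biasStep σ (biasBit N R) (2 * N) (8 * (R * (R + 1)) + 10 * N + 21) := by
  intro i w' u v ct out pi ci
  have e := biasStep_exec (l := l) (N := N) (R := R)
    (σ := {σ with i := i, ws := w', uu := u, vv := v, ct := ct, out := out, pi := pi, ci := ci})
    ⟨hσ.pos, hσ.nn, hσ.bq, hσ.md, hσ.ms, hσ.fits⟩ hR hr
  convert e using 1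
  rw [hc.z, hc.q, hc.x, hc.g, hc.cj, hc.al, hc.pw, hc.ce, hc.h]

theorem Source.clean_ringEnv (D : Source) (hs : D.walkSeed n k B E ≤ n) :
    (D.ringEnv n k B E w).Clean :=
  ⟨rfl, rfl, rfl, rfl, rfl, rfl, rfl, rfl, Nat.sub_eq_zero_of_le hs⟩

theorem StepSpec.mono {bit : ℕ → ℕ → ℕ} {s T T' : ℕ} {σ : Env} (h : StepSpec l step σ bit s T)
    (hT : T ≤ T') : StepSpec l step σ bit s T' :=
  fun i w u v ct out pi ci => (h i w u v ct out pi ci).mono hT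

theorem Source.ringEnv_rr (D : Source) : (D.ringEnv n k B E w).rr = D.R n k B E := rfl

theorem biasSource_R : biasSource.R n k B E = markBound n k := rfl

theorem biasSource_chunk : biasSource.chunk n k B E = 2 * biasSource.dim n k B E := by
  rw [Source.chunk]
  exact congrArg (· * biasSource.dim n k B E) (rfl : biasSource.C n k B E = 2)

theorem biasSource_bit (N K R i w : ℕ) : biasSource.bit N K R i w = biasBit N R i w := rfl

theorem biasSource_dirBit :
    biasSource.dirBit n k B E = biasBit (biasSource.dim n k B E) (markBound n k) := by
  funext i w
  rw [Source.dirBit, biasSource_bit, biasSource_R]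

theorem biasStep_spec (h : InputBound n k B E z) (hl : z ^ 10 ≤ l)
    (hs : biasSource.walkSeed n k B E ≤ n) :
    StepSpec l biasStep (biasSource.ringEnv n k B E w) (biasSource.dirBit n k B E)
      (biasSource.chunk n k B E) (z ^ 7) := by
  have hM : 0 < biasDim n k B E := by rw [biasDim]; omega
  obtain ⟨hdim, hdimn, -, -⟩ := biasSource.walk_bounds hM Nat.two_pos hs
  have h4 : z ^ 5 ≤ z ^ 10 := h.pow_mono (by norm_num)
  have hr := h.lt_two_pow hl (h.markBound_mul_le.trans h4)
  rw [biasSource_chunk, biasSource_dirBit]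
  exact (biasStep_stepSpec (biasSource.ringReady hdim (h.radix_pow_lt hl hdimn))
    (biasSource.clean_ringEnv hs) (biasSource.ringEnv_rr.trans biasSource_R) hr).mono
    (h.biasBit_cost hdimn)

theorem biasSource_computes : biasSource.Computes biasSizes biasStep where
  M_pos _ := by change 0 < biasDim _ _ _ _; rw [biasDim]; omega
  M_le h := h.biasDim_le
  C_pos _ := Nat.two_pos
  C_le h := by change 2 ≤ _; have := h.six_le; omega
  sizes_exec h hl := biasSizes_exec_walkEnv h hl
  step_spec h hl hs := biasStep_spec h hl hs

end Explicit

/-! ### Correctness of the two generators -/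

/-- The integer walk computes the position of the polarizing walk. -/
theorem walkPos_eq_walkPair {n : ℕ} {Ω : Type*} (x : Ω → Fin n → ℝ) {pa : ℕ} (hpa : 0 < pa)
    (i : Fin n) (d : ℕ → ℕ) (t : ℕ) (ω : Fin t → Ω)
    (hd : ∀ τ : Fin t, x (ω τ) i = (-1) ^ d τ) :
    walkPos x (1 / pa) t ω i =
      (((walkPair pa d t).1 : ℝ) - (walkPair pa d t).2) / (2 * (pa : ℝ) ^ t) := by
  induction t with
  | zero => simp [walkPos, walkPair]
  | succ t ih =>
    have hpa' : (0 : ℝ) < pa := by exact_mod_cast hpa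
    have ih := ih (Fin.init ω) (fun τ => hd τ.castSucc)
    have hlast : x (ω (Fin.last t)) i = (-1) ^ d t := hd (Fin.last t)
    have hsum : ((walkPair pa d t).1 : ℝ) + (walkPair pa d t).2 = 2 * (pa : ℝ) ^ t := by
      exact_mod_cast walkPair_add hpa d t
    simp only [walkPos, walkStep]
    rw [ih, hlast, walkPair]
    generalize walkPair pa d t = y at hsum
    obtain ⟨u, v⟩ := y
    dsimp only at hsum ⊢
    have hS : (0 : ℝ) < 2 * (pa : ℝ) ^ t := by positivity
    have hm1 : ((u - (u - v) : ℕ) : ℝ) = min (u : ℝ) v := by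
      rw [← Nat.cast_min]; congr 1; omega
    have hmu : u - (u - v) ≤ pa * u := (Nat.sub_le _ _).trans (Nat.le_mul_of_pos_left _ hpa)
    have hmv : u - (u - v) ≤ pa * v :=
      (by omega : u - (u - v) ≤ v).trans (Nat.le_mul_of_pos_left _ hpa)
    have habs : 1 - |((u : ℝ) - v) / (2 * (pa : ℝ) ^ t)| =
        2 * min (u : ℝ) v / (2 * (pa : ℝ) ^ t) := by
      rw [abs_div, abs_of_pos hS, eq_div_iff hS.ne', sub_mul, div_mul_cancel₀ _ hS.ne', ← hsum]
      rcases le_total (u : ℝ) v with h | h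
      · rw [min_eq_left h, abs_of_nonpos (by linarith)]; ring
      · rw [min_eq_right h, abs_of_nonneg (by linarith)]; ring
    rw [habs]
    by_cases h : d t % 2 = 0
    · rw [if_pos h, (Nat.even_iff.mpr h).neg_one_pow]
      push_cast [Nat.cast_sub hmv]
      rw [hm1]
      field_simp
      ring
    · rw [if_neg h, (Nat.odd_iff.mpr (by omega)).neg_one_pow]
      push_cast [Nat.cast_sub hmu]
      rw [hm1]
      field_simp
      ring

/-- A seed as a sequence of chunks. -/
def chunkEquiv (t c : ℕ) : Cube (t * c) ≃ (Fin t → Cube c) :=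
  (finProdFinEquiv.arrowCongr (Equiv.refl ℤˣ)).symm.trans (Equiv.curry (Fin t) (Fin c) ℤˣ)

theorem signCode_chunkEquiv_bit {t c : ℕ} (u : Cube (t * c)) (τ : Fin t) {l : ℕ} (hl : l < c) :
    signCode (chunkEquiv t c u τ) / 2 ^ l % 2 = signCode u / 2 ^ (c * τ) / 2 ^ l % 2 := by
  have hlt : c * τ + l < t * c := by
    have h1 := Nat.mul_le_mul_left c (Nat.succ_le_of_lt τ.2)
    rw [Nat.mul_succ, mul_comm c t] at h1
    omega
  rw [signCode_bit, Nat.div_div_eq_div_mul, ← pow_add, signCode_bit, dif_pos hl, dif_pos hlt]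
  congr 1
  refine congrArg u (Fin.ext ?_)
  change l + c * τ = c * τ + l
  exact add_comm _ _

/-- The expectation over the seed is the expectation over independent directions. -/
theorem expect_walkPair {n t c pa : ℕ} (hpa : 0 < pa) (bit : ℕ → ℕ → ℕ)
    (hbit : ∀ i w w', (∀ l < c, w / 2 ^ l % 2 = w' / 2 ^ l % 2) → bit i w = bit i w')
    (f : BoolFn n) :
    𝔼 u : Cube (t * c), signVal (f fun i =>
        if (walkPair pa (fun τ => bit i (signCode u / 2 ^ (c * τ))) t).1 <
          (walkPair pa (fun τ => bit i (signCode u / 2 ^ (c * τ))) t).2 then -1 else 1) =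
      𝔼 ω : Fin t → Cube c, signVal (f fun i =>
        toSign (walkPos (fun a i => signVal ((-1) ^ bit i (signCode a))) (1 / pa) t ω i)) := by
  have hpa' : (0 : ℝ) < pa := by exact_mod_cast hpa
  refine Fintype.expect_equiv (chunkEquiv t c) _ _ fun u => ?_
  congr 2
  funext i
  rw [walkPos_eq_walkPair _ hpa i (fun τ => bit i (signCode u / 2 ^ (c * τ)))]
  · rw [toSign]
    refine if_congr ?_ rfl rfl
    rw [div_neg_iff]
    have : (0 : ℝ) < 2 * (pa : ℝ) ^ t := by positivity
    constructor
    · exact fun h => Or.inr ⟨by simpa using h, this⟩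
    · rintro (⟨-, h⟩ | ⟨h, -⟩)
      · linarith
      · simpa using h
  · intro τ
    rw [signVal_neg_one_pow, hbit _ _ _ fun l hl => signCode_chunkEquiv_bit u τ hl]

theorem cycDot_congr {N w w' : ℕ} (h : ∀ l < N, w / 2 ^ l % 2 = w' / 2 ^ l % 2) (g : ℕ) :
    cycDot N w g = cycDot N w' g :=
  sum_congr rfl fun l hl => by rw [h l (mem_range.mp hl)]

theorem spread_congr {N w w' : ℕ} (h : ∀ l < N, w / 2 ^ l % 2 = w' / 2 ^ l % 2) :
    spread N w = spread N w' := by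
  rw [spread, spread, enc, enc]
  exact sum_congr rfl fun l hl => by rw [h l (mem_range.mp hl)]

theorem polyBit_congr {N k i w w' : ℕ}
    (h : ∀ l < k * N, w / 2 ^ l % 2 = w' / 2 ^ l % 2) : polyBit N k i w = polyBit N k i w' := by
  refine sum_congr rfl fun j hj => cycDot_congr (fun l hl => ?_) _
  rw [Nat.div_div_eq_div_mul, Nat.div_div_eq_div_mul, ← pow_add]
  have h1 := Nat.mul_le_mul_left N (Nat.succ_le_of_lt (mem_range.mp hj))
  rw [Nat.mul_succ, mul_comm N k] at h1
  exact h _ (by omega)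

theorem biasBit_congr {N R i w w' : ℕ}
    (h : ∀ l < 2 * N, w / 2 ^ l % 2 = w' / 2 ^ l % 2) : biasBit N R i w = biasBit N R i w' := by
  rw [biasBit, biasBit, spread_congr (w := w) (w' := w') fun l hl => h l (by omega)]
  refine cycDot_congr (fun l hl => ?_) _
  rw [Nat.div_div_eq_div_mul, Nat.div_div_eq_div_mul, ← pow_add]
  exact h _ (by omega)

/-- If the walk is used, the output of the generator is the sign of the final position. -/
theorem expect_gen (D : Source) {n k : ℕ} {b ε : ℝ}
    (hbit : ∀ i w w', (∀ l < D.chunk n k ⌈b⌉₊ ⌈1 / ε⌉₊, w / 2 ^ l % 2 = w' / 2 ^ l % 2) →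
      D.dirBit n k ⌈b⌉₊ ⌈1 / ε⌉₊ i w = D.dirBit n k ⌈b⌉₊ ⌈1 / ε⌉₊ i w')
    (hs : D.walkSeed n k ⌈b⌉₊ ⌈1 / ε⌉₊ ≤ n) (f : BoolFn n) :
    𝔼 u, signVal (f (D.gen n k b ε u)) =
      𝔼 ω : Fin (walkLen n k ⌈b⌉₊ ⌈1 / ε⌉₊) → Cube (D.chunk n k ⌈b⌉₊ ⌈1 / ε⌉₊),
        signVal (f fun i => toSign (walkPos (fun a i => signVal ((fun (a : Cube _) (i : Fin n) =>
          (-1) ^ D.dirBit n k ⌈b⌉₊ ⌈1 / ε⌉₊ i (signCode a)) a i))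
            (1 / (2 ^ stepExp n k ⌈b⌉₊ ⌈1 / ε⌉₊ : ℕ)) _ ω i)) := by
  have hlen : D.seedLen n k b ε = walkLen n k ⌈b⌉₊ ⌈1 / ε⌉₊ * D.chunk n k ⌈b⌉₊ ⌈1 / ε⌉₊ := if_pos hs
  have key : ∀ (s : ℕ), s = walkLen n k ⌈b⌉₊ ⌈1 / ε⌉₊ * D.chunk n k ⌈b⌉₊ ⌈1 / ε⌉₊ →
      ∀ φ : ℕ → ℝ, 𝔼 u : Cube s, φ (signCode u) =
        𝔼 u : Cube (walkLen n k ⌈b⌉₊ ⌈1 / ε⌉₊ * D.chunk n k ⌈b⌉₊ ⌈1 / ε⌉₊), φ (signCode u) := by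
    rintro s rfl φ; rfl
  rw [← expect_walkPair (Nat.two_pow_pos _) _ hbit]
  rw [← key _ hlen (fun w => signVal (f fun i =>
        if (walkPair (2 ^ stepExp n k ⌈b⌉₊ ⌈1 / ε⌉₊) (fun τ => D.dirBit n k ⌈b⌉₊ ⌈1 / ε⌉₊ i
            (w / 2 ^ (D.chunk n k ⌈b⌉₊ ⌈1 / ε⌉₊ * τ))) (walkLen n k ⌈b⌉₊ ⌈1 / ε⌉₊)).1 <
          (walkPair (2 ^ stepExp n k ⌈b⌉₊ ⌈1 / ε⌉₊) (fun τ => D.dirBit n k ⌈b⌉₊ ⌈1 / ε⌉₊ i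
            (w / 2 ^ (D.chunk n k ⌈b⌉₊ ⌈1 / ε⌉₊ * τ))) (walkLen n k ⌈b⌉₊ ⌈1 / ε⌉₊)).2 then -1 else 1))]
  refine expect_congr rfl fun u _ => ?_
  congr 2
  funext i
  rw [Source.gen, if_pos hs]

/-- If the walk is not used, the output of the generator is uniform. -/
theorem expect_gen_of_lt (D : Source) {n k : ℕ} {b ε : ℝ}
    (hs : n < D.walkSeed n k ⌈b⌉₊ ⌈1 / ε⌉₊) (f : BoolFn n) :
    𝔼 u, signVal (f (D.gen n k b ε u)) = 𝔼 x, signVal (f x) := by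
  have hlen : D.seedLen n k b ε = n := if_neg (not_le.mpr hs)
  have key : ∀ (s : ℕ), s = n → 𝔼 u : Cube s,
      signVal (f fun i : Fin n => if h : (i : ℕ) < s then u ⟨i, h⟩ else 1) =
        𝔼 x, signVal (f x) := by
    rintro s rfl
    simp
  rw [← key _ hlen]
  refine expect_congr rfl fun u _ => ?_
  congr 2
  funext i
  rw [Source.gen, if_neg (not_le.mpr hs)]

theorem le_two_pow_size (n : ℕ) : n ≤ 2 ^ n.size := (Nat.lt_size_self n).le

section Params

variable {n k B E : ℕ}

/-- The steps are so short that the level `effLevel n k` contributes little. -/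
theorem le_two_pow_stepExp_mul (hn : 2 ≤ n) (hk : 2 < k) :
    64 * E * walkLog n E * (2 * B) ^ effLevel n k ≤
      2 ^ (stepExp n k B E * (effLevel n k - 2)) := by
  have hK : 3 ≤ effLevel n k := by rw [effLevel]; omega
  set K := effLevel n k with hKdef
  set A := 6 + E.size + (walkLog n E).size + (B.size + 1) * K with hA
  have h1 : A ≤ stepExp n k B E * (K - 2) := by
    rw [stepExp, ← hKdef, ← hA, mul_comm]
    exact (Nat.lt_mul_div_succ A (by omega)).le
  refine le_trans ?_ (Nat.pow_le_pow_right (by norm_num) h1)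
  rw [hA, pow_add, pow_add, pow_add, pow_mul]
  have h2 : (2 * B) ^ K ≤ (2 ^ (B.size + 1)) ^ K :=
    Nat.pow_le_pow_left (by rw [pow_succ']; exact Nat.mul_le_mul_left _ (le_two_pow_size B)) _
  exact Nat.mul_le_mul (Nat.mul_le_mul (Nat.mul_le_mul (by norm_num) (le_two_pow_size E))
    (le_two_pow_size _)) h2

theorem two_mul_le_two_pow_stepExp (hn : 2 ≤ n) (hk : 2 < k) : 2 * B ≤ 2 ^ stepExp n k B E := by
  have hK : 3 ≤ effLevel n k := by rw [effLevel]; omega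
  have h1 : B.size + 1 ≤ stepExp n k B E := by
    rw [stepExp]
    refine le_trans ?_ (Nat.le_succ _)
    rw [Nat.le_div_iff_mul_le (by omega)]
    have := Nat.mul_le_mul_left (B.size + 1) (Nat.sub_le (effLevel n k) 2)
    omega
  refine le_trans ?_ (Nat.pow_le_pow_right (by norm_num) h1)
  rw [pow_succ']
  exact Nat.mul_le_mul_left _ (le_two_pow_size B)

/-- The error that all steps of the walk together incur beyond the low levels. -/
theorem walkLen_mul_pow_le (hn : 2 ≤ n) (hk : 2 < k) (hE : 1 ≤ E) {b : ℝ} (hb0 : 1 ≤ b)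
    (hb : b ≤ B) :
    walkLen n k B E * (2 * (1 / (2 ^ stepExp n k B E : ℕ)) * b) ^ effLevel n k ≤ 1 / (4 * E) := by
  have hK : 3 ≤ effLevel n k := by rw [effLevel]; omega
  have h1 := le_two_pow_stepExp_mul (B := B) (E := E) hn hk
  have hlog : (0 : ℝ) < walkLog n E := by rw [walkLog]; positivity
  rw [walkLen]
  generalize effLevel n k = K at *
  generalize stepExp n k B E = a at *
  generalize walkLog n E = L at *
  obtain ⟨c, rfl⟩ : ∃ c, K = c + 2 := ⟨K - 2, by omega⟩
  have h2 : (64 : ℝ) * E * L * (2 * B) ^ (c + 2) ≤ ((2 : ℝ) ^ a) ^ c := by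
    rw [← pow_mul]; exact_mod_cast h1
  have hE' : (1 : ℝ) ≤ E := by exact_mod_cast hE
  have h3 : (2 * b) ^ (c + 2) ≤ (2 * (B : ℝ)) ^ (c + 2) := by gcongr
  push_cast
  have hq : (0 : ℝ) < 2 ^ a := by positivity
  generalize (2 : ℝ) ^ a = q at *
  rw [show 2 * (1 / q) * b = (2 * b) / q by ring, div_pow, mul_div_assoc',
    div_le_div_iff₀ (by positivity) (by positivity)]
  have h4 : 64 * E * L * (2 * b) ^ (c + 2) ≤ q ^ c :=
    (mul_le_mul_of_nonneg_left h3 (by positivity)).trans h2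
  calc 16 * (q * q) * L * (2 * b) ^ (c + 2) * (4 * E) =
        (64 * E * L * (2 * b) ^ (c + 2)) * q ^ 2 := by ring
    _ ≤ q ^ c * q ^ 2 := by gcongr
    _ = 1 * q ^ (c + 2) := by ring

/-- After the walk all coordinates are close to `1` or `-1`. -/
theorem polarize_le (hn : 2 ≤ n) (hE : 1 ≤ E) :
    2 * (n * (1 - (1 / (2 ^ stepExp n k B E : ℕ) : ℝ) ^ 2 / 16) ^ walkLen n k B E) ≤
      1 / (2 * (E : ℝ)) := by
  set q : ℝ := ((2 ^ stepExp n k B E : ℕ) : ℝ) with hq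
  have hq1 : 1 ≤ q := by rw [hq]; exact_mod_cast Nat.one_le_two_pow
  have hE' : (1 : ℝ) ≤ E := by exact_mod_cast hE
  have hn' : (2 : ℝ) ≤ n := by exact_mod_cast hn
  have hlen : (walkLen n k B E : ℝ) = 16 * (q * q) * walkLog n E := by
    rw [walkLen, hq]; push_cast; ring
  have h1 : (1 - (1 / q) ^ 2 / 16) ^ walkLen n k B E ≤ Real.exp (-(walkLog n E : ℝ)) := by
    have h2 : 1 - (1 / q) ^ 2 / 16 ≤ Real.exp (-((1 / q) ^ 2 / 16)) := by
      have := Real.add_one_le_exp (-((1 / q) ^ 2 / 16)); linarith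
    have h3 : 0 ≤ 1 - (1 / q) ^ 2 / 16 := by
      have : 1 / q ≤ 1 := by rw [div_le_one (by linarith)]; exact hq1
      have h4 : 0 ≤ 1 / q := by positivity
      nlinarith
    calc (1 - (1 / q) ^ 2 / 16) ^ walkLen n k B E ≤
        Real.exp (-((1 / q) ^ 2 / 16)) ^ walkLen n k B E := by gcongr
      _ = Real.exp (-(walkLog n E : ℝ)) := by
        rw [← Real.exp_nat_mul, hlen]
        congr 1
        field_simp
  have h5 : Real.exp (-(walkLog n E : ℝ)) ≤ 1 / (4 * (n * E)) := by
    rw [Real.exp_neg, ← one_div]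
    refine one_div_le_one_div_of_le (by positivity) ?_
    have h6 : (2 : ℝ) ^ walkLog n E ≤ Real.exp (walkLog n E) := by
      rw [← mul_one (walkLog n E : ℝ), Real.exp_nat_mul]
      have := Real.add_one_le_exp (1 : ℝ)
      gcongr
      linarith
    refine le_trans ?_ h6
    rw [walkLog, pow_add]
    have h7 : ((n * E : ℕ) : ℝ) ≤ 2 ^ (n * E).size := by exact_mod_cast le_two_pow_size (n * E)
    push_cast at h7
    linarith
  calc 2 * (n * (1 - (1 / q) ^ 2 / 16) ^ walkLen n k B E) ≤ 2 * (n * (1 / (4 * (n * E)))) := by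
        gcongr; exact h1.trans h5
    _ = 1 / (2 * (E : ℝ)) := by field_simp; norm_num

/-- The bias of the directions of the second generator is negligible even after all steps. -/
theorem walkLen_mul_bias_le (hE : 1 ≤ E) {d : ℕ} (hd : biasDim n k B E ≤ d) :
    ((markBound n k * (markBound n k + 1) : ℕ) : ℝ) / 2 ^ d ≤
      (1 / (2 ^ stepExp n k B E : ℕ) : ℝ) ^ 2 / (64 * E * walkLog n E) := by
  have hE' : (0 : ℝ) < E := by exact_mod_cast hE
  have hlog : (0 : ℝ) < walkLog n E := by rw [walkLog]; positivity
  have h1 : 64 * E * (2 ^ stepExp n k B E) ^ 2 * walkLog n E *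
      (markBound n k * (markBound n k + 1)) ≤ 2 ^ d := by
    refine le_trans ?_ (Nat.pow_le_pow_right (by norm_num) hd)
    rw [biasDim, pow_add, pow_add, pow_add, pow_add, ← pow_mul, mul_comm (stepExp n k B E)]
    exact Nat.mul_le_mul (Nat.mul_le_mul (Nat.mul_le_mul (Nat.mul_le_mul (by norm_num)
      (le_two_pow_size E)) le_rfl) (le_two_pow_size _)) (le_two_pow_size _)
  have h2 : (64 : ℝ) * E * (2 ^ stepExp n k B E) ^ 2 * walkLog n E *
      ((markBound n k * (markBound n k + 1) : ℕ) : ℝ) ≤ 2 ^ d := by exact_mod_cast h1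
  generalize ((markBound n k * (markBound n k + 1) : ℕ) : ℝ) = r at *
  rw [div_pow, one_pow, div_div, div_le_div_iff₀ (by positivity) (by positivity)]
  push_cast
  linarith

end Params

/-- The generator fools `F` if its directions have small bias on sets of size below the level. -/
theorem gen_isPRG (D : Source) {n k : ℕ} {b ε δ : ℝ} (hn : 2 ≤ n) (hk : 2 < k) (hb : 1 ≤ b)
    (hε : 0 < ε)
    (hbit : ∀ i w w', (∀ l < D.chunk n k ⌈b⌉₊ ⌈1 / ε⌉₊, w / 2 ^ l % 2 = w' / 2 ^ l % 2) →
      D.dirBit n k ⌈b⌉₊ ⌈1 / ε⌉₊ i w = D.dirBit n k ⌈b⌉₊ ⌈1 / ε⌉₊ i w')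
    (hδ0 : 0 ≤ δ)
    (hδ : δ ≤ (1 / (2 ^ stepExp n k ⌈b⌉₊ ⌈1 / ε⌉₊ : ℕ) : ℝ) ^ 2 /
      (64 * ⌈1 / ε⌉₊ * walkLog n ⌈1 / ε⌉₊))
    (hx : ∀ S : Finset (Fin n), 1 ≤ #S → #S < effLevel n k →
      |𝔼 ω : Cube (D.chunk n k ⌈b⌉₊ ⌈1 / ε⌉₊),
        ∏ i ∈ S, signVal ((-1) ^ D.dirBit n k ⌈b⌉₊ ⌈1 / ε⌉₊ i (signCode ω))| ≤ δ)
    {F : Set (BoolFn n)} (hF : ClosedUnderRestrictions F) (hM : classAbsFourierSum k F ≤ b ^ k)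
    (hL : δ = 0 ∨ ∀ i : ℕ, 1 ≤ i → i < k → classFourierMass i F ≤ b ^ i) :
    IsPRG (D.gen n k b ε) F ε := by
  intro f hf
  -- without the walk, the output is exactly uniform
  rcases lt_or_ge n (D.walkSeed n k ⌈b⌉₊ ⌈1 / ε⌉₊) with hs | hs
  · rw [expect_gen_of_lt D hs, sub_self, abs_zero]; exact hε.le
  rw [expect_gen D hbit hs]
  have hK : 3 ≤ effLevel n k := by rw [effLevel]; omega
  have hKk : effLevel n k ≤ k := min_le_left _ _
  have hE : 1 ≤ ⌈1 / ε⌉₊ := Nat.one_le_iff_ne_zero.mpr (Nat.ceil_pos.mpr (by positivity)).ne'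
  have hE' : (1 : ℝ) ≤ ⌈1 / ε⌉₊ := by exact_mod_cast hE
  have hEε : 1 / (⌈1 / ε⌉₊ : ℝ) ≤ ε := by
    rw [div_le_iff₀ (by linarith)]
    have := Nat.le_ceil (1 / ε)
    rw [div_le_iff₀ hε] at this
    linarith
  have hB : b ≤ ⌈b⌉₊ := Nat.le_ceil b
  have e1 := walkLen_mul_pow_le hn hk hE hb hB
  have e2 := polarize_le (k := k) (B := ⌈b⌉₊) hn hE
  have e3 : ((2 * ⌈b⌉₊ : ℕ) : ℝ) ≤ (2 ^ stepExp n k ⌈b⌉₊ ⌈1 / ε⌉₊ : ℕ) := by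
    exact_mod_cast two_mul_le_two_pow_stepExp hn hk
  have hlog : (1 : ℝ) ≤ walkLog n ⌈1 / ε⌉₊ := by
    rw [walkLog]; push_cast; linarith [Nat.cast_nonneg (α := ℝ) (n * ⌈1 / ε⌉₊).size]
  have hlen : (walkLen n k ⌈b⌉₊ ⌈1 / ε⌉₊ : ℝ) = 16 * ((2 ^ stepExp n k ⌈b⌉₊ ⌈1 / ε⌉₊ : ℕ) : ℝ) ^ 2 *
      walkLog n ⌈1 / ε⌉₊ := by
    rw [walkLen]; push_cast; ring
  -- at level `n + 1` the sums are empty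
  have hM' : classAbsFourierSum (effLevel n k) F ≤ b ^ effLevel n k := by
    rcases le_total k (n + 1) with h | h
    · rw [effLevel, min_eq_left h]; exact hM
    · rw [effLevel, min_eq_right h]
      have h0 : ∀ (f : BoolFn n) x, levelPart (n + 1) f x = 0 := fun f x => by
        rw [levelPart, powersetCard_eq_empty.mpr (by simp), sum_empty]
      simp only [classAbsFourierSum, absFourierSum, h0, abs_zero, Real.iSup_const_zero]
      positivity
  push_cast at e3
  set E := ⌈1 / ε⌉₊
  set L : ℝ := (walkLog n E : ℝ)
  set t := walkLen n k ⌈b⌉₊ E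
  set q : ℝ := ((2 ^ stepExp n k ⌈b⌉₊ E : ℕ) : ℝ) with hq
  have e3' : 2 * b ≤ q := by rw [hq]; push_cast; linarith
  have hq0 : 0 < q := by linarith
  have hp : 1 / q ≤ 1 / 2 := one_div_le_one_div_of_le (by norm_num) (by linarith)
  have hpb : 1 / q * b ≤ 1 / 2 := by
    rw [div_mul_eq_mul_div, div_le_div_iff₀ hq0 (by norm_num)]; linarith
  have hδ1 : δ ≤ (1 / q) ^ 2 / 16 := by
    refine hδ.trans (div_le_div_of_nonneg_left (by positivity) (by norm_num) ?_)
    nlinarith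
  have hδ2 : (t : ℝ) * δ ≤ 1 / (4 * (E : ℝ)) := by
    rw [hlen]
    calc 16 * q ^ 2 * L * δ ≤ 16 * q ^ 2 * L * ((1 / q) ^ 2 / (64 * E * L)) := by gcongr
      _ = 1 / (4 * (E : ℝ)) := by field_simp; norm_num
  have main := abs_expect_walk_sub_le hF
    (fun (a : Cube (D.chunk n k ⌈b⌉₊ E)) (i : Fin n) => (-1) ^ D.dirBit n k ⌈b⌉₊ E i (signCode a))
    (p := 1 / q) (η := (2 * (1 / q) * b) ^ effLevel n k + δ) (by positivity) hp
    (fun i => by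
      have := hx {i} (by simp) (by rw [card_singleton]; omega)
      simp only [prod_singleton] at this
      exact this.trans hδ1)
    (fun f hf => abs_expect_fractional_sub_le (by omega) hF (by linarith) hM' _ (by positivity) hp
      hpb hδ0 hx (hL.imp_right fun h i h1 h2 => h i h1 (h2.trans_le hKk)) hf) t hf
  refine main.trans ?_
  have h4 : 1 / (4 * (E : ℝ)) + 1 / (4 * E) + 1 / (2 * E) = 1 / E := by field_simp; norm_num
  rw [mul_add]
  linarith

/-- The dimension of the ring, with the degree of the field onto which it maps. -/
theorem exists_ringDim {m : ℕ} (hm : 0 < m) : ∃ j, ringDim m = 3 ^ (j + 1) ∧ m ≤ 2 * 3 ^ j := by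
  have h2 : 0 < Nat.clog 3 (2 * m) := Nat.clog_pos (by norm_num) (by omega)
  obtain ⟨c, hc⟩ := Nat.exists_eq_succ_of_ne_zero h2.ne'
  have h3 := le_ringDim m
  rw [ringDim, hc, pow_succ] at h3
  exact ⟨c, by rw [ringDim, hc], by omega⟩

theorem polySource_chunk {n k B E : ℕ} :
    polySource.chunk n k B E = effLevel n k * polySource.dim n k B E := by
  rw [Source.chunk]
  exact congrArg (· * polySource.dim n k B E) (rfl : polySource.C n k B E = effLevel n k)

theorem polySource_bit (N K R i w : ℕ) : polySource.bit N K R i w = polyBit N K i w := rfl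

theorem polySource_dirBit {n k B E : ℕ} :
    polySource.dirBit n k B E = polyBit (polySource.dim n k B E) (effLevel n k) := by
  funext i w
  rw [Source.dirBit, polySource_bit]

theorem polySource_dim {n k B E : ℕ} : polySource.dim n k B E = ringDim n.size := rfl

theorem biasSource_dim {n k B E : ℕ} : biasSource.dim n k B E = ringDim (biasDim n k B E) := rfl

/-- The first generator has no bias on sets of size below the level, so the lower levels are
harmless. -/
theorem polySource_isPRG {n k : ℕ} {b ε : ℝ} (hn : 2 ≤ n) (hk : 2 < k) (hb : 1 ≤ b)
    (hε : 0 < ε) {F : Set (BoolFn n)} (hF : ClosedUnderRestrictions F)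
    (hM : classAbsFourierSum k F ≤ b ^ k) : IsPRG (polySource.gen n k b ε) F ε := by
  obtain ⟨j, hj, hd⟩ := exists_ringDim (Nat.size_pos.mpr (by omega : 0 < n))
  have hdim : polySource.dim n k ⌈b⌉₊ ⌈1 / ε⌉₊ = 3 ^ (j + 1) := by
    rw [polySource_dim, hj]
  have hchunk : polySource.chunk n k ⌈b⌉₊ ⌈1 / ε⌉₊ = effLevel n k * 3 ^ (j + 1) := by
    rw [polySource_chunk, hdim]
  have hbit : polySource.dirBit n k ⌈b⌉₊ ⌈1 / ε⌉₊ = polyBit (3 ^ (j + 1)) (effLevel n k) := by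
    rw [polySource_dirBit, hdim]
  refine gen_isPRG polySource (δ := 0) hn hk hb hε ?_ le_rfl (by positivity) ?_ hF hM (Or.inl rfl)
  · rw [hchunk, hbit]; exact fun i w w' h => polyBit_congr h
  · rw [hchunk, hbit]
    intro S h1 h2
    rw [expect_polyBit_eq_zero ((le_two_pow_size n).trans (Nat.pow_le_pow_right (by norm_num) hd))
      S h1 h2, abs_zero]

theorem biasSource_isPRG {n k : ℕ} {b ε : ℝ} (hn : 2 ≤ n) (hk : 2 < k) (hb : 1 ≤ b)
    (hε : 0 < ε) {F : Set (BoolFn n)} (hF : ClosedUnderRestrictions F)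
    (hM : classAbsFourierSum k F ≤ b ^ k)
    (hL : ∀ i : ℕ, 1 ≤ i → i < k → classFourierMass i F ≤ b ^ i) :
    IsPRG (biasSource.gen n k b ε) F ε := by
  have hE : 1 ≤ ⌈1 / ε⌉₊ := Nat.one_le_iff_ne_zero.mpr (Nat.ceil_pos.mpr (by positivity)).ne'
  have hm : 0 < biasDim n k ⌈b⌉₊ ⌈1 / ε⌉₊ := by rw [biasDim]; omega
  obtain ⟨j, hj, hd⟩ := exists_ringDim hm
  have hdim : biasSource.dim n k ⌈b⌉₊ ⌈1 / ε⌉₊ = 3 ^ (j + 1) := by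
    rw [biasSource_dim, hj]
  have hchunk : biasSource.chunk n k ⌈b⌉₊ ⌈1 / ε⌉₊ = 2 * 3 ^ (j + 1) := by
    rw [biasSource_chunk, hdim]
  have hbit : biasSource.dirBit n k ⌈b⌉₊ ⌈1 / ε⌉₊ = biasBit (3 ^ (j + 1)) (markBound n k) := by
    rw [biasSource_dirBit, hdim]
  refine gen_isPRG biasSource
    (δ := ((markBound n k * (markBound n k + 1) : ℕ) : ℝ) / 2 ^ (2 * 3 ^ j))
    hn hk hb hε ?_ (div_nonneg (Nat.cast_nonneg _) (pow_nonneg zero_le_two _))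
    (walkLen_mul_bias_le hE hd) ?_ hF hM (Or.inr hL)
  · rw [hchunk, hbit]; exact fun i w w' h => biasBit_congr h
  · rw [hchunk, hbit]
    intro S h1 h2
    have := abs_expect_biasBit_le (m := n.size) (j := j) (Nat.size_pos.mpr (by omega))
      (le_two_pow_size n) S h1 h2
    rwa [← markBound] at this

/-! ### Seed lengths -/

theorem half_le_log_two : 1 / 2 ≤ Real.log 2 := by linarith [Real.log_two_gt_d9]

theorem size_le_log {m : ℕ} (hm : 1 ≤ m) : (m.size : ℝ) ≤ 2 * Real.log m + 1 := by
  have h1 : 0 < m.size := Nat.size_pos.mpr hm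
  obtain ⟨c, hc⟩ := Nat.exists_eq_succ_of_ne_zero h1.ne'
  have h2 : 2 ^ c ≤ m := Nat.lt_size.mp (by omega)
  have h3 : (2 : ℝ) ^ c ≤ m := by exact_mod_cast h2
  have h4 := Real.log_le_log (by positivity) h3
  rw [Real.log_pow] at h4
  rw [hc]
  push_cast
  nlinarith [half_le_log_two, Nat.cast_nonneg (α := ℝ) c]

theorem two_pow_size_le {m : ℕ} (hm : 1 ≤ m) : 2 ^ m.size ≤ 2 * m := by
  have h1 : 0 < m.size := Nat.size_pos.mpr hm
  obtain ⟨c, hc⟩ := Nat.exists_eq_succ_of_ne_zero h1.ne'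
  have h2 : 2 ^ c ≤ m := Nat.lt_size.mp (by omega)
  rw [hc, pow_succ]
  omega

/-- The bound `b² Λ (b² Λ / ε) ^ r` for the length of the walk, where `r = 2 / (k - 2)`. -/
def walkBound (b Λ ε r : ℝ) : ℝ := b ^ 2 * Λ * (b ^ 2 * Λ / ε) ^ r

theorem walkBound_eq {b Λ ε r : ℝ} (hb : 0 < b) (hΛ : 0 < Λ) (hε : 0 < ε) :
    b ^ (2 + 2 * r) * Λ ^ (1 + r) / ε ^ r = walkBound b Λ ε r := by
  rw [walkBound, Real.div_rpow (by positivity) hε.le, Real.mul_rpow (by positivity) hΛ.le,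
    Real.rpow_add hb, Real.rpow_add hΛ, Real.rpow_mul hb.le, Real.rpow_one, Real.rpow_two]
  ring

section

variable {n k : ℕ} {b ε : ℝ}

theorem log_div_ge (hn : 2 ≤ n) (hε : 0 < ε) (hε1 : ε ≤ 1) : Real.log 2 ≤ Real.log (n / ε) := by
  have hn' : (2 : ℝ) ≤ n := by exact_mod_cast hn
  refine Real.log_le_log (by norm_num) ?_
  rw [le_div_iff₀ hε]
  nlinarith

theorem ceil_one_div_le (hε : 0 < ε) (hε1 : ε ≤ 1) : (⌈1 / ε⌉₊ : ℝ) ≤ 2 / ε := by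
  have h1 := Nat.ceil_lt_add_one (a := 1 / ε) (by positivity)
  have h2 : 1 ≤ 1 / ε := by rw [le_div_iff₀ hε]; linarith
  have h3 : 2 / ε = 1 / ε + 1 / ε := by ring
  linarith

theorem ceil_one_div_pos (hε : 0 < ε) : 1 ≤ ⌈1 / ε⌉₊ :=
  Nat.one_le_iff_ne_zero.mpr (Nat.ceil_pos.mpr (by positivity)).ne'

theorem ceil_le_two_mul (hb : 1 ≤ b) : (⌈b⌉₊ : ℝ) ≤ 2 * b := by
  have := Nat.ceil_lt_add_one (a := b) (by linarith); linarith

theorem walkLog_le (hn : 2 ≤ n) (hε : 0 < ε) (hε1 : ε ≤ 1) :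
    (walkLog n ⌈1 / ε⌉₊ : ℝ) ≤ 16 * Real.log (n / ε) := by
  have hE := ceil_one_div_pos hε
  have hn' : (2 : ℝ) ≤ n := by exact_mod_cast hn
  have h1 : 1 ≤ n * ⌈1 / ε⌉₊ := Nat.mul_pos (by omega) hE
  have h2 := size_le_log h1
  have h3 : Real.log ((n * ⌈1 / ε⌉₊ : ℕ) : ℝ) ≤ Real.log 2 + Real.log (n / ε) := by
    rw [← Real.log_mul (by norm_num) (by positivity)]
    refine Real.log_le_log (by exact_mod_cast h1) ?_
    push_cast
    calc (n : ℝ) * ⌈1 / ε⌉₊ ≤ n * (2 / ε) := by gcongr; exact ceil_one_div_le hε hε1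
      _ = 2 * (n / ε) := by ring
  have h4 := log_div_ge hn hε hε1
  have h5 := half_le_log_two
  rw [walkLog]
  push_cast
  linarith

/-- The rounding of the parameters to integers and powers of two costs a constant factor only. -/
theorem walkLen_le (hn : 2 ≤ n) (hk : 2 < k) (hb : 1 ≤ b) (hε : 0 < ε) (hε1 : ε ≤ 1) :
    (walkLen n k ⌈b⌉₊ ⌈1 / ε⌉₊ : ℝ) ≤
      2 ^ 54 * walkBound b (Real.log (n / ε)) ε (2 / ((effLevel n k : ℝ) - 2)) := by
  have hK : 3 ≤ effLevel n k := by rw [effLevel]; omega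
  have hE := ceil_one_div_pos hε
  have hB : 1 ≤ ⌈b⌉₊ := Nat.one_le_iff_ne_zero.mpr (Nat.ceil_pos.mpr (by linarith)).ne'
  have hlog := walkLog_le hn hε hε1
  have hΛ : 0 < Real.log (n / ε) := by
    have := log_div_ge hn hε hε1; have := half_le_log_two; linarith
  have hlogpos : 1 ≤ walkLog n ⌈1 / ε⌉₊ := by rw [walkLog]; omega
  set K := effLevel n k with hKdef
  set Λ := Real.log (n / ε) with hΛdef
  have hK' : (3 : ℝ) ≤ K := by exact_mod_cast hK
  set r : ℝ := 2 / ((K : ℝ) - 2) with hr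
  have hr0 : 0 ≤ r := div_nonneg (by norm_num) (by linarith)
  have hr2 : r ≤ 2 := by rw [hr, div_le_iff₀ (by linarith)]; linarith
  have hKr : (K : ℝ) * r = 2 + 2 * r := by
    rw [hr]; field_simp [(by linarith : (K : ℝ) - 2 ≠ 0)]; ring
  set A := 6 + (⌈1 / ε⌉₊).size + (walkLog n ⌈1 / ε⌉₊).size + (⌈b⌉₊.size + 1) * K with hA
  -- the length of the exponent is absorbed by a power of two
  have hpowA : (2 : ℝ) ^ A ≤ 2 ^ 13 * (Λ / ε) * (8 * b) ^ K := by
    rw [hA, pow_add, pow_add, pow_add, pow_mul]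
    have e1 : (2 : ℝ) ^ (⌈1 / ε⌉₊).size ≤ 2 * (2 / ε) := by
      have : (2 : ℝ) ^ (⌈1 / ε⌉₊).size ≤ 2 * ⌈1 / ε⌉₊ := by exact_mod_cast two_pow_size_le hE
      have := ceil_one_div_le hε hε1
      linarith
    have e2 : (2 : ℝ) ^ (walkLog n ⌈1 / ε⌉₊).size ≤ 32 * Λ := by
      have : (2 : ℝ) ^ (walkLog n ⌈1 / ε⌉₊).size ≤ 2 * walkLog n ⌈1 / ε⌉₊ := by
        exact_mod_cast two_pow_size_le hlogpos
      linarith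
    have e3 : (2 : ℝ) ^ (⌈b⌉₊.size + 1) ≤ 8 * b := by
      have : (2 : ℝ) ^ ⌈b⌉₊.size ≤ 2 * ⌈b⌉₊ := by exact_mod_cast two_pow_size_le hB
      have := ceil_le_two_mul hb
      rw [pow_succ]
      linarith
    calc (2 : ℝ) ^ 6 * 2 ^ (⌈1 / ε⌉₊).size * 2 ^ (walkLog n ⌈1 / ε⌉₊).size *
          (2 ^ (⌈b⌉₊.size + 1)) ^ K ≤ 2 ^ 6 * (2 * (2 / ε)) * (32 * Λ) * (8 * b) ^ K := by
          gcongr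
      _ = 2 ^ 13 * (Λ / ε) * (8 * b) ^ K := by ring
  have hexp : ((2 ^ stepExp n k ⌈b⌉₊ ⌈1 / ε⌉₊ : ℕ) : ℝ) ^ 2 ≤ 4 * ((2 : ℝ) ^ A) ^ r := by
    have e1 : (stepExp n k ⌈b⌉₊ ⌈1 / ε⌉₊ : ℝ) ≤ A / ((K : ℝ) - 2) + 1 := by
      rw [stepExp, ← hKdef, ← hA]
      push_cast
      have := Nat.cast_div_le (α := ℝ) (m := A) (n := K - 2)
      rw [Nat.cast_sub (by omega)] at this
      push_cast at this
      linarith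
    push_cast
    rw [← pow_mul, ← Real.rpow_natCast 2 (_ * 2), ← Real.rpow_natCast 2 A,
      ← Real.rpow_mul (by norm_num)]
    calc (2 : ℝ) ^ ((stepExp n k ⌈b⌉₊ ⌈1 / ε⌉₊ * 2 : ℕ) : ℝ) ≤ 2 ^ (2 + (A : ℝ) * r) := by
          refine Real.rpow_le_rpow_of_exponent_le (by norm_num) ?_
          have : (A : ℝ) * r = 2 * (A / ((K : ℝ) - 2)) := by rw [hr]; ring
          push_cast
          linarith
      _ = 4 * 2 ^ ((A : ℝ) * r) := by
          rw [Real.rpow_add (by norm_num)]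
          norm_num
  have hArpow : ((2 : ℝ) ^ A) ^ r ≤ 2 ^ 44 * (b ^ 2 * (b ^ 2 * Λ / ε) ^ r) := by
    have hb0 : 0 < b := by linarith
    calc ((2 : ℝ) ^ A) ^ r ≤ (2 ^ 13 * (Λ / ε) * (8 * b) ^ K) ^ r :=
          Real.rpow_le_rpow (by positivity) hpowA hr0
      _ = (2 ^ 13 : ℝ) ^ r * (Λ / ε) ^ r * (8 * b) ^ (2 + 2 * r) := by
          rw [Real.mul_rpow (by positivity) (by positivity),
            Real.mul_rpow (by positivity) (by positivity),
            ← Real.rpow_natCast_mul (by positivity : (0 : ℝ) ≤ 8 * b) K r, hKr]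
      _ = (2 ^ 13 : ℝ) ^ r * (8 : ℝ) ^ (2 + 2 * r) * (b ^ 2 * (b ^ 2 * Λ / ε) ^ r) := by
          rw [Real.mul_rpow (by norm_num) hb0.le, Real.rpow_add hb0, Real.rpow_mul hb0.le,
            mul_div_assoc (b ^ 2), Real.mul_rpow (by positivity) (by positivity), Real.rpow_two]
          ring
      _ ≤ (2 ^ 13 : ℝ) ^ (2 : ℝ) * (8 : ℝ) ^ (6 : ℝ) * (b ^ 2 * (b ^ 2 * Λ / ε) ^ r) := by
          have e1 : (2 ^ 13 : ℝ) ^ r ≤ (2 ^ 13 : ℝ) ^ (2 : ℝ) :=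
            Real.rpow_le_rpow_of_exponent_le (by norm_num) hr2
          have e2 : (8 : ℝ) ^ (2 + 2 * r) ≤ (8 : ℝ) ^ (6 : ℝ) :=
            Real.rpow_le_rpow_of_exponent_le (by norm_num) (by linarith)
          gcongr
      _ = 2 ^ 44 * (b ^ 2 * (b ^ 2 * Λ / ε) ^ r) := by
          norm_num
  have hlen : (walkLen n k ⌈b⌉₊ ⌈1 / ε⌉₊ : ℝ) =
      16 * ((2 ^ stepExp n k ⌈b⌉₊ ⌈1 / ε⌉₊ : ℕ) : ℝ) ^ 2 * walkLog n ⌈1 / ε⌉₊ := by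
    rw [walkLen]; push_cast; ring
  rw [hlen]
  calc 16 * ((2 ^ stepExp n k ⌈b⌉₊ ⌈1 / ε⌉₊ : ℕ) : ℝ) ^ 2 * walkLog n ⌈1 / ε⌉₊ ≤
        16 * (4 * (2 ^ 44 * (b ^ 2 * (b ^ 2 * Λ / ε) ^ r))) * (16 * Λ) := by
        gcongr
        exact hexp.trans (by gcongr)
    _ = 2 ^ 54 * walkBound b Λ ε r := by rw [walkBound]; ring

theorem one_fourth_le_rpow {x r : ℝ} (hx : 1 / 2 ≤ x) (hr0 : 0 ≤ r) (hr2 : r ≤ 2) :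
    1 / 4 ≤ x ^ r := by
  calc (1 / 4 : ℝ) = (1 / 2) ^ (2 : ℝ) := by norm_num
    _ ≤ (1 / 2) ^ r := Real.rpow_le_rpow_of_exponent_ge (by norm_num) (by norm_num) hr2
    _ ≤ x ^ r := Real.rpow_le_rpow (by norm_num) hx hr0

theorem le_walkBound {Λ r : ℝ} (hb : 1 ≤ b) (hε : 0 < ε) (hε1 : ε ≤ 1) (hΛ : 1 / 2 ≤ Λ)
    (hr0 : 0 ≤ r) (hr2 : r ≤ 2) : b ^ 2 * Λ ≤ 4 * walkBound b Λ ε r := by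
  have h1 : 1 / 2 ≤ b ^ 2 * Λ := by nlinarith
  have h2 : 1 / 2 ≤ b ^ 2 * Λ / ε := by
    rw [le_div_iff₀ hε]; nlinarith
  have h3 := one_fourth_le_rpow h2 hr0 hr2
  rw [walkBound]
  nlinarith

theorem seedLen_le_n (D : Source) : D.seedLen n k b ε ≤ n := by
  rw [Source.seedLen]; split_ifs with h <;> omega

theorem seedLen_le_walkSeed (D : Source) :
    D.seedLen n k b ε ≤ D.walkSeed n k ⌈b⌉₊ ⌈1 / ε⌉₊ := by
  rw [Source.seedLen]; split_ifs with h <;> omega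

theorem exponent_bounds (hk : 2 < k) :
    0 ≤ 2 / ((k : ℝ) - 2) ∧ 2 / ((k : ℝ) - 2) ≤ 2 := by
  have hk' : (3 : ℝ) ≤ k := by exact_mod_cast hk
  exact ⟨div_nonneg (by norm_num) (by linarith), by rw [div_le_iff₀ (by linarith)]; linarith⟩

theorem polySource_seedLen_le (hn : 2 ≤ n) (hk : 2 < k) (hb : 1 ≤ b) (hε : 0 < ε) (hε1 : ε ≤ 1) :
    (polySource.seedLen n k b ε : ℝ) ≤
      2 ^ 60 * (walkBound b (Real.log (n / ε)) ε (2 / ((k : ℝ) - 2)) * (k * Real.log n)) := by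
  have hn' : (2 : ℝ) ≤ n := by exact_mod_cast hn
  have hlogn : 1 / 2 ≤ Real.log n := half_le_log_two.trans (Real.log_le_log (by norm_num) hn')
  have hΛ : 1 / 2 ≤ Real.log (n / ε) := half_le_log_two.trans (log_div_ge hn hε hε1)
  obtain ⟨hr0, hr2⟩ := exponent_bounds hk
  have hS := le_walkBound hb hε hε1 hΛ hr0 hr2
  have hS' : 1 / 8 ≤ walkBound b (Real.log (n / ε)) ε (2 / ((k : ℝ) - 2)) := by nlinarith
  rcases le_total k (n + 1) with h | h
  · have hK : effLevel n k = k := min_eq_left h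
    have h1 := walkLen_le hn hk hb hε hε1
    rw [hK] at h1
    have h2 : (polySource.seedLen n k b ε : ℝ) ≤ polySource.walkSeed n k ⌈b⌉₊ ⌈1 / ε⌉₊ := by
      exact_mod_cast seedLen_le_walkSeed polySource
    have h3 : (ringDim n.size : ℝ) ≤ 24 * Real.log n := by
      have h4 : (ringDim n.size : ℝ) ≤ 6 * n.size := by
        exact_mod_cast (ringDim_lt (Nat.size_pos.mpr (by omega : 0 < n))).le
      have h5 := size_le_log (by omega : 1 ≤ n)
      linarith
    rw [Source.walkSeed, polySource_chunk, polySource_dim, hK] at h2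
    push_cast at h2
    refine h2.trans ?_
    set S := walkBound b (Real.log (n / ε)) ε (2 / ((k : ℝ) - 2))
    calc (walkLen n k ⌈b⌉₊ ⌈1 / ε⌉₊ : ℝ) * (k * ringDim n.size) ≤
          2 ^ 54 * S * (k * (24 * Real.log n)) := by gcongr
      _ = 24 * 2 ^ 54 * (S * (k * Real.log n)) := by ring
      _ ≤ 2 ^ 60 * (S * (k * Real.log n)) := by
          gcongr
          norm_num
  -- the seed is never longer than `n`, which is below `k` here
  · have h2 : (polySource.seedLen n k b ε : ℝ) ≤ k := by
      exact_mod_cast (seedLen_le_n polySource).trans (by omega)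
    set S := walkBound b (Real.log (n / ε)) ε (2 / ((k : ℝ) - 2))
    have h3 : (1 / 16 : ℝ) ≤ S * Real.log n := by nlinarith
    have h4 : (k : ℝ) * (1 / 16) ≤ k * (S * Real.log n) := by gcongr
    have h5 : (0 : ℝ) ≤ k := Nat.cast_nonneg k
    linarith

/-- The factor for the length of the directions in the second generator. -/
def logFactor (n k : ℕ) (b ε : ℝ) : ℝ := Real.log (Real.log n) + Real.log k + Real.log (b / ε)

/-- The term `log k` makes up for the possibly negative term `log (log n)`. -/
theorem half_le_logFactor (hn : 2 ≤ n) (hk : 2 < k) (hb : 1 ≤ b) (hε : 0 < ε) (hε1 : ε ≤ 1) :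
    1 / 2 ≤ logFactor n k b ε := by
  have hn' : (2 : ℝ) ≤ n := by exact_mod_cast hn
  have hk' : (3 : ℝ) ≤ k := by exact_mod_cast hk
  have h2 := Real.log_two_gt_d9
  have hlogn : Real.log 2 ≤ Real.log n := Real.log_le_log (by norm_num) hn'
  have h1 : Real.log 2 ≤ Real.log (Real.log n) + Real.log k := by
    rw [← Real.log_mul (by linarith) (by linarith)]
    exact Real.log_le_log (by norm_num) (by nlinarith)
  have h3 : 0 ≤ Real.log (b / ε) := Real.log_nonneg (by rw [le_div_iff₀ hε]; linarith)
  rw [logFactor]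
  linarith

theorem biasDim_le_logFactor (hn : 2 ≤ n) (hk : 2 < k) (hb : 1 ≤ b) (hε : 0 < ε) (hε1 : ε ≤ 1) :
    (biasDim n k ⌈b⌉₊ ⌈1 / ε⌉₊ : ℝ) ≤ 315 * logFactor n k b ε := by
  have hn' : (2 : ℝ) ≤ n := by exact_mod_cast hn
  have hk' : (3 : ℝ) ≤ k := by exact_mod_cast hk
  have hE := ceil_one_div_pos hε
  have hB : 1 ≤ ⌈b⌉₊ := Nat.one_le_iff_ne_zero.mpr (Nat.ceil_pos.mpr (by linarith)).ne'
  have l2 := Real.log_two_gt_d9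
  have l2' := Real.log_two_lt_d9
  have hlogn : Real.log 2 ≤ Real.log n := Real.log_le_log (by norm_num) hn'
  have hlogn0 : 0 < Real.log n := by linarith
  have hX : 0 ≤ Real.log (1 / ε) := Real.log_nonneg (by rw [le_div_iff₀ hε]; linarith)
  have hY : 0 ≤ Real.log b := Real.log_nonneg hb
  have hW : Real.log (b / ε) = Real.log (1 / ε) + Real.log b := by
    rw [Real.log_div (by linarith) hε.ne', Real.log_div one_ne_zero hε.ne', Real.log_one]; ring
  have hlogk : 1 ≤ Real.log k := by
    rw [Real.le_log_iff_exp_le (by linarith)]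
    have := Real.exp_one_lt_d9
    linarith
  have hu : -1 ≤ Real.log (Real.log n) := by
    rw [Real.le_log_iff_exp_le hlogn0]
    have : Real.exp (-1) ≤ 1 / 2 := by
      rw [Real.exp_neg, ← one_div]
      refine one_div_le_one_div_of_le (by norm_num) ?_
      have := Real.add_one_le_exp (1 : ℝ); linarith
    linarith
  have hΛ : Real.log (n / ε) = Real.log n + Real.log (1 / ε) := by
    rw [Real.log_div (by linarith) hε.ne', Real.log_div one_ne_zero hε.ne', Real.log_one]; ring
  have hD := half_le_logFactor hn hk hb hε hε1
  have l16 : Real.log 16 ≤ 3 := by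
    rw [show (16 : ℝ) = 2 ^ 4 by norm_num, Real.log_pow]; push_cast; linarith
  have l4 : Real.log 4 = 2 * Real.log 2 := by
    rw [show (4 : ℝ) = 2 ^ 2 by norm_num, Real.log_pow]; push_cast; ring
  have s1 : ((⌈1 / ε⌉₊).size : ℝ) ≤ 2 * Real.log (1 / ε) + 3 := by
    have h1 := size_le_log hE
    have h2 : Real.log (⌈1 / ε⌉₊ : ℝ) ≤ Real.log 2 + Real.log (1 / ε) := by
      rw [← Real.log_mul (by norm_num) (by positivity)]
      refine Real.log_le_log (by exact_mod_cast hE) ?_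
      rw [mul_one_div]; exact ceil_one_div_le hε hε1
    linarith
  have s2 : ((walkLog n ⌈1 / ε⌉₊).size : ℝ) ≤
      9 + 2 * Real.log (Real.log n) + 4 * Real.log (1 / ε) := by
    have hpos : 1 ≤ walkLog n ⌈1 / ε⌉₊ := by rw [walkLog]; omega
    have h1 := size_le_log hpos
    have h2 := walkLog_le hn hε hε1
    have h3 : Real.log (walkLog n ⌈1 / ε⌉₊ : ℝ) ≤
        Real.log 16 + Real.log (Real.log n) + Real.log (1 + 2 * Real.log (1 / ε)) := by
      rw [← Real.log_mul (by norm_num) hlogn0.ne', ← Real.log_mul (by positivity) (by positivity)]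
      refine Real.log_le_log (by exact_mod_cast hpos) (h2.trans ?_)
      rw [hΛ]
      nlinarith
    have h4 : Real.log (1 + 2 * Real.log (1 / ε)) ≤ 2 * Real.log (1 / ε) := by
      have := Real.log_le_sub_one_of_pos (by linarith : 0 < 1 + 2 * Real.log (1 / ε))
      linarith
    linarith
  have s3 : (⌈b⌉₊.size : ℝ) ≤ 2 * Real.log b + 3 := by
    have h1 := size_le_log hB
    have h2 : Real.log (⌈b⌉₊ : ℝ) ≤ Real.log 2 + Real.log b := by
      rw [← Real.log_mul (by norm_num) (by linarith)]
      exact Real.log_le_log (by exact_mod_cast hB) (ceil_le_two_mul hb)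
    linarith
  have s4 : (stepExp n k ⌈b⌉₊ ⌈1 / ε⌉₊ : ℝ) ≤
      7 + (⌈1 / ε⌉₊).size + (walkLog n ⌈1 / ε⌉₊).size + 3 * (⌈b⌉₊.size + 1) := by
    exact_mod_cast stepExp_le_add hn hk
  have s5 : ((markBound n k * (markBound n k + 1)).size : ℝ) ≤
      13 + 4 * Real.log k + 4 * (Real.log (Real.log n) + 1) := by
    have hsn := size_le_log (by omega : 1 ≤ n)
    have hsn1 : (1 : ℝ) ≤ n.size := by exact_mod_cast Nat.size_pos.mpr (by omega : 0 < n)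
    have hm : 1 ≤ markBound n k := by
      have : 0 < effLevel n k := by rw [effLevel]; omega
      have := Nat.mul_pos this (Nat.size_pos.mpr (by omega : 0 < n))
      rw [markBound]; omega
    have hmle : (markBound n k : ℝ) ≤ 2 * (k * n.size) := by
      have : effLevel n k * n.size ≤ k * n.size := Nat.mul_le_mul_right _ (min_le_left _ _)
      rw [markBound]
      exact_mod_cast Nat.mul_le_mul_left 2 this
    have hm' : (1 : ℝ) ≤ markBound n k := by exact_mod_cast hm
    have h1 := size_le_log (Nat.mul_pos hm (Nat.succ_pos (markBound n k)) :
      1 ≤ markBound n k * (markBound n k + 1))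
    have h2 : Real.log ((markBound n k * (markBound n k + 1) : ℕ) : ℝ) ≤
        2 * Real.log (4 * (k * n.size)) := by
      rw [← Real.log_rpow (by positivity), Real.rpow_two]
      push_cast
      refine Real.log_le_log (by positivity) ?_
      nlinarith
    have h3 : Real.log (4 * (k * (n.size : ℝ))) =
        Real.log 4 + (Real.log k + Real.log n.size) := by
      rw [Real.log_mul (by norm_num) (by positivity), Real.log_mul (by positivity) (by positivity)]
    have h4 : Real.log (n.size : ℝ) ≤ Real.log 4 + Real.log (Real.log n) := by
      rw [← Real.log_mul (by norm_num) hlogn0.ne']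
      exact Real.log_le_log (by linarith) (by linarith)
    linarith
  rw [biasDim]
  push_cast
  rw [logFactor] at hD ⊢
  linarith

/-- At level `n + 1`, the last factor of the bound is constant if `b ^ 2 Λ < n`. -/
theorem walkBound_le_of_lt {Λ : ℝ} (hn : 2 ≤ n) (hb : 1 ≤ b) (hε : 0 < ε)
    (hΛ : Λ = Real.log (n / ε)) (hΛ0 : 0 < Λ) (hlt : b ^ 2 * Λ < n) :
    walkBound b Λ ε (2 / (((n + 1 : ℕ) : ℝ) - 2)) ≤ 2 ^ 13 * (b ^ 2 * Λ) := by
  have hn' : (2 : ℝ) ≤ n := by exact_mod_cast hn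
  have h1 : Λ < n := (le_mul_of_one_le_left hΛ0.le (one_le_pow₀ hb)).trans_lt hlt
  have h2 : b ^ 2 * Λ / ε ≤ Real.exp n ^ 2 := by
    have h3 : (n : ℝ) / ε ≤ Real.exp n := by
      rw [← Real.exp_log (by positivity : (0 : ℝ) < n / ε), ← hΛ]
      exact Real.exp_le_exp.mpr h1.le
    have h4 : b ^ 2 * Λ / ε ≤ n / ε := by gcongr
    have h5 : 1 ≤ Real.exp n := Real.one_le_exp (by linarith)
    nlinarith
  have h6 : (b ^ 2 * Λ / ε) ^ (2 / (((n + 1 : ℕ) : ℝ) - 2)) ≤ 2 ^ 13 := by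
    have hr0 : 0 ≤ 2 / (((n + 1 : ℕ) : ℝ) - 2) := by
      push_cast; exact div_nonneg (by norm_num) (by linarith)
    calc (b ^ 2 * Λ / ε) ^ (2 / (((n + 1 : ℕ) : ℝ) - 2)) ≤
          (Real.exp n ^ 2) ^ (2 / (((n + 1 : ℕ) : ℝ) - 2)) :=
          Real.rpow_le_rpow (by positivity) h2 hr0
      _ = Real.exp (2 * n * (2 / (((n + 1 : ℕ) : ℝ) - 2))) := by
          rw [← Real.exp_nat_mul, ← Real.exp_mul]; push_cast; ring_nf
      _ ≤ Real.exp 8 := by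
          refine Real.exp_le_exp.mpr ?_
          push_cast
          rw [mul_div_assoc', div_le_iff₀ (by linarith)]
          linarith
      _ = Real.exp 1 ^ 8 := by rw [← Real.exp_nat_mul]; norm_num
      _ ≤ 3 ^ 8 := by
          have := Real.exp_one_lt_d9
          gcongr
          linarith
      _ ≤ 2 ^ 13 := by norm_num
  rw [walkBound, mul_comm (2 ^ 13)]
  gcongr

theorem biasSource_seedLen_le (hn : 2 ≤ n) (hk : 2 < k) (hb : 1 ≤ b) (hε : 0 < ε) (hε1 : ε ≤ 1) :
    (biasSource.seedLen n k b ε : ℝ) ≤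
      2 ^ 81 * (walkBound b (Real.log (n / ε)) ε (2 / ((k : ℝ) - 2)) * logFactor n k b ε) := by
  have hn' : (2 : ℝ) ≤ n := by exact_mod_cast hn
  have hΛ : 1 / 2 ≤ Real.log (n / ε) := half_le_log_two.trans (log_div_ge hn hε hε1)
  obtain ⟨hr0, hr2⟩ := exponent_bounds hk
  have hS := le_walkBound hb hε hε1 hΛ hr0 hr2
  have hD := half_le_logFactor hn hk hb hε hε1
  have hlen := walkLen_le hn hk hb hε hε1
  have hchunk : (biasSource.chunk n k ⌈b⌉₊ ⌈1 / ε⌉₊ : ℝ) ≤ 2 ^ 12 * logFactor n k b ε := by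
    rw [biasSource_chunk, biasSource_dim]
    have h1 : (ringDim (biasDim n k ⌈b⌉₊ ⌈1 / ε⌉₊) : ℝ) ≤ 6 * biasDim n k ⌈b⌉₊ ⌈1 / ε⌉₊ := by
      exact_mod_cast (ringDim_lt (by rw [biasDim]; omega)).le
    have h2 := biasDim_le_logFactor hn hk hb hε hε1
    push_cast
    linarith
  have hseed : (biasSource.seedLen n k b ε : ℝ) ≤
      walkLen n k ⌈b⌉₊ ⌈1 / ε⌉₊ * biasSource.chunk n k ⌈b⌉₊ ⌈1 / ε⌉₊ := by
    have : (biasSource.seedLen n k b ε : ℝ) ≤ biasSource.walkSeed n k ⌈b⌉₊ ⌈1 / ε⌉₊ := by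
      exact_mod_cast seedLen_le_walkSeed biasSource
    rw [Source.walkSeed] at this
    push_cast at this
    exact this
  have hseedn : (biasSource.seedLen n k b ε : ℝ) ≤ n := by
    exact_mod_cast seedLen_le_n biasSource
  have hb2 : 1 ≤ b ^ 2 := by nlinarith
  set Λ := Real.log (n / ε) with hΛdef
  set S := walkBound b Λ ε (2 / ((k : ℝ) - 2))
  set L := logFactor n k b ε
  have hS0 : 0 ≤ S := by nlinarith
  have hΛ0 : 0 < Λ := by linarith
  rcases le_or_gt k (n + 1) with h | h
  · have hK : effLevel n k = k := min_eq_left h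
    rw [hK] at hlen
    calc (biasSource.seedLen n k b ε : ℝ) ≤ 2 ^ 54 * S * (2 ^ 12 * L) :=
          hseed.trans (mul_le_mul hlen hchunk (Nat.cast_nonneg _) (by positivity))
      _ = 2 ^ 66 * (S * L) := by ring
      _ ≤ 2 ^ 81 * (S * L) := by
          have : 0 ≤ S * L := mul_nonneg hS0 (by linarith)
          gcongr <;> norm_num
  -- the walk uses the level `n + 1`; either the trivial bound `n` suffices, or the level is
  -- immaterial
  · rcases le_or_gt (n : ℝ) (b ^ 2 * Λ) with h' | h'
    · have : 0 ≤ S * L := mul_nonneg hS0 (by linarith)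
      have : S * (1 / 2) ≤ S * L := by gcongr
      linarith
    · have hK : effLevel n k = n + 1 := min_eq_right h.le
      rw [hK] at hlen
      have h1 := walkBound_le_of_lt hn hb hε hΛdef hΛ0 h'
      have h2 : (walkLen n k ⌈b⌉₊ ⌈1 / ε⌉₊ : ℝ) ≤ 2 ^ 54 * (2 ^ 13 * (4 * S)) :=
        hlen.trans (by gcongr; exact h1.trans (by gcongr))
      calc (biasSource.seedLen n k b ε : ℝ) ≤ 2 ^ 54 * (2 ^ 13 * (4 * S)) * (2 ^ 12 * L) :=
            hseed.trans (mul_le_mul h2 hchunk (Nat.cast_nonneg _) (by positivity))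
        _ = 2 ^ 81 * (S * L) := by ring

end

end

theorem mainTheorem2 :
    (∃ (C : ℝ) (s : ℕ → ℕ → ℝ → ℝ → ℕ)
        (G : (n k : ℕ) → (b ε : ℝ) → Cube (s n k b ε) → Cube n),
      IsExplicit s G ∧
      ∀ (n k : ℕ) (b ε : ℝ), 2 ≤ n → 2 < k → 1 ≤ b → 0 < ε → ε ≤ 1 →
        (s n k b ε : ℝ) ≤
          C * (b ^ (2 + 4 / ((k : ℝ) - 2)) * (k * Real.log n) *
            Real.log (n / ε) ^ (1 + 2 / ((k : ℝ) - 2)) / ε ^ (2 / ((k : ℝ) - 2))) ∧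
        ∀ F : Set (BoolFn n), ClosedUnderRestrictions F →
          classAbsFourierSum k F ≤ b ^ k →
          IsPRG (G n k b ε) F ε) ∧
    (∃ (C : ℝ) (s : ℕ → ℕ → ℝ → ℝ → ℕ)
        (G : (n k : ℕ) → (b ε : ℝ) → Cube (s n k b ε) → Cube n),
      IsExplicit s G ∧
      ∀ (n k : ℕ) (b ε : ℝ), 2 ≤ n → 2 < k → 1 ≤ b → 0 < ε → ε ≤ 1 →
        (s n k b ε : ℝ) ≤
          C * (b ^ (2 + 4 / ((k : ℝ) - 2)) *
            (Real.log (Real.log n) + Real.log k + Real.log (b / ε)) *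
            Real.log (n / ε) ^ (1 + 2 / ((k : ℝ) - 2)) / ε ^ (2 / ((k : ℝ) - 2))) ∧
        ∀ F : Set (BoolFn n), ClosedUnderRestrictions F →
          classAbsFourierSum k F ≤ b ^ k →
          (∀ i : ℕ, 1 ≤ i → i < k → classFourierMass i F ≤ b ^ i) →
          IsPRG (G n k b ε) F ε) := by
  have key : ∀ (n k : ℕ) (b ε X : ℝ), 2 ≤ n → 1 ≤ b → 0 < ε → ε ≤ 1 →
      b ^ (2 + 4 / ((k : ℝ) - 2)) * X * Real.log (n / ε) ^ (1 + 2 / ((k : ℝ) - 2)) /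
        ε ^ (2 / ((k : ℝ) - 2)) =
      walkBound b (Real.log (n / ε)) ε (2 / ((k : ℝ) - 2)) * X := by
    intro n k b ε X hn hb hε hε1
    have hΛ : 1 / 2 ≤ Real.log (n / ε) := half_le_log_two.trans (log_div_ge hn hε hε1)
    rw [← walkBound_eq (by linarith) (by linarith) hε,
      show 2 * (2 / ((k : ℝ) - 2)) = 4 / ((k : ℝ) - 2) by ring]
    ring
  refine ⟨⟨2 ^ 60, polySource.seedLen, polySource.gen, isExplicit_gen polySource_computes,
    fun n k b ε hn hk hb hε hε1 => ⟨?_, fun F hF hM => polySource_isPRG hn hk hb hε hF hM⟩⟩,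
    ⟨2 ^ 81, biasSource.seedLen, biasSource.gen, isExplicit_gen biasSource_computes,
    fun n k b ε hn hk hb hε hε1 => ⟨?_, fun F hF hM hL => biasSource_isPRG hn hk hb hε hF hM hL⟩⟩⟩
  · rw [key n k b ε _ hn hb hε hε1]
    exact polySource_seedLen_le hn hk hb hε hε1
  · rw [key n k b ε _ hn hb hε hε1]
    exact biasSource_seedLen_le hn hk hb hε hε1
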